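/- Let $\mathcal M$ be a compact, connected, orientable smooth surface with a smooth nondegenerate area form $\omega$, and let $(\phi_t)_{t\in\mathbb R}$ be the smooth flow of a $C^\infty$ vector field $X$ on $\mathcal M$ that preserves $\omega$. A local Hamiltonian is a smooth real function $H$ on an open set with $dH=\omega(X,\cdot)$. A fixed point is a zero of $X$; it is a saddle if the local Hamiltonian does not attain a local maximum or minimum at it. A stable (unstable) separatrix is the trajectory of a non-fixed point that converges to a fixed point as $t\to+\infty$ (as $t\to-\infty$); a separatrix connection is a trajectory that is both. Assume that $(\phi_t)$ has finitely many (possibly no) fixed points and finitely many separatrices. A separatrix path connecting $p$ with $q$ consists of saddles $s_1,\dots,s_N$, $N\ge 1$ (not necessarily distinct), such that $\phi_t(p)\to s_1$ as $t\to+\infty$, $\phi_t(q)\to s_N$ as $t\to-\infty$, and for each $1\le i<N$ there is a separatrix connection beginning at $s_i$ and ending at $s_{i+1}$, together with these pieces of trajectories ($p=s_1$ or $q=s_N$ is allowed). Let $\Gamma\subset\mathcal M$ be a transversal: a compact, smooth, simple arc everywhere transversal to $X$. Let $H$ be a local Hamiltonian defined around $\Gamma$; it parametrizes $\Gamma$,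 with values running from $a$ to $b$, $a<b$, and we identify $\Gamma\cong[a,b]$ through $H$. The first return map $P$ sends $x\in\Gamma$ to $\phi_\tau(x)$, where $\tau>0$ is the least positive time with $\phi_\tau(x)\in\Gamma$, if it exists. Let $\mathcal D\subset\Gamma$ be the set of all $x\in\Gamma$ such that (1) $x$ is an endpoint of $\Gamma$; or (2) $\phi_{(0,\infty)}(x)$ intersects $\Gamma$ and the first such intersection is an endpoint of $\Gamma$; or (3) $\phi_{(0,\infty)}(x)$ does not intersect $\Gamma$ and $\phi_t(x)$ converges to a saddle as $t\to+\infty$. Then $\mathcal D$ is finite, and there exists a right-continuous interval exchange transformation $T:[a,b)\to[a,b)$ (a bijection for which there are $N\ge1$, $a=a_0<\dots<a_N=b$ and $\sigma_1,\dots,\sigma_N\in\mathbb R$ with $Tx=x+\sigma_i$ for $x\in[a_{i-1},a_i)$) such that: (i) for each $x\in[a,b)\setminus\mathcal D$ the first return point $P(x)$ is well defined and coincides with $T(x)$; (ii) every discontinuity of $T$ belongs to $\mathcal D$; (iii) if $P$ is not defined at some $x\in\mathcal D\cap[a,b)$, then there exist a separatrix path connecting $x$ with $T(x)$ and, provided that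 $x>a$, a separatrix path connecting $x$ with $\lim_{y\to x^-}T(y)$ (this limit exists and lies in $[a,b]\cong\Gamma$). -/

import Mathlib

open Set Filter Topology
open scoped Manifold ContDiff Bundle

/-- A smooth area-preserving flow on a surface `M`: a smooth vector field `X`, the smooth flow `φ`
it generates, and a smooth nondegenerate area form `area` (written `ω` below) preserved by the flow.
(A surface carrying a nondegenerate area form is orientable.) -/
structure AreaPreservingFlow (M : Type*) [TopologicalSpace M]
    [ChartedSpace (EuclideanSpace ℝ (Fin 2)) M] [IsManifold (𝓡 2) ∞ M] where
  /-- the vector field -/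
  X : ∀ x : M, TangentSpace (𝓡 2) x
  X_smooth : ContMDiff (𝓡 2) (𝓡 2).tangent ∞ (fun x => (⟨x, X x⟩ : TangentBundle (𝓡 2) M))
  /-- the flow -/
  φ : Flow ℝ M
  φ_smooth : ContMDiff (𝓘(ℝ, ℝ).prod (𝓡 2)) (𝓡 2) ∞ (fun p : ℝ × M => φ p.1 p.2)
  φ_integral : ∀ x : M, IsMIntegralCurve (I := 𝓡 2) (fun t => φ t x) X
  /-- the area form -/
  area : ∀ x : M, TangentSpace (𝓡 2) x →L[ℝ] (TangentSpace (𝓡 2) x →L[ℝ] ℝ)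
  area_smooth : ContMDiff (𝓡 2)
    ((𝓡 2).prod 𝓘(ℝ, EuclideanSpace ℝ (Fin 2) →L[ℝ] (EuclideanSpace ℝ (Fin 2) →L[ℝ] ℝ))) ∞
    (fun x => Bundle.TotalSpace.mk' (EuclideanSpace ℝ (Fin 2) →L[ℝ] (EuclideanSpace ℝ (Fin 2) →L[ℝ] ℝ))
      (E := fun y : M => TangentSpace (𝓡 2) y →L[ℝ] (TangentSpace (𝓡 2) y →L[ℝ] ℝ)) x (area x))
  area_alternating : ∀ (x : M) (v : TangentSpace (𝓡 2) x), area x v v = 0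
  area_nondegenerate : ∀ (x : M) (v : TangentSpace (𝓡 2) x), v ≠ 0 → ∃ w, area x v w ≠ 0
  area_preserved : ∀ (t : ℝ) (x : M) (v w : TangentSpace (𝓡 2) x),
    area (φ t x) (mfderiv (𝓡 2) (𝓡 2) (φ t) x v) (mfderiv (𝓡 2) (𝓡 2) (φ t) x w) = area x v w

namespace AreaPreservingFlow

variable {M : Type*} [TopologicalSpace M] [ChartedSpace (EuclideanSpace ℝ (Fin 2)) M]
  [IsManifold (𝓡 2) ∞ M]

/-- The set of fixed points (zeroes of the vector field). -/
def fixedPoints (F : AreaPreservingFlow M) : Set M := {x | F.X x = 0}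

/-- `H` is a local Hamiltonian on the open set `U`: `dH(Y) = ω(X, Y)` on `U`. -/
structure IsLocalHamiltonian (F : AreaPreservingFlow M) (U : Set M) (H : M → ℝ) : Prop where
  isOpen : IsOpen U
  smooth : ContMDiffOn (𝓡 2) 𝓘(ℝ, ℝ) ∞ H U
  deriv_eq : ∀ x ∈ U, ∀ v : TangentSpace (𝓡 2) x,
    mfderiv (𝓡 2) 𝓘(ℝ, ℝ) H x v = F.area x (F.X x) v

/-- A saddle: a fixed point at which the local Hamiltonian has no local maximum or minimum.
(Two local Hamiltonians near `p` differ by a constant near `p`.) -/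
def IsSaddle (F : AreaPreservingFlow M) (p : M) : Prop :=
  p ∈ F.fixedPoints ∧
    ∃ (U : Set M) (H : M → ℝ), p ∈ U ∧ F.IsLocalHamiltonian U H ∧ ¬ IsLocalExtr H p

/-- The trajectory of `x`. -/
def trajectory (F : AreaPreservingFlow M) (x : M) : Set M := range (fun t : ℝ => F.φ t x)

/-- The forward trajectory of `x` ends at the fixed point `p`. -/
def EndsAt (F : AreaPreservingFlow M) (x p : M) : Prop :=
  p ∈ F.fixedPoints ∧ Tendsto (fun t : ℝ => F.φ t x) atTop (𝓝 p)

/-- The backward trajectory of `x` begins at the fixed point `p`. -/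
def BeginsAt (F : AreaPreservingFlow M) (x p : M) : Prop :=
  p ∈ F.fixedPoints ∧ Tendsto (fun t : ℝ => F.φ t x) atBot (𝓝 p)

/-- A stable separatrix: the trajectory of a non-fixed point that ends at a fixed point. -/
def IsStableSeparatrix (F : AreaPreservingFlow M) (S : Set M) : Prop :=
  ∃ x, x ∉ F.fixedPoints ∧ S = F.trajectory x ∧ ∃ p, F.EndsAt x p

/-- An unstable separatrix: the trajectory of a non-fixed point that begins at a fixed point. -/
def IsUnstableSeparatrix (F : AreaPreservingFlow M) (S : Set M) : Prop :=
  ∃ x, x ∉ F.fixedPoints ∧ S = F.trajectory x ∧ ∃ p, F.BeginsAt x p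

/-- The set of all separatrices. -/
def separatrices (F : AreaPreservingFlow M) : Set (Set M) :=
  {S | F.IsStableSeparatrix S ∨ F.IsUnstableSeparatrix S}

/-- There is a separatrix connection that begins at `p` and ends at `q`. -/
def HasSeparatrixConnection (F : AreaPreservingFlow M) (p q : M) : Prop :=
  ∃ x, x ∉ F.fixedPoints ∧ F.BeginsAt x p ∧ F.EndsAt x q

/-- There is a separatrix path connecting `x` with `y`, passing through the saddles
`s 0, …, s n` (at least one, possibly with repetitions). If `x` is itself a fixed point, then
`F.EndsAt x (s 0)` says that `x = s 0`; likewise for `y`. -/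
def ExistsSeparatrixPath (F : AreaPreservingFlow M) (x y : M) : Prop :=
  ∃ (n : ℕ) (s : Fin (n + 1) → M),
    (∀ i, F.IsSaddle (s i)) ∧
    F.EndsAt x (s 0) ∧
    (∀ i : Fin n, F.HasSeparatrixConnection (s i.castSucc) (s i.succ)) ∧
    F.BeginsAt y (s (Fin.last n))

/-- `y` is the first point in which `φ_{(0,∞)}(x)` meets `Γ`. For `x ∈ Γ` this says that the
first return map to `Γ` is defined at `x`, with value `y`. -/
def IsFirstReturn (F : AreaPreservingFlow M) (Γ : Set M) (x y : M) : Prop :=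
  ∃ τ : ℝ, IsLeast {t : ℝ | 0 < t ∧ F.φ t x ∈ Γ} τ ∧ y = F.φ τ x

/-- A transversal `Γ ≅ [a, b]`: a compact smooth embedded arc, everywhere transversal to `X`,
with a local Hamiltonian `H` defined around the whole arc that parametrizes it. -/
structure Transversal (F : AreaPreservingFlow M) (a b : ℝ) where
  /-- the parametrization -/
  γ : ℝ → M
  /-- the domain of the local Hamiltonian -/
  U : Set M
  /-- the local Hamiltonian -/
  H : M → ℝ
  lt : a < b
  smooth : ContMDiffOn 𝓘(ℝ, ℝ) (𝓡 2) ∞ γ (Icc a b)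
  injOn : InjOn γ (Icc a b)
  transverse : ∀ s ∈ Icc a b,
    LinearIndependent ℝ ![F.X (γ s), mfderivWithin 𝓘(ℝ, ℝ) (𝓡 2) γ (Icc a b) s (1 : ℝ)]
  isLocalHamiltonian : F.IsLocalHamiltonian U H
  subset : γ '' Icc a b ⊆ U
  H_eq : ∀ s ∈ Icc a b, H (γ s) = s

namespace Transversal

variable {F : AreaPreservingFlow M} {a b : ℝ}

/-- The transversal as a subset of the surface. -/
def carrier (Γ : F.Transversal a b) : Set M := Γ.γ '' Icc a b

/-- The set `𝒟`, in the coordinate of the transversal: the endpoints; the points whose first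
return is an endpoint; the points that never return and lie on a stable separatrix ending at a
saddle. -/
def exceptional (Γ : F.Transversal a b) : Set ℝ :=
  {s | s ∈ Icc a b ∧
    ((s = a ∨ s = b) ∨
     (F.IsFirstReturn Γ.carrier (Γ.γ s) (Γ.γ a) ∨ F.IsFirstReturn Γ.carrier (Γ.γ s) (Γ.γ b)) ∨
     ((∀ t : ℝ, 0 < t → F.φ t (Γ.γ s) ∉ Γ.carrier) ∧
       ∃ p, F.IsSaddle p ∧ F.EndsAt (Γ.γ s) p))}

end Transversal

end AreaPreservingFlow

/-- `T` restricts to a right-continuous interval exchange transformation of `[a, b)`. -/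
def IsIET (a b : ℝ) (T : ℝ → ℝ) : Prop :=
  BijOn T (Ico a b) (Ico a b) ∧
  ∃ (N : ℕ) (α : Fin (N + 1) → ℝ) (σ : Fin N → ℝ),
    1 ≤ N ∧ StrictMono α ∧ α 0 = a ∧ α (Fin.last N) = b ∧
    ∀ i : Fin N, ∀ x ∈ Ico (α i.castSucc) (α i.succ), T x = x + σ i

/-! The one-form θ = ω(X, ·) is invariant under the flow and vanishes on X, so Cartan's formula
gives dθ(X, ·) = 0. On a surface this forces dθ = 0 off the zeros of X, and everywhere by continuity
because the zeros are finite in number. Hence every point has a local Hamiltonian H. It is constant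
along orbits, and invariance of θ makes the passage from one piece of an H-parametrized arc to
another a translation. `FlowSection` keeps only these consequences, and most of the dynamics is done
for continuous flows that have such sections.

A parameter is regular if it returns and both it and its return are interior; the return map is a
translation on intervals of regular parameters. The main tool is a crossing count. Let regular
parameters approach a nonreturning c from one side. Their return times tend to infinity, yet the
number of crossings of an auxiliary section T, disjoint from the transversal, stays bounded: this
number can change only when an orbit meets an end of T, and each end lies on at most one orbit
segment before return. So limits of long orbit segments accumulate only at fixed points and, these
being finitely many, converge. In particular c flows to a fixed point, necessarily a saddle, and
lies in 𝒟. Thus an interval free of 𝒟 is either regular throughout or never returns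
(`subset_regular`).

The second case is excluded by recurrence (`FlowSection.mem_regular`). A nonreturning orbit that
does not converge crosses some section infinitely often. After a late crossing, a small interval
around it is carried back to that section forever by translations, and two of its images must
overlap, although its points lie on distinct orbits.

For (iii), `reach` follows the regular orbits near c past successive saddles. Each passage leaves a
small neighbourhood of a fixed point through its frontier, where visits are bounded by the same
count, so finitely many connections lead to the limit of the returns. Finally `exists_isIET` extends
the return map across the finite set 𝒟 by its right germs, and surjectivity follows from Lebesgue
measure. -/

/-- The model plane. -/
abbrev Plane := EuclideanSpace ℝ (Fin 2)

/-! ### Closedness of ω(X, ·) and existence of local Hamiltonians -/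

/-- A one-form annihilating the generator of a local flow and invariant under the flow is
closed in the direction of the generator. -/
theorem fderiv_symm_generator_of_invariant {E : Type*} [NormedAddCommGroup E] [NormedSpace ℝ E]
    {Φ : ℝ × E → E} {θ : E → E →L[ℝ] ℝ} {y₀ : E}
    (hΦ : ContDiffAt ℝ 2 Φ (0, y₀)) (hΦ0 : ∀ᶠ y in 𝓝 y₀, Φ (0, y) = y)
    (hθ : DifferentiableAt ℝ θ y₀)
    (hinv : ∀ᶠ t in 𝓝 (0 : ℝ), ∀ v, θ (Φ (t, y₀)) (fderiv ℝ Φ (t, y₀) (0, v)) = θ y₀ v)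
    (hker : ∀ᶠ y in 𝓝 y₀, θ y (fderiv ℝ Φ (0, y) (1, 0)) = 0) (v : E) :
    fderiv ℝ θ y₀ (fderiv ℝ Φ (0, y₀) (1, 0)) v = fderiv ℝ θ y₀ v (fderiv ℝ Φ (0, y₀) (1, 0)) := by
  set ξ := fderiv ℝ Φ (0, y₀) (1, 0) with hξ
  have hD : DifferentiableAt ℝ Φ (0, y₀) := hΦ.differentiableAt (by norm_num)
  have hD2 : DifferentiableAt ℝ (fderiv ℝ Φ) (0, y₀) :=
    (hΦ.fderiv_right (m := 1) (by norm_num)).differentiableAt (by norm_num)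
  have hsymm : IsSymmSndFDerivAt ℝ Φ (0, y₀) := hΦ.isSymmSndFDerivAt (by simp)
  have hy0 : Φ (0, y₀) = y₀ := hΦ0.self_of_nhds
  have hline : HasDerivAt (fun t : ℝ => ((t, y₀) : ℝ × E)) (1, 0) 0 :=
    (hasDerivAt_id (0 : ℝ)).prodMk (hasDerivAt_const (0 : ℝ) y₀)
  have hslice : HasFDerivAt (fun y : E => ((0, y) : ℝ × E)) (ContinuousLinearMap.inr ℝ ℝ E) y₀ :=
    (hasFDerivAt_prodMk_right (0 : ℝ) y₀)
  have hid : ∀ v, fderiv ℝ Φ (0, y₀) (0, v) = v := by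
    intro v
    have h1 : HasFDerivAt (fun y => Φ (0, y))
        ((fderiv ℝ Φ (0, y₀)).comp (ContinuousLinearMap.inr ℝ ℝ E)) y₀ :=
      HasFDerivAt.comp y₀ hD.hasFDerivAt hslice
    have h2 : HasFDerivAt (fun y => Φ (0, y)) (ContinuousLinearMap.id ℝ E) y₀ :=
      (hasFDerivAt_id y₀).congr_of_eventuallyEq hΦ0
    have := congrArg (fun L : E →L[ℝ] E => L v) (h1.unique h2)
    simpa using this
  -- Cartan's formula by hand: the t-derivative of the invariance relation and the v-derivative of
  -- θ(ξ) = 0 each contain θ applied to a mixed second derivative of Φ. These two terms agree by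
  -- symmetry and cancel.
  have hA : HasDerivAt (𝕜 := ℝ) (F := ℝ) (fun t : ℝ => θ (Φ (t, y₀)) (fderiv ℝ Φ (t, y₀) (0, v)))
      (fderiv ℝ θ y₀ ξ v + θ y₀ (fderiv ℝ (fderiv ℝ Φ) (0, y₀) (1, 0) (0, v))) 0 := by
    have h1 : HasDerivAt (fun t : ℝ => Φ (t, y₀)) ξ 0 :=
      hD.hasFDerivAt.comp_hasDerivAt (0 : ℝ) hline
    have h2 : HasDerivAt (fun t : ℝ => θ (Φ (t, y₀))) (fderiv ℝ θ y₀ ξ) 0 := by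
      have : HasFDerivAt θ (fderiv ℝ θ y₀) (Φ (0, y₀)) := by rw [hy0]; exact hθ.hasFDerivAt
      exact this.comp_hasDerivAt (0 : ℝ) h1
    have h3 : HasDerivAt (fun t : ℝ => fderiv ℝ Φ (t, y₀))
        (fderiv ℝ (fderiv ℝ Φ) (0, y₀) (1, 0)) 0 :=
      hD2.hasFDerivAt.comp_hasDerivAt (0 : ℝ) hline
    have h4 := h3.clm_apply (hasDerivAt_const (0 : ℝ) ((0 : ℝ), v))
    have h5 := HasDerivAt.clm_apply (𝕜 := ℝ) h2 h4
    simpa [hy0, hid] using h5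
  have hA0 : fderiv ℝ θ y₀ ξ v + θ y₀ (fderiv ℝ (fderiv ℝ Φ) (0, y₀) (1, 0) (0, v)) = 0 := by
    refine hA.unique ((hasDerivAt_const (0 : ℝ) (θ y₀ v)).congr_of_eventuallyEq ?_)
    filter_upwards [hinv] with t ht using ht v
  have hB : HasFDerivAt (fun y => θ y (fderiv ℝ Φ (0, y) (1, 0))) (0 : E →L[ℝ] ℝ) y₀ :=
    (hasFDerivAt_const (0 : ℝ) y₀).congr_of_eventuallyEq hker
  have hS : HasFDerivAt (fun y => fderiv ℝ Φ (0, y))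
      ((fderiv ℝ (fderiv ℝ Φ) (0, y₀)).comp (ContinuousLinearMap.inr ℝ ℝ E)) y₀ :=
    HasFDerivAt.comp y₀ hD2.hasFDerivAt hslice
  have hB' := hθ.hasFDerivAt.clm_apply
    (hS.clm_apply (hasFDerivAt_const ((1 : ℝ), (0 : E)) y₀))
  have hB0 := congrArg (fun L : E →L[ℝ] ℝ => L v) (hB'.unique hB)
  have hB1 : θ y₀ (fderiv ℝ (fderiv ℝ Φ) (0, y₀) (0, v) (1, 0)) + fderiv ℝ θ y₀ v ξ = 0 := by
    simpa using hB0
  rw [hsymm (1, 0) (0, v)] at hA0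
  linarith

/-- In the plane, a bilinear form symmetric against one nonzero vector is symmetric. -/
theorem bilin_symm_of_symm_vector {B : Plane →L[ℝ] Plane →L[ℝ] ℝ} {ξ : Plane} (hξ : ξ ≠ 0)
    (h : ∀ v, B ξ v = B v ξ) (u v : Plane) : B u v = B v u := by
  by_cases hu : ∃ c : ℝ, u = c • ξ
  · obtain ⟨c, rfl⟩ := hu
    simp [h]
  · have hli : LinearIndependent ℝ ![ξ, u] := by
      rw [LinearIndependent.pair_iff' hξ]
      intro c hc
      exact hu ⟨c, hc.symm⟩
    have hspan := hli.span_eq_top_of_card_eq_finrank' (by simp)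
    have hv : v ∈ Submodule.span ℝ (Set.range ![ξ, u]) := by rw [hspan]; trivial
    simp only [Matrix.range_cons, Matrix.range_empty, Set.union_empty] at hv
    rw [Set.singleton_union, Submodule.mem_span_pair] at hv
    obtain ⟨a, b, rfl⟩ := hv
    simp [h]

namespace AreaPreservingFlow

variable {M : Type*} [TopologicalSpace M] [ChartedSpace (EuclideanSpace ℝ (Fin 2)) M]
  [IsManifold (𝓡 2) ∞ M]

/-- The one-form `ω(X, ·)`. -/
noncomputable def form (F : AreaPreservingFlow M) (x : M) : TangentSpace (𝓡 2) x →L[ℝ] ℝ := F.area x (F.X x)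

theorem form_X (F : AreaPreservingFlow M) (x : M) : F.form x (F.X x) = 0 :=
  F.area_alternating x _

theorem mem_fixedPoints_of_form_eq_zero (F : AreaPreservingFlow M) {x : M}
    (h : ∀ v, F.form x v = 0) : x ∈ F.fixedPoints := by
  by_contra hx
  obtain ⟨w, hw⟩ := F.area_nondegenerate x (F.X x) hx
  exact hw (h w)

theorem contMDiff_flow (F : AreaPreservingFlow M) (t : ℝ) : ContMDiff (𝓡 2) (𝓡 2) ∞ (F.φ t) :=
  F.φ_smooth.comp (contMDiff_const.prodMk contMDiff_id)

theorem mdifferentiableAt_flow (F : AreaPreservingFlow M) (t : ℝ) (x : M) :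
    MDifferentiableAt (𝓡 2) (𝓡 2) (F.φ t) x :=
  (F.contMDiff_flow t).mdifferentiableAt (by simp)

theorem hasMFDerivAt_orbit (F : AreaPreservingFlow M) (x : M) (t : ℝ) :
    HasMFDerivAt 𝓘(ℝ, ℝ) (𝓡 2) (fun s => F.φ s x) t
      ((1 : ℝ →L[ℝ] ℝ).smulRight (F.X (F.φ t x))) := F.φ_integral x t

/-- φ_t commutes with φ_s; differentiate in s at 0. -/
theorem mfderiv_flow_X (F : AreaPreservingFlow M) (t : ℝ) (x : M) :
    mfderiv (𝓡 2) (𝓡 2) (F.φ t) x (F.X x) = F.X (F.φ t x) := by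
  have h1 := F.hasMFDerivAt_orbit x 0
  have h2 : HasMFDerivAt (𝓡 2) (𝓡 2) (F.φ t) (F.φ 0 x) (mfderiv (𝓡 2) (𝓡 2) (F.φ t) (F.φ 0 x)) :=
    (F.mdifferentiableAt_flow t _).hasMFDerivAt
  have h3 := h2.comp (0 : ℝ) h1
  have h4 := F.hasMFDerivAt_orbit (F.φ t x) 0
  have h5 : (F.φ t ∘ fun s => F.φ s x) = fun s => F.φ s (F.φ t x) := by
    funext s
    simp only [Function.comp_apply, ← F.φ.map_add, add_comm]
  rw [h5] at h3
  have h6 := congrArg (fun L : ℝ →L[ℝ] Plane => L 1) (hasMFDerivAt_unique h3 h4)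
  have h7 : mfderiv (𝓡 2) (𝓡 2) (F.φ t) (F.φ 0 x) ((1 : ℝ) • (F.X (F.φ 0 x) : Plane))
      = (1 : ℝ) • (F.X (F.φ 0 (F.φ t x)) : Plane) := h6
  rw [one_smul, one_smul, Flow.map_zero_apply, Flow.map_zero_apply] at h7
  exact h7

theorem form_flow (F : AreaPreservingFlow M) (t : ℝ) (x : M) (v : TangentSpace (𝓡 2) x) :
    F.form (F.φ t x) (mfderiv (𝓡 2) (𝓡 2) (F.φ t) x v) = F.form x v := by
  unfold form
  rw [← F.mfderiv_flow_X, F.area_preserved]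

theorem flow_eq_of_mem_fixedPoints [T2Space M] (F : AreaPreservingFlow M) {x : M}
    (hx : x ∈ F.fixedPoints) (t : ℝ) : F.φ t x = x := by
  have hc : IsMIntegralCurve (I := 𝓡 2) (fun _ : ℝ => x) F.X := by
    intro t
    have h0 : F.X x = 0 := hx
    have := hasMFDerivAt_const (I := 𝓘(ℝ, ℝ)) (I' := 𝓡 2) x t
    have h1 : (1 : ℝ →L[ℝ] ℝ).smulRight (F.X x) = 0 := by
      rw [h0]
      exact ContinuousLinearMap.smulRight_zero _
    rw [h1]
    exact this
  have := isMIntegralCurve_Ioo_eq_of_contMDiff_boundaryless (I := 𝓡 2) (t₀ := 0)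
    (F.X_smooth.of_le (by simp)) (F.φ_integral x) hc (by simp)
  exact congrFun this t

theorem mem_fixedPoints_of_flow_eq (F : AreaPreservingFlow M) {x : M}
    (h : ∀ t, F.φ t x = x) : x ∈ F.fixedPoints := by
  have h1 := F.hasMFDerivAt_orbit x 0
  have h2 : (fun s => F.φ s x) = fun _ => x := funext h
  rw [h2] at h1
  have h3 := hasMFDerivAt_unique h1 (hasMFDerivAt_const x (0 : ℝ))
  have h6 := congrArg (fun L : ℝ →L[ℝ] Plane => L 1) h3
  have h7 : (1 : ℝ) • (F.X (F.φ 0 x) : Plane) = 0 := h6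
  rw [one_smul, Flow.map_zero_apply] at h7
  exact h7

end AreaPreservingFlow

namespace AreaPreservingFlow

variable {M : Type*} [TopologicalSpace M] [ChartedSpace (EuclideanSpace ℝ (Fin 2)) M]
  [IsManifold (𝓡 2) ∞ M]

/-- The one-form `ω(X, ·)` read in the chart at `p`. -/
noncomputable def chartForm (F : AreaPreservingFlow M) (p : M) (y : Plane) : Plane →L[ℝ] ℝ :=
  (F.form ((chartAt Plane p).symm y)).comp
    (mfderiv (𝓡 2) (𝓡 2) (chartAt Plane p).symm y : Plane →L[ℝ] _)

theorem chartForm_apply (F : AreaPreservingFlow M) (p : M) (y v : Plane) :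
    F.chartForm p y v = F.form ((chartAt Plane p).symm y)
      (mfderiv (𝓡 2) (𝓡 2) (chartAt Plane p).symm y v) := rfl

theorem contMDiffOn_tangent_chart_symm (p : M) (v : Plane) :
    ContMDiffOn (𝓡 2) (𝓡 2).tangent ∞ (fun y : Plane =>
      (⟨(chartAt Plane p).symm y, mfderiv (𝓡 2) (𝓡 2) (chartAt Plane p).symm y v⟩ :
        TangentBundle (𝓡 2) M)) (chartAt Plane p).target := by
  have h1 := (contMDiffOn_chart_symm (I := 𝓡 2) (n := ∞) (x := p)).contMDiffOn_tangentMapWithin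
    (m := ∞) (by simp) (chartAt Plane p).open_target.uniqueMDiffOn
  have h2 : ContMDiff (𝓡 2) (𝓡 2).tangent ∞
      (fun y : Plane => (⟨y, v⟩ : TangentBundle (𝓡 2) Plane)) := by
    intro y
    rw [Bundle.contMDiffAt_totalSpace]
    refine ⟨contMDiffAt_id, ?_⟩
    simp
    exact contMDiffAt_const
  have h3 := h1.comp (h2.contMDiffOn (s := (chartAt Plane p).target)) (fun y hy => hy)
  refine h3.congr fun y hy => ?_
  simp only [Function.comp_apply, tangentMapWithin]
  rw [mfderivWithin_of_isOpen (chartAt Plane p).open_target hy]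

theorem contDiffOn_chartForm (F : AreaPreservingFlow M) (p : M) :
    ContDiffOn ℝ ∞ (F.chartForm p) (chartAt Plane p).target := by
  rw [contDiffOn_clm_apply]
  intro v y hy
  have hs : ContMDiffOn (𝓡 2) (𝓡 2) ∞ (chartAt Plane p).symm (chartAt Plane p).target :=
    contMDiffOn_chart_symm
  have h : ContMDiffWithinAt (𝓡 2) ((𝓡 2).prod 𝓘(ℝ)) ∞
      (fun y : Plane => Bundle.TotalSpace.mk' ℝ (E := Bundle.Trivial M ℝ)
        ((chartAt Plane p).symm y)
        (F.area ((chartAt Plane p).symm y) (F.X ((chartAt Plane p).symm y))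
          (mfderiv (𝓡 2) (𝓡 2) (chartAt Plane p).symm y v))) (chartAt Plane p).target y := by
    apply ContMDiffWithinAt.clm_bundle_apply₂ (F₁ := Plane) (F₂ := Plane)
    · exact ContMDiffAt.comp_contMDiffWithinAt y F.area_smooth.contMDiffAt (hs y hy)
    · exact ContMDiffAt.comp_contMDiffWithinAt y F.X_smooth.contMDiffAt (hs y hy)
    · exact contMDiffOn_tangent_chart_symm p v y hy
  simp only [Bundle.contMDiffWithinAt_totalSpace] at h
  exact h.2.contDiffWithinAt

theorem chartForm_mfderiv (F : AreaPreservingFlow M) (p : M) {x : M}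
    (hx : x ∈ (chartAt Plane p).source) (w : TangentSpace (𝓡 2) x) :
    F.chartForm p (chartAt Plane p x) (mfderiv (𝓡 2) (𝓡 2) (chartAt Plane p) x w)
      = F.form x w := by
  have he : (chartAt Plane p).MDifferentiable (𝓡 2) (𝓡 2) :=
    haveI : IsManifold (𝓡 2) 1 M := IsManifold.of_le (n := ∞) (by simp)
    mdifferentiable_chart p
  have h2 : ∀ x' (hx' : x' = x) (w' : Plane), w' = w → F.form x' w' = F.form x w := by
    rintro x' rfl w' rfl
    rfl
  refine (F.chartForm_apply p _ _).trans (h2 _ ((chartAt Plane p).left_inv hx) _ ?_)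
  exact congrArg (fun L : Plane →L[ℝ] Plane => L w) (he.symm_comp_deriv hx)

/-- The flow read in the chart at `p`. -/
noncomputable def chartFlow (F : AreaPreservingFlow M) (p : M) (z : ℝ × Plane) : Plane :=
  chartAt Plane p (F.φ z.1 ((chartAt Plane p).symm z.2))

theorem contDiffAt_chartFlow (F : AreaPreservingFlow M) (p : M) {t : ℝ} {y : Plane}
    (hy : y ∈ (chartAt Plane p).target)
    (ht : F.φ t ((chartAt Plane p).symm y) ∈ (chartAt Plane p).source) :
    ContDiffAt ℝ ∞ (F.chartFlow p) (t, y) := by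
  rw [← contMDiffAt_iff_contDiffAt]
  have h1 : ContMDiffAt 𝓘(ℝ, ℝ × Plane) 𝓘(ℝ, ℝ) ∞ (fun z : ℝ × Plane => z.1) (t, y) :=
    contDiff_fst.contMDiff.contMDiffAt
  have h2 : ContMDiffAt 𝓘(ℝ, ℝ × Plane) (𝓡 2) ∞ (fun z : ℝ × Plane => z.2) (t, y) :=
    contDiff_snd.contMDiff.contMDiffAt
  have h3 : ContMDiffAt (𝓡 2) (𝓡 2) ∞ (chartAt Plane p).symm y :=
    (contMDiffOn_chart_symm (I := 𝓡 2) (n := ∞) (x := p)).contMDiffAt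
      ((chartAt Plane p).open_target.mem_nhds hy)
  have h4 : ContMDiffAt (𝓡 2) (𝓡 2) ∞ (chartAt Plane p) (F.φ t ((chartAt Plane p).symm y)) :=
    (contMDiffOn_chart (I := 𝓡 2) (n := ∞) (x := p)).contMDiffAt
      ((chartAt Plane p).open_source.mem_nhds ht)
  have h5 := h1.prodMk (ContMDiffAt.comp (t, y) (g := (chartAt Plane p).symm) h3 h2)
  have h6 := ContMDiffAt.comp (t, y) F.φ_smooth.contMDiffAt h5
  exact ContMDiffAt.comp (t, y) h4 h6

theorem fderiv_chartFlow_snd (F : AreaPreservingFlow M) (p : M) {t : ℝ} {y : Plane}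
    (hy : y ∈ (chartAt Plane p).target)
    (ht : F.φ t ((chartAt Plane p).symm y) ∈ (chartAt Plane p).source) (v : Plane) :
    F.chartForm p (F.chartFlow p (t, y)) (fderiv ℝ (F.chartFlow p) (t, y) (0, v))
      = F.chartForm p y v := by
  have he : (chartAt Plane p).MDifferentiable (𝓡 2) (𝓡 2) :=
    haveI : IsManifold (𝓡 2) 1 M := IsManifold.of_le (n := ∞) (by simp)
    mdifferentiable_chart p
  have h1 : HasFDerivAt (fun y => F.chartFlow p (t, y))
      ((fderiv ℝ (F.chartFlow p) (t, y)).comp (ContinuousLinearMap.inr ℝ ℝ Plane)) y :=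
    HasFDerivAt.comp y ((F.contDiffAt_chartFlow p hy ht).differentiableAt (by simp)).hasFDerivAt
      (hasFDerivAt_prodMk_right t y)
  have h2 := (he.mdifferentiableAt_symm hy).hasMFDerivAt
  have h3 := (F.mdifferentiableAt_flow t ((chartAt Plane p).symm y)).hasMFDerivAt
  have h4 := (he.mdifferentiableAt ht).hasMFDerivAt
  have h5 := HasMFDerivAt.comp (f := F.φ t ∘ (chartAt Plane p).symm) y h4 (h3.comp y h2)
  have h6 := congrArg (fun L : Plane →L[ℝ] Plane => L v)
    (h1.unique (hasMFDerivAt_iff_hasFDerivAt.1 h5))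
  have h7 : fderiv ℝ (F.chartFlow p) (t, y) (0, v) =
    mfderiv (𝓡 2) (𝓡 2) (chartAt Plane p) (F.φ t ((chartAt Plane p).symm y))
      (mfderiv (𝓡 2) (𝓡 2) (F.φ t) ((chartAt Plane p).symm y)
        (mfderiv (𝓡 2) (𝓡 2) (chartAt Plane p).symm y v)) := h6
  rw [h7, chartFlow, F.chartForm_mfderiv p ht, F.form_flow, chartForm_apply]

theorem fderiv_chartFlow_fst (F : AreaPreservingFlow M) (p : M) {y : Plane}
    (hy : y ∈ (chartAt Plane p).target) :
    fderiv ℝ (F.chartFlow p) (0, y) (1, 0)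
      = mfderiv (𝓡 2) (𝓡 2) (chartAt Plane p) ((chartAt Plane p).symm y)
          (F.X ((chartAt Plane p).symm y)) := by
  have he : (chartAt Plane p).MDifferentiable (𝓡 2) (𝓡 2) :=
    haveI : IsManifold (𝓡 2) 1 M := IsManifold.of_le (n := ∞) (by simp)
    mdifferentiable_chart p
  have hy' := (chartAt Plane p).map_target hy
  have h0 : F.φ 0 ((chartAt Plane p).symm y) = (chartAt Plane p).symm y := F.φ.map_zero_apply _
  have ht : F.φ 0 ((chartAt Plane p).symm y) ∈ (chartAt Plane p).source := by rwa [h0]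
  have h1 : HasFDerivAt (fun t : ℝ => F.chartFlow p (t, y))
      ((fderiv ℝ (F.chartFlow p) (0, y)).comp (ContinuousLinearMap.inl ℝ ℝ Plane)) (0 : ℝ) :=
    HasFDerivAt.comp (𝕜 := ℝ) (f := fun t : ℝ => (t, y)) (0 : ℝ)
      ((F.contDiffAt_chartFlow p hy ht).differentiableAt (by simp)).hasFDerivAt
      (hasFDerivAt_prodMk_left (0 : ℝ) y)
  have h2 := F.hasMFDerivAt_orbit ((chartAt Plane p).symm y) 0
  have h4 := (he.mdifferentiableAt ht).hasMFDerivAt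
  have h5 := h4.comp (0 : ℝ) h2
  have h6 := congrArg (fun L : ℝ →L[ℝ] Plane => L 1)
    (h1.unique (hasMFDerivAt_iff_hasFDerivAt.1 h5))
  have h7 : fderiv ℝ (F.chartFlow p) (0, y) (1, 0) =
    mfderiv (𝓡 2) (𝓡 2) (chartAt Plane p) (F.φ 0 ((chartAt Plane p).symm y))
      ((1 : ℝ) • (F.X (F.φ 0 ((chartAt Plane p).symm y)) : Plane)) := h6
  rw [one_smul, h0] at h7
  exact h7

/-- Invariance gives symmetry against the generator, which is nonzero here; in the plane that is
full symmetry, since an alternating form killed by a nonzero vector vanishes. -/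
theorem fderiv_chartForm_symm_of_notMem (F : AreaPreservingFlow M) (p : M) {y : Plane}
    (hy : y ∈ (chartAt Plane p).target)
    (hfix : (chartAt Plane p).symm y ∉ F.fixedPoints) (u v : Plane) :
    fderiv ℝ (F.chartForm p) y u v = fderiv ℝ (F.chartForm p) y v u := by
  have he : (chartAt Plane p).MDifferentiable (𝓡 2) (𝓡 2) :=
    haveI : IsManifold (𝓡 2) 1 M := IsManifold.of_le (n := ∞) (by simp)
    mdifferentiable_chart p
  have hy' := (chartAt Plane p).map_target hy
  have h0 : F.φ 0 ((chartAt Plane p).symm y) = (chartAt Plane p).symm y := F.φ.map_zero_apply _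
  have ht : F.φ 0 ((chartAt Plane p).symm y) ∈ (chartAt Plane p).source := by rwa [h0]
  have htarget := (chartAt Plane p).open_target.mem_nhds hy
  refine bilin_symm_of_symm_vector (ξ := fderiv ℝ (F.chartFlow p) (0, y) (1, 0)) ?_
    (fderiv_symm_generator_of_invariant ((F.contDiffAt_chartFlow p hy ht).of_le ENat.LEInfty.out) ?_ ?_ ?_ ?_)
    u v
  · rw [F.fderiv_chartFlow_fst p hy]
    intro h
    apply hfix
    have := he.mfderiv_injective hy' (h.trans (map_zero _).symm)
    exact this
  · filter_upwards [htarget] with z hz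
    simp [chartFlow, (chartAt Plane p).right_inv hz]
  · exact ((F.contDiffOn_chartForm p).contDiffAt htarget).differentiableAt (by simp)
  · have hc : Continuous fun t : ℝ => F.φ t ((chartAt Plane p).symm y) := by fun_prop
    filter_upwards [hc.continuousAt.preimage_mem_nhds
      ((chartAt Plane p).open_source.mem_nhds ht)] with t ht v
    exact F.fderiv_chartFlow_snd p hy ht v
  · filter_upwards [htarget] with z hz
    have h := F.chartForm_mfderiv p ((chartAt Plane p).map_target hz)
      (F.X ((chartAt Plane p).symm z))
    rw [(chartAt Plane p).right_inv hz, F.form_X] at h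
    rw [F.fderiv_chartFlow_fst p hz]
    exact h

/-- Fixed points are isolated, and the antisymmetric part of the derivative is continuous and
vanishes around them. -/
theorem fderiv_chartForm_symm (F : AreaPreservingFlow M) (hfix : F.fixedPoints.Finite) (p : M)
    {y : Plane} (hy : y ∈ (chartAt Plane p).target) (u v : Plane) :
    fderiv ℝ (F.chartForm p) y u v = fderiv ℝ (F.chartForm p) y v u := by
  set e := chartAt Plane p with he
  have htarget := e.open_target.mem_nhds hy
  have hcont : ContinuousAt (fderiv ℝ (F.chartForm p)) y :=
    (((F.contDiffOn_chartForm p).contDiffAt htarget).fderiv_right (m := 0)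
      (by simp)).continuousAt
  have hc : ∀ u v : Plane, Tendsto (fun z => fderiv ℝ (F.chartForm p) z u v) (𝓝[≠] y)
      (𝓝 (fderiv ℝ (F.chartForm p) y u v)) := fun u v =>
    ((hcont.clm_apply continuousAt_const).clm_apply continuousAt_const).tendsto.mono_left
      nhdsWithin_le_nhds
  have hfin : (e.target ∩ e.symm ⁻¹' F.fixedPoints).Finite := by
    refine Set.Finite.of_finite_image (f := e.symm) (hfix.subset ?_) ?_
    · rintro _ ⟨z, hz, rfl⟩
      exact hz.2
    · exact e.symm.injOn.mono inter_subset_left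
  have hev : ∀ᶠ z in 𝓝[≠] y, e.symm z ∉ F.fixedPoints := by
    have h1 : ((e.target ∩ e.symm ⁻¹' F.fixedPoints) \ {y})ᶜ ∈ 𝓝 y :=
      (hfin.subset sdiff_subset).isClosed.isOpen_compl.mem_nhds (by simp)
    filter_upwards [mem_nhdsWithin_of_mem_nhds h1, mem_nhdsWithin_of_mem_nhds htarget,
      self_mem_nhdsWithin] with z hz1 hz2 hz3 hz4
    exact hz1 ⟨⟨hz2, hz4⟩, hz3⟩
  refine tendsto_nhds_unique_of_eventuallyEq (hc u v) (hc v u) ?_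
  filter_upwards [hev, mem_nhdsWithin_of_mem_nhds htarget] with z hz1 hz2
  exact F.fderiv_chartForm_symm_of_notMem p hz2 hz1 u v

/-- Every point has a local Hamiltonian. -/
theorem exists_isLocalHamiltonian (F : AreaPreservingFlow M) (hfix : F.fixedPoints.Finite)
    (p : M) : ∃ (U : Set M) (H : M → ℝ), p ∈ U ∧ F.IsLocalHamiltonian U H := by
  have he : (chartAt Plane p).MDifferentiable (𝓡 2) (𝓡 2) :=
    haveI : IsManifold (𝓡 2) 1 M := IsManifold.of_le (n := ∞) (by simp)
    mdifferentiable_chart p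
  set e := chartAt Plane p with hedef
  obtain ⟨r, hr, hball⟩ := Metric.isOpen_iff.1 e.open_target (e p)
    (e.map_source (mem_chart_source Plane p))
  have hsmooth := (F.contDiffOn_chartForm p).mono hball
  -- The Poincaré lemma on a ball contained in the chart target.
  obtain ⟨G, hG⟩ := (convex_ball (e p) r).exists_forall_hasFDerivAt_of_fderiv_symmetric
    Metric.isOpen_ball (hsmooth.differentiableOn (by simp))
    (fun y hy u v => F.fderiv_chartForm_symm hfix p (hball hy) u v)
  have hGs : ContDiffOn ℝ ∞ G (Metric.ball (e p) r) := by
    rw [contDiffOn_infty_iff_fderiv_of_isOpen Metric.isOpen_ball]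
    refine ⟨fun y hy => (hG y hy).differentiableAt.differentiableWithinAt, ?_⟩
    exact hsmooth.congr fun y hy => (hG y hy).fderiv
  refine ⟨e.source ∩ e ⁻¹' Metric.ball (e p) r, G ∘ e,
    ⟨mem_chart_source Plane p, Metric.mem_ball_self hr⟩,
    e.isOpen_inter_preimage Metric.isOpen_ball, ?_, ?_⟩
  · have h1 : ContMDiffOn (𝓡 2) (𝓡 2) ∞ e e.source := contMDiffOn_chart
    exact hGs.contMDiffOn.comp (h1.mono inter_subset_left) fun x hx => hx.2
  · rintro x ⟨hx1, hx2⟩ v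
    have h1 := (he.mdifferentiableAt hx1).hasMFDerivAt
    have h2 := (hG (e x) hx2).hasMFDerivAt.comp x h1
    rw [h2.mfderiv]
    exact F.chartForm_mfderiv p hx1 v

end AreaPreservingFlow

/-! ### Cross-sections and absence of short periods -/

/-- A cross-section of a flow: an arc met by nearby orbits exactly once, parametrized so that the
transitions of the flow from the arc to itself are translations. -/
structure FlowSection {M : Type*} [TopologicalSpace M] (φ : Flow ℝ M) where
  /-- the left end of the parameter interval -/
  lo : ℝ
  /-- the right end of the parameter interval -/
  hi : ℝ
  /-- the parametrization -/
  σ : ℝ → M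
  lt : lo < hi
  continuousOn : ContinuousOn σ (Icc lo hi)
  injOn : InjOn σ (Icc lo hi)
  sep : ∃ η > 0, ∀ x ∈ σ '' Icc lo hi, ∀ t : ℝ, t ≠ 0 → |t| < η → φ t x ∉ σ '' Icc lo hi
  box : ∀ v ∈ Ioo lo hi, ∀ ε > 0, ∀ᶠ z in 𝓝 (σ v), ∃ t : ℝ, |t| < ε ∧
    ∃ w ∈ Ioo lo hi, |w - v| < ε ∧ φ t z = σ w
  transl : ∀ u₀ ∈ Ioo lo hi, ∀ v₀ ∈ Ioo lo hi, ∀ t₀ : ℝ, φ t₀ (σ u₀) = σ v₀ → ∀ ε > 0,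
    ∀ᶠ u in 𝓝 u₀, ∃ t : ℝ, |t - t₀| < ε ∧ v₀ + (u - u₀) ∈ Ioo lo hi ∧
      φ t (σ u) = σ (v₀ + (u - u₀))

/-- A short period t of a point y near x has a multiple within ε of T. Hence y itself would lie near
φ_T(x), which is separated from x. -/
theorem Flow.eventually_ne_of_ne {M : Type*} [TopologicalSpace M] [T2Space M] (φ : Flow ℝ M)
    {x : M} {T : ℝ} (hT : φ T x ≠ x) :
    ∃ ε > 0, ∀ᶠ y in 𝓝 x, ∀ t : ℝ, t ≠ 0 → |t| < ε → φ t y ≠ y := by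
  obtain ⟨A, B, hA, hB, hxA, hxB, hAB⟩ := t2_separation hT.symm
  have hc : Continuous fun p : ℝ × M => φ p.1 p.2 := by fun_prop
  have h1 : (fun p : ℝ × M => φ p.1 p.2) ⁻¹' B ∈ 𝓝 (T, x) :=
    hc.continuousAt.preimage_mem_nhds (hB.mem_nhds hxB)
  obtain ⟨I, hI, N, hN, hIN⟩ := mem_nhds_prod_iff.1 h1
  obtain ⟨ε, hε, hball⟩ := Metric.mem_nhds_iff.1 hI
  refine ⟨ε, hε, ?_⟩
  filter_upwards [hN, hA.mem_nhds hxA] with y hyN hyA t ht0 htε hty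
  have hper : ∀ n : ℤ, φ (n * t) y = y := by
    have hnat : ∀ n : ℕ, φ (n * t) y = y := by
      intro n
      induction n with
      | zero => simp
      | succ k ih => rw [Nat.cast_succ, add_mul, φ.map_add, one_mul, hty, ih]
    intro n
    obtain ⟨k, rfl | rfl⟩ := n.eq_nat_or_neg
    · exact_mod_cast hnat k
    · have h2 : φ (-(k * t)) (φ (k * t) y) = y := by
        rw [← φ.map_add, neg_add_cancel, φ.map_zero_apply]
      rw [hnat k] at h2
      simpa using h2
  set n : ℤ := ⌊T / t⌋
  have hn : |n * t - T| < ε := by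
    have h3 : n * t - T = -(Int.fract (T / t) * t) := by
      have : T = T / t * t := by field_simp
      have h4 := Int.floor_add_fract (T / t)
      calc n * t - T = n * t - (n + Int.fract (T / t)) * t := by rw [h4, ← this]
        _ = _ := by ring
    rw [h3, abs_neg, abs_mul, abs_of_nonneg (Int.fract_nonneg _)]
    calc Int.fract (T / t) * |t| ≤ 1 * |t| := by
          gcongr; exact (Int.fract_lt_one _).le
      _ < ε := by linarith
  have h5 : φ (n * t) y ∈ B := hIN (show ((n * t : ℝ), y) ∈ I ×ˢ N from
    ⟨hball (by rwa [Metric.mem_ball, Real.dist_eq]), hyN⟩)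
  rw [hper n] at h5
  exact Set.disjoint_left.1 hAB hyA h5

theorem IsLocalExtr.mfderiv_apply_eq_zero {M : Type*} [TopologicalSpace M]
    [ChartedSpace (EuclideanSpace ℝ (Fin 2)) M] {f : M → ℝ} {x : M} (h : IsLocalExtr f x)
    (v : TangentSpace (𝓡 2) x) : mfderiv (𝓡 2) 𝓘(ℝ, ℝ) f x v = 0 := by
  by_cases hf : MDifferentiableAt (𝓡 2) 𝓘(ℝ, ℝ) f x
  · have h1 : HasFDerivAt (𝕜 := ℝ) (E := Plane) (F := ℝ)
        (writtenInExtChartAt (𝓡 2) 𝓘(ℝ, ℝ) x f) (mfderiv (𝓡 2) 𝓘(ℝ, ℝ) f x)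
        (extChartAt (𝓡 2) x x) := by
      have h := hf.hasMFDerivAt.2
      rw [modelWithCornersSelf_coe, Set.range_id] at h
      exact hasFDerivWithinAt_univ.1 h
    have hc : ContinuousAt (chartAt Plane x).symm (chartAt Plane x x) :=
      (chartAt Plane x).continuousAt_symm (mem_chart_target Plane x)
    have h0 : (chartAt Plane x).symm (chartAt Plane x x) = x :=
      (chartAt Plane x).left_inv (mem_chart_source Plane x)
    have h2 : IsLocalExtr (f ∘ (chartAt Plane x).symm) (chartAt Plane x x) := by
      have h3 : Tendsto (chartAt Plane x).symm (𝓝 (chartAt Plane x x)) (𝓝 x) := by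
        have := hc.tendsto
        rwa [h0] at this
      have h4 : IsExtrFilter f (𝓝 x) ((chartAt Plane x).symm (chartAt Plane x x)) := by
        rw [h0]; exact h
      exact h4.comp_tendsto h3
    have h5 : writtenInExtChartAt (𝓡 2) 𝓘(ℝ, ℝ) x f = f ∘ (chartAt Plane x).symm := by
      ext y
      simp [writtenInExtChartAt, chartAt_self_eq]
    have h6 : extChartAt (𝓡 2) x x = chartAt Plane x x := by simp
    rw [h5, h6] at h1
    have h7 := h2.hasFDerivAt_eq_zero h1
    exact congrArg (fun L : Plane →L[ℝ] ℝ => L v) h7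
  · rw [mfderiv_zero_of_not_mdifferentiableAt hf]
    rfl

/-! ### Local Hamiltonians along orbits, and saddles as limits of orbits -/

namespace AreaPreservingFlow

variable {M : Type*} [TopologicalSpace M] [ChartedSpace (EuclideanSpace ℝ (Fin 2)) M]
  [IsManifold (𝓡 2) ∞ M] {F : AreaPreservingFlow M} {U : Set M} {H : M → ℝ}

namespace IsLocalHamiltonian

theorem hasMFDerivAt (hH : F.IsLocalHamiltonian U H) {x : M} (hx : x ∈ U) :
    HasMFDerivAt (𝓡 2) 𝓘(ℝ, ℝ) H x (F.form x) := by
  have h1 := ((hH.smooth.contMDiffAt (hH.isOpen.mem_nhds hx)).mdifferentiableAt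
    (by simp)).hasMFDerivAt
  have h2 : mfderiv (𝓡 2) 𝓘(ℝ, ℝ) H x = F.form x := by
    ext v
    exact hH.deriv_eq x hx v
  rwa [h2] at h1

theorem hasDerivAt_orbit (hH : F.IsLocalHamiltonian U H) {x : M} {t : ℝ} (hx : F.φ t x ∈ U) :
    HasDerivAt (fun s => H (F.φ s x)) 0 t := by
  have h1 := (hH.hasMFDerivAt hx).comp t (F.hasMFDerivAt_orbit x t)
  have h2 : HasFDerivAt (𝕜 := ℝ) (E := ℝ) (F := ℝ) (fun s => H (F.φ s x)) _ t :=
    hasMFDerivAt_iff_hasFDerivAt.1 h1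
  have h3 : F.form (F.φ t x) ((1 : ℝ) • (F.X (F.φ t x) : Plane)) = 0 := by
    rw [one_smul]
    exact F.form_X _
  rw [← h3]
  exact h2.hasDerivAt

theorem eq_on_orbit (hH : F.IsLocalHamiltonian U H) {x : M} {s t : ℝ}
    (h : ∀ r ∈ uIcc s t, F.φ r x ∈ U) : H (F.φ t x) = H (F.φ s x) := by
  have h1 := (convex_uIcc s t).norm_image_sub_le_of_norm_hasDerivWithin_le
    (f := fun r => H (F.φ r x)) (f' := fun _ => 0) (C := 0)
    (fun r hr => (hH.hasDerivAt_orbit (h r hr)).hasDerivWithinAt) (by simp)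
    left_mem_uIcc right_mem_uIcc
  simpa [sub_eq_zero] using h1

theorem eventually_flow_eq (hH : F.IsLocalHamiltonian U H) {x : M} (hx : x ∈ U) :
    ∃ ε > 0, ∀ᶠ y in 𝓝 x, ∀ t : ℝ, |t| < ε → H (F.φ t y) = H y := by
  have hc : Continuous fun p : ℝ × M => F.φ p.1 p.2 := by fun_prop
  have h1 : (fun p : ℝ × M => F.φ p.1 p.2) ⁻¹' U ∈ 𝓝 ((0 : ℝ), x) :=
    hc.continuousAt.preimage_mem_nhds (hH.isOpen.mem_nhds (by simpa using hx))
  obtain ⟨I, hI, N, hN, hIN⟩ := mem_nhds_prod_iff.1 h1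
  obtain ⟨ε, hε, hball⟩ := Metric.mem_nhds_iff.1 hI
  refine ⟨ε, hε, ?_⟩
  filter_upwards [hN] with y hy t ht
  have h2 := hH.eq_on_orbit (x := y) (s := 0) (t := t) fun r hr => by
    refine hIN (show (r, y) ∈ I ×ˢ N from ⟨hball ?_, hy⟩)
    have := abs_sub_left_of_mem_uIcc hr
    rw [Metric.mem_ball, Real.dist_eq]
    simp only [sub_zero] at this ⊢
    linarith
  simpa using h2

end IsLocalHamiltonian

theorem flow_notMem_fixedPoints [T2Space M] {x : M} (hx : x ∉ F.fixedPoints) (t : ℝ) :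
    F.φ t x ∉ F.fixedPoints := by
  intro h
  have h1 := F.flow_eq_of_mem_fixedPoints h (-t)
  rw [← F.φ.map_add, neg_add_cancel, F.φ.map_zero_apply] at h1
  exact hx (h1 ▸ h)

/-- Near p the converging orbit lies in the level H = H(p). Were p a local extremum, the orbit
points close to p would be extrema too, so dH and hence X would vanish there. The filter g covers
both time directions. -/
theorem isSaddle_of_tendsto [T2Space M] (hfix : F.fixedPoints.Finite) {z p : M}
    (hz : z ∉ F.fixedPoints) (hp : p ∈ F.fixedPoints) {g : Filter ℝ} [g.NeBot]
    {S : ℝ → Set ℝ} (hg : g.HasBasis (fun _ => True) S) (hS : ∀ i, (S i).OrdConnected)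
    (h : Tendsto (fun t => F.φ t z) g (𝓝 p)) : F.IsSaddle p := by
  obtain ⟨U, H, hpU, hH⟩ := F.exists_isLocalHamiltonian hfix p
  refine ⟨hp, U, H, hpU, hH, fun hext => ?_⟩
  have hHc : ContinuousAt H p := (hH.smooth.contMDiffAt (hH.isOpen.mem_nhds hpU)).continuousAt
  obtain ⟨i, -, hi⟩ := hg.eventually_iff.1 (h.eventually (hH.isOpen.mem_nhds hpU))
  have hmem : S i ∈ g := hg.mem_of_mem trivial
  have hconst : ∀ t ∈ S i, H (F.φ t z) = H p := by
    intro t ht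
    refine tendsto_nhds_unique (tendsto_const_nhds.congr' ?_) (hHc.tendsto.comp h)
    filter_upwards [hmem] with s hs
    exact (hH.eq_on_orbit fun r hr => hi ((hS i).uIcc_subset hs ht hr))
  have key : ∀ y ∈ U, y ∉ F.fixedPoints → ¬ IsLocalExtr H y := by
    intro y hy hyf hloc
    refine hyf (F.mem_fixedPoints_of_form_eq_zero fun v => ?_)
    exact (hH.deriv_eq y hy v).symm.trans (hloc.mfderiv_apply_eq_zero v)
  rcases hext with hmin | hmax
  · have h1 : ∀ᶠ y in 𝓝 p, ∀ᶠ y' in 𝓝 y, H p ≤ H y' := eventually_eventually_nhds.2 hmin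
    obtain ⟨t, ht, htS⟩ := ((h.eventually h1).and hmem).exists
    refine key _ (hi htS) (flow_notMem_fixedPoints hz t) (Or.inl ?_)
    filter_upwards [ht] with y' hy'
    rwa [hconst t htS]
  · have h1 : ∀ᶠ y in 𝓝 p, ∀ᶠ y' in 𝓝 y, H y' ≤ H p := eventually_eventually_nhds.2 hmax
    obtain ⟨t, ht, htS⟩ := ((h.eventually h1).and hmem).exists
    refine key _ (hi htS) (flow_notMem_fixedPoints hz t) (Or.inr ?_)
    filter_upwards [ht] with y' hy'
    rwa [hconst t htS]

theorem EndsAt.isSaddle [T2Space M] (hfix : F.fixedPoints.Finite) {z p : M}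
    (hz : z ∉ F.fixedPoints) (h : F.EndsAt z p) : F.IsSaddle p :=
  isSaddle_of_tendsto hfix hz h.1 atTop_basis (fun _ => ordConnected_Ici) h.2

end AreaPreservingFlow

/-! ### Arcs parametrized by a Hamiltonian are cross-sections -/

namespace AreaPreservingFlow

variable {M : Type*} [TopologicalSpace M] [ChartedSpace (EuclideanSpace ℝ (Fin 2)) M]
  [IsManifold (𝓡 2) ∞ M] {F : AreaPreservingFlow M} {U : Set M} {H : M → ℝ}

/-- A curve transverse to the flow, parametrized by a local Hamiltonian. -/
structure IsHamiltonianArc (F : AreaPreservingFlow M) (lo hi : ℝ) (σ : ℝ → M) (U : Set M)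
    (H : M → ℝ) : Prop where
  lt : lo < hi
  continuousOn : ContinuousOn σ (Icc lo hi)
  contMDiffAt : ∀ s ∈ Ioo lo hi, ContMDiffAt 𝓘(ℝ, ℝ) (𝓡 2) 1 σ s
  isLocalHamiltonian : F.IsLocalHamiltonian U H
  mem : ∀ s ∈ Icc lo hi, σ s ∈ U
  H_eq : ∀ s ∈ Icc lo hi, H (σ s) = s
  notMem_fixedPoints : ∀ s ∈ Icc lo hi, σ s ∉ F.fixedPoints

namespace IsHamiltonianArc

variable {lo hi : ℝ} {σ : ℝ → M}

theorem injOn (h : F.IsHamiltonianArc lo hi σ U H) : InjOn σ (Icc lo hi) := by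
  intro s hs t ht hst
  rw [← h.H_eq s hs, hst, h.H_eq t ht]

/-- A short return preserves H, hence the parameter, so it would be a short period. Compactness of
the arc makes the bound uniform. -/
theorem sep [T2Space M] (h : F.IsHamiltonianArc lo hi σ U H) :
    ∃ η > 0, ∀ x ∈ σ '' Icc lo hi, ∀ t : ℝ, t ≠ 0 → |t| < η → F.φ t x ∉ σ '' Icc lo hi := by
  have hcpt : IsCompact (σ '' Icc lo hi) := isCompact_Icc.image_of_continuousOn h.continuousOn
  suffices ∃ η > 0, ∀ x ∈ σ '' Icc lo hi, x ∈ σ '' Icc lo hi →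
      ∀ t : ℝ, t ≠ 0 → |t| < η → F.φ t x ∉ σ '' Icc lo hi by
    obtain ⟨η, hη, h1⟩ := this
    exact ⟨η, hη, fun x hx => h1 x hx hx⟩
  refine hcpt.induction_on (p := fun s => ∃ η > 0, ∀ x ∈ s, x ∈ σ '' Icc lo hi →
      ∀ t : ℝ, t ≠ 0 → |t| < η → F.φ t x ∉ σ '' Icc lo hi) ?_ ?_ ?_ ?_
  · exact ⟨1, one_pos, by simp⟩
  · rintro s t hst ⟨η, hη, h1⟩
    exact ⟨η, hη, fun x hx => h1 x (hst hx)⟩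
  · rintro s t ⟨η, hη, h1⟩ ⟨η', hη', h2⟩
    refine ⟨min η η', lt_min hη hη', ?_⟩
    rintro x (hx | hx) hxc r hr0 hr
    · exact h1 x hx hxc r hr0 (hr.trans_le (min_le_left _ _))
    · exact h2 x hx hxc r hr0 (hr.trans_le (min_le_right _ _))
  · rintro x ⟨u, hu, rfl⟩
    obtain ⟨T, hT⟩ : ∃ T, F.φ T (σ u) ≠ σ u := by
      by_contra! hcon
      exact h.notMem_fixedPoints u hu (F.mem_fixedPoints_of_flow_eq hcon)
    obtain ⟨ε, hε, h1⟩ := F.φ.eventually_ne_of_ne hT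
    obtain ⟨ε', hε', h2⟩ := h.isLocalHamiltonian.eventually_flow_eq (h.mem u hu)
    refine ⟨_, mem_nhdsWithin_of_mem_nhds (h1.and h2), min ε ε', lt_min hε hε', ?_⟩
    rintro y ⟨hy1, hy2⟩ ⟨s, hs, rfl⟩ t ht0 ht ⟨w, hw, hwt⟩
    have h3 := hy2 t (ht.trans_le (min_le_right _ _))
    rw [← hwt, h.H_eq w hw, h.H_eq s hs] at h3
    subst h3
    exact hy1 t ht0 (ht.trans_le (min_le_left _ _)) hwt.symm

theorem hasMFDerivAt (h : F.IsHamiltonianArc lo hi σ U H) {s : ℝ} (hs : s ∈ Ioo lo hi) :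
    HasMFDerivAt 𝓘(ℝ, ℝ) (𝓡 2) σ s (mfderiv 𝓘(ℝ, ℝ) (𝓡 2) σ s) :=
  ((h.contMDiffAt s hs).mdifferentiableAt (by simp)).hasMFDerivAt

theorem form_mfderiv (h : F.IsHamiltonianArc lo hi σ U H) {s : ℝ} (hs : s ∈ Ioo lo hi) :
    F.form (σ s) (mfderiv 𝓘(ℝ, ℝ) (𝓡 2) σ s (1 : ℝ)) = 1 := by
  have h1 := (h.isLocalHamiltonian.hasMFDerivAt (h.mem s (Ioo_subset_Icc_self hs))).comp s
    (h.hasMFDerivAt hs)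
  have h2 : HasFDerivAt (𝕜 := ℝ) (E := ℝ) (F := ℝ) (fun r => H (σ r)) _ s :=
    hasMFDerivAt_iff_hasFDerivAt.1 h1
  have h3 : HasFDerivAt (fun r => H (σ r)) (ContinuousLinearMap.id ℝ ℝ) s := by
    refine (hasFDerivAt_id s).congr_of_eventuallyEq ?_
    filter_upwards [Ioo_mem_nhds hs.1 hs.2] with r hr using h.H_eq r (Ioo_subset_Icc_self hr)
  exact congrArg (fun L : ℝ →L[ℝ] ℝ => L 1) (h2.unique h3)

/-- The source of the translation property: dH after flowing equals dH before, and H increases at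
unit rate along the arc. -/
theorem hasDerivAt_flow (h : F.IsHamiltonianArc lo hi σ U H) {s t : ℝ} (hs : s ∈ Ioo lo hi)
    (ht : F.φ t (σ s) ∈ U) : HasDerivAt (fun u => H (F.φ t (σ u))) 1 s := by
  have h1 := (F.mdifferentiableAt_flow t (σ s)).hasMFDerivAt.comp s (h.hasMFDerivAt hs)
  have h2 := HasMFDerivAt.comp (f := F.φ t ∘ σ) s (h.isLocalHamiltonian.hasMFDerivAt ht) h1
  have h3 : HasFDerivAt (𝕜 := ℝ) (E := ℝ) (F := ℝ) (fun u => H (F.φ t (σ u))) _ s :=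
    hasMFDerivAt_iff_hasFDerivAt.1 h2
  have h4 := F.form_flow t (σ s) (mfderiv 𝓘(ℝ, ℝ) (𝓡 2) σ s (1 : ℝ))
  rw [h.form_mfderiv hs] at h4
  rw [← h4]
  exact h3.hasDerivAt

/-- Flow box: (s, t) ↦ φ_t(σ(s)) has invertible derivative at (v, 0), because θ equals 1 on σ' and 0
on X. Small neighbourhoods of (v, 0) therefore cover a neighbourhood of σ(v). -/
theorem box [T2Space M] (h : F.IsHamiltonianArc lo hi σ U H) :
    ∀ v ∈ Ioo lo hi, ∀ ε > 0, ∀ᶠ z in 𝓝 (σ v), ∃ t : ℝ, |t| < ε ∧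
      ∃ w ∈ Ioo lo hi, |w - v| < ε ∧ F.φ t z = σ w := by
  intro v hv ε hε
  set x := σ v with hx
  have he : (chartAt Plane x).MDifferentiable (𝓡 2) (𝓡 2) :=
    haveI : IsManifold (𝓡 2) 1 M := IsManifold.of_le (n := ∞) (by simp)
    mdifferentiable_chart x
  set e := chartAt Plane x with hedef
  have hxe : x ∈ e.source := mem_chart_source Plane x
  set B : ℝ × ℝ → M := fun p => F.φ p.2 (σ p.1) with hB
  have hB0 : B (v, 0) = x := F.φ.map_zero_apply _
  have hBs : ContMDiffAt 𝓘(ℝ, ℝ × ℝ) (𝓡 2) 1 B (v, 0) := by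
    have h1 : ContMDiffAt 𝓘(ℝ, ℝ × ℝ) 𝓘(ℝ, ℝ) 1 (fun z : ℝ × ℝ => z.2) (v, 0) :=
      contDiff_snd.contMDiff.contMDiffAt
    have h2 : ContMDiffAt 𝓘(ℝ, ℝ × ℝ) 𝓘(ℝ, ℝ) 1 (fun z : ℝ × ℝ => z.1) (v, 0) :=
      contDiff_fst.contMDiff.contMDiffAt
    have h3 := h1.prodMk (ContMDiffAt.comp (v, (0 : ℝ)) (g := σ) (h.contMDiffAt v hv) h2)
    exact ContMDiffAt.comp (v, (0 : ℝ)) (F.φ_smooth.contMDiffAt.of_le (by simp)) h3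
  have hbs : ContDiffAt ℝ 1 (e ∘ B) (v, 0) := by
    rw [← contMDiffAt_iff_contDiffAt]
    have h4 : ContMDiffAt (𝓡 2) (𝓡 2) 1 e (B (v, 0)) := by
      rw [hB0]
      exact ((contMDiffOn_chart (I := 𝓡 2) (n := ∞) (x := x)).contMDiffAt
        (e.open_source.mem_nhds hxe)).of_le (by simp)
    exact ContMDiffAt.comp (v, (0 : ℝ)) h4 hBs
  set L := fderiv ℝ (e ∘ B) (v, 0) with hL
  have hstrict : HasStrictFDerivAt (e ∘ B) L (v, 0) := hbs.hasStrictFDerivAt (by simp)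
  have hde := (he.mdifferentiableAt hxe).hasMFDerivAt
  have hLs : L (1, 0) = mfderiv (𝓡 2) (𝓡 2) e x (mfderiv 𝓘(ℝ, ℝ) (𝓡 2) σ v (1 : ℝ)) := by
    have h1 : HasFDerivAt (fun s : ℝ => (e ∘ B) (s, 0))
        (L.comp (ContinuousLinearMap.inl ℝ ℝ ℝ)) v :=
      HasFDerivAt.comp (𝕜 := ℝ) (f := fun s : ℝ => (s, (0 : ℝ))) v hstrict.hasFDerivAt
        (hasFDerivAt_prodMk_left v (0 : ℝ))
    have h2 : HasFDerivAt (𝕜 := ℝ) (E := ℝ) (F := Plane) (e ∘ σ) _ v :=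
      hasMFDerivAt_iff_hasFDerivAt.1 (hde.comp v (h.hasMFDerivAt hv))
    have h3 : (fun s : ℝ => (e ∘ B) (s, 0)) = e ∘ σ := by
      funext s
      simp [hB]
    rw [h3] at h1
    exact congrArg (fun L : ℝ →L[ℝ] Plane => L 1) (h1.unique h2)
  have hLt : L (0, 1) = mfderiv (𝓡 2) (𝓡 2) e x (F.X x) := by
    have h1 : HasFDerivAt (fun s : ℝ => (e ∘ B) (v, s))
        (L.comp (ContinuousLinearMap.inr ℝ ℝ ℝ)) (0 : ℝ) :=
      HasFDerivAt.comp (𝕜 := ℝ) (f := fun s : ℝ => (v, s)) (0 : ℝ) hstrict.hasFDerivAt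
        (hasFDerivAt_prodMk_right v (0 : ℝ))
    have hde' : HasMFDerivAt (𝓡 2) (𝓡 2) e (F.φ 0 x) (mfderiv (𝓡 2) (𝓡 2) e (F.φ 0 x)) :=
      (he.mdifferentiableAt (by simpa using hxe)).hasMFDerivAt
    have h2 : HasFDerivAt (𝕜 := ℝ) (E := ℝ) (F := Plane) (e ∘ fun s => F.φ s x) _ (0 : ℝ) :=
      hasMFDerivAt_iff_hasFDerivAt.1 (hde'.comp (0 : ℝ) (F.hasMFDerivAt_orbit x 0))
    have h6 := congrArg (fun L : ℝ →L[ℝ] Plane => L 1) (h1.unique h2)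
    have h7 : L (0, 1) = mfderiv (𝓡 2) (𝓡 2) e (F.φ 0 x) ((1 : ℝ) • (F.X (F.φ 0 x) : Plane)) :=
      h6
    rw [one_smul, F.φ.map_zero_apply] at h7
    exact h7
  have hform := h.form_mfderiv hv
  have hinj : Function.Injective L := by
    rw [injective_iff_map_eq_zero]
    rintro ⟨α, β⟩ h0
    have h1 : ((α, β) : ℝ × ℝ) = α • ((1 : ℝ), (0 : ℝ)) + β • ((0 : ℝ), (1 : ℝ)) := by simp
    rw [h1, map_add, map_smul, map_smul, hLs, hLt] at h0
    have h2 : mfderiv (𝓡 2) (𝓡 2) e x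
        (α • mfderiv 𝓘(ℝ, ℝ) (𝓡 2) σ v (1 : ℝ) + β • F.X x) = 0 := by
      rw [map_add, map_smul, map_smul]
      exact h0
    have h3 := he.mfderiv_injective hxe (h2.trans (map_zero _).symm)
    have h4 := congrArg (F.form x) h3
    rw [map_add, map_smul, map_smul, F.form_X, map_zero] at h4
    have h5 : α = 0 := by
      have h6 : α • F.form x (mfderiv 𝓘(ℝ, ℝ) (𝓡 2) σ v (1 : ℝ)) = 0 := by simpa using h4
      rw [hform] at h6
      simpa using h6
    subst h5
    rw [zero_smul, zero_add, smul_eq_zero] at h3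
    rcases h3 with h3 | h3
    · simp [h3]
    · exact absurd h3 (h.notMem_fixedPoints v (Ioo_subset_Icc_self hv))
  have hsurj : L.range = ⊤ := by
    have : Function.Surjective (L : ℝ × ℝ →ₗ[ℝ] Plane) :=
      (LinearMap.injective_iff_surjective_of_finrank_eq_finrank (by simp)).1 hinj
    exact LinearMap.range_eq_top.2 this
  have hmap := hstrict.map_nhds_eq_of_surj hsurj
  have hS : {p : ℝ × ℝ | p.1 ∈ Ioo lo hi ∧ |p.1 - v| < ε ∧ |p.2| < ε ∧ B p ∈ e.source} ∈
      𝓝 (v, (0 : ℝ)) := by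
    have h1 : ∀ᶠ p : ℝ × ℝ in 𝓝 (v, (0 : ℝ)), p.1 ∈ Ioo lo hi :=
      continuousAt_fst.eventually (Ioo_mem_nhds hv.1 hv.2)
    have h2 : ∀ᶠ p : ℝ × ℝ in 𝓝 (v, (0 : ℝ)), |p.1 - v| < ε := by
      have : ContinuousAt (fun p : ℝ × ℝ => |p.1 - v|) (v, 0) := by fun_prop
      exact this.eventually (Iio_mem_nhds (by simpa))
    have h3 : ∀ᶠ p : ℝ × ℝ in 𝓝 (v, (0 : ℝ)), |p.2| < ε := by
      have : ContinuousAt (fun p : ℝ × ℝ => |p.2|) (v, 0) := by fun_prop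
      exact this.eventually (Iio_mem_nhds (by simpa))
    have h4 : ∀ᶠ p in 𝓝 (v, (0 : ℝ)), B p ∈ e.source :=
      hBs.continuousAt.eventually (e.open_source.mem_nhds (by rwa [hB0]))
    filter_upwards [h1, h2, h3, h4] with p a b c d using ⟨a, b, c, d⟩
  have himg := image_mem_map (m := e ∘ B) hS
  rw [hmap] at himg
  have hee : (e ∘ B) (v, 0) = e x := by simp [hB0]
  rw [hee] at himg
  filter_upwards [e.continuousAt hxe |>.preimage_mem_nhds himg,
    e.open_source.mem_nhds hxe] with z hz hzs
  obtain ⟨⟨w, t⟩, ⟨hw, hwv, ht, hBz⟩, hpz⟩ := hz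
  have h8 : F.φ t (σ w) = z := e.injOn hBz hzs hpz
  refine ⟨-t, by simpa using ht, w, hw, hwv, ?_⟩
  rw [← h8, ← F.φ.map_add, neg_add_cancel, F.φ.map_zero_apply]

/-- H(φ_{t₀}(σ(u))) − u is locally constant. The short extra time that brings the point onto the arc
does not change H, and on the arc H is the parameter. -/
theorem transl [T2Space M] (h : F.IsHamiltonianArc lo hi σ U H) :
    ∀ u₀ ∈ Ioo lo hi, ∀ v₀ ∈ Ioo lo hi, ∀ t₀ : ℝ, F.φ t₀ (σ u₀) = σ v₀ → ∀ ε > 0,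
    ∀ᶠ u in 𝓝 u₀, ∃ t : ℝ, |t - t₀| < ε ∧ v₀ + (u - u₀) ∈ Ioo lo hi ∧
      F.φ t (σ u) = σ (v₀ + (u - u₀)) := by
  intro u₀ hu₀ v₀ hv₀ t₀ ht₀ ε hε
  have hv₀U := h.mem v₀ (Ioo_subset_Icc_self hv₀)
  obtain ⟨ε', hε', hinv⟩ := h.isLocalHamiltonian.eventually_flow_eq hv₀U
  have hbox := h.box v₀ hv₀ (min ε ε') (lt_min hε hε')
  have hcont : ContinuousAt (fun u => F.φ t₀ (σ u)) u₀ :=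
    (F.φ.continuous_toFun t₀).continuousAt.comp (h.contMDiffAt u₀ hu₀).continuousAt
  have htend : Tendsto (fun u => F.φ t₀ (σ u)) (𝓝 u₀) (𝓝 (σ v₀)) := by
    rw [← ht₀]; exact hcont
  obtain ⟨r, hr, hball⟩ := Metric.eventually_nhds_iff_ball.1
    ((htend.eventually (h.isLocalHamiltonian.isOpen.mem_nhds hv₀U)).and
      (Ioo_mem_nhds hu₀.1 hu₀.2))
  filter_upwards [htend.eventually hbox, htend.eventually hinv, Metric.ball_mem_nhds u₀ hr]
    with u hu1 hu2 hu3
  have hconst : H (F.φ t₀ (σ u)) - u = H (F.φ t₀ (σ u₀)) - u₀ := by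
    have h1 := (convex_ball u₀ r).norm_image_sub_le_of_norm_hasDerivWithin_le
      (f := fun u => H (F.φ t₀ (σ u)) - u) (f' := fun _ => 1 - 1) (C := 0)
      (fun s hs => ((h.hasDerivAt_flow (hball s hs).2 (hball s hs).1).sub
        (hasDerivAt_id s)).hasDerivWithinAt) (by simp) (Metric.mem_ball_self hr) hu3
    rw [← sub_eq_zero]
    simpa using h1
  rw [ht₀, h.H_eq v₀ (Ioo_subset_Icc_self hv₀)] at hconst
  obtain ⟨t, ht, w, hw, -, htw⟩ := hu1
  have h2 := hu2 t (ht.trans_le (min_le_right _ _))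
  rw [htw, h.H_eq w (Ioo_subset_Icc_self hw)] at h2
  have hw' : v₀ + (u - u₀) = w := by linarith
  refine ⟨t + t₀, by simpa using ht.trans_le (min_le_left _ _), hw' ▸ hw, ?_⟩
  rw [F.φ.map_add, htw, hw']

/-- A Hamiltonian arc is a cross-section of the flow. -/
def flowSection [T2Space M] (h : F.IsHamiltonianArc lo hi σ U H) : FlowSection F.φ :=
  ⟨lo, hi, σ, h.lt, h.continuousOn, h.injOn, h.sep, h.box, h.transl⟩

end IsHamiltonianArc

end AreaPreservingFlow

/-! ### Existence of short Hamiltonian arcs -/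

namespace AreaPreservingFlow

variable {M : Type*} [TopologicalSpace M] [ChartedSpace (EuclideanSpace ℝ (Fin 2)) M]
  [IsManifold (𝓡 2) ∞ M] {F : AreaPreservingFlow M}

theorem Transversal.isHamiltonianArc {a b : ℝ} (Γ : F.Transversal a b) :
    F.IsHamiltonianArc a b Γ.γ Γ.U Γ.H where
  lt := Γ.lt
  continuousOn := Γ.smooth.continuousOn
  contMDiffAt s hs := (Γ.smooth.contMDiffAt (Icc_mem_nhds hs.1 hs.2)).of_le (by simp)
  isLocalHamiltonian := Γ.isLocalHamiltonian
  mem s hs := Γ.subset (mem_image_of_mem _ hs)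
  H_eq := Γ.H_eq
  notMem_fixedPoints s hs h := (Γ.transverse s hs).ne_zero 0 h

/-- Through every nonfixed point there are arbitrarily short Hamiltonian arcs. -/
theorem exists_isHamiltonianArc [T2Space M] (hfix : F.fixedPoints.Finite) {q : M}
    (hq : q ∉ F.fixedPoints) {O : Set M} (hO : O ∈ 𝓝 q) :
    ∃ (lo hi : ℝ) (σ : ℝ → M) (U : Set M) (H : M → ℝ), F.IsHamiltonianArc lo hi σ U H ∧
      (∃ v ∈ Ioo lo hi, σ v = q) ∧ σ '' Icc lo hi ⊆ O := by
  obtain ⟨U, H, hqU, hH⟩ := F.exists_isLocalHamiltonian hfix q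
  have he : (chartAt Plane q).MDifferentiable (𝓡 2) (𝓡 2) :=
    haveI : IsManifold (𝓡 2) 1 M := IsManifold.of_le (n := ∞) (by simp)
    mdifferentiable_chart q
  set e := chartAt Plane q with hedef
  have hqe : q ∈ e.source := mem_chart_source Plane q
  have hqt : e q ∈ e.target := e.map_source hqe
  have hleft : e.symm (e q) = q := e.left_inv hqe
  obtain ⟨v₀, hv₀⟩ : ∃ v, F.form q v ≠ 0 := by
    by_contra! hcon
    exact hq (F.mem_fixedPoints_of_form_eq_zero hcon)
  -- The arc is a chart segment in the direction w, normalized so that H has derivative 1 along it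
  -- at q.
  obtain ⟨w, hw⟩ : ∃ w : Plane, F.chartForm q (e q) w = 1 := by
    obtain ⟨u, hu⟩ : ∃ u : Plane, F.chartForm q (e q) u = F.form q v₀ :=
      ⟨_, F.chartForm_mfderiv q hqe v₀⟩
    refine ⟨(F.form q v₀)⁻¹ • u, ?_⟩
    rw [map_smul, hu, smul_eq_mul, inv_mul_cancel₀ hv₀]
  have hline : ContDiff ℝ 1 fun r : ℝ => e q + r • w := by fun_prop
  have hcurve : ∀ r : ℝ, e q + r • w ∈ e.target →
      ContMDiffAt 𝓘(ℝ, ℝ) (𝓡 2) 1 (fun r : ℝ => e.symm (e q + r • w)) r := by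
    intro r hr
    have h1 : ContMDiffAt (𝓡 2) (𝓡 2) 1 e.symm (e q + r • w) :=
      ((contMDiffOn_chart_symm (I := 𝓡 2) (n := ∞) (x := q)).contMDiffAt
        (e.open_target.mem_nhds hr)).of_le (by simp)
    exact ContMDiffAt.comp r (g := e.symm) h1 hline.contMDiff.contMDiffAt
  have h0t : e q + (0 : ℝ) • w ∈ e.target := by simpa using hqt
  have h0q : e.symm (e q + (0 : ℝ) • w) = q := by simp [hleft]
  set g : ℝ → ℝ := fun r => H (e.symm (e q + r • w)) with hg
  have hgs : ContDiffAt ℝ 1 g 0 := by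
    rw [← contMDiffAt_iff_contDiffAt]
    have h1 : ContMDiffAt (𝓡 2) 𝓘(ℝ, ℝ) 1 H (e.symm (e q + (0 : ℝ) • w)) := by
      rw [h0q]
      exact (hH.smooth.contMDiffAt (hH.isOpen.mem_nhds hqU)).of_le (by simp)
    exact ContMDiffAt.comp (0 : ℝ) h1 (hcurve 0 h0t)
  have hgd : HasFDerivAt g ((ContinuousLinearEquiv.refl ℝ ℝ : ℝ ≃L[ℝ] ℝ) : ℝ →L[ℝ] ℝ) 0 := by
    have h1 : HasFDerivAt (fun r : ℝ => e q + r • w)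
        ((1 : ℝ →L[ℝ] ℝ).smulRight w) 0 :=
      ((hasFDerivAt_id (𝕜 := ℝ) (0 : ℝ)).smul_const w).const_add (e q)
    have h2 := (he.mdifferentiableAt_symm h0t).hasMFDerivAt
    have h3 : HasMFDerivAt (𝓡 2) 𝓘(ℝ, ℝ) H (e.symm (e q + (0 : ℝ) • w))
        (F.form (e.symm (e q + (0 : ℝ) • w))) := hH.hasMFDerivAt (by rw [h0q]; exact hqU)
    have h4 : HasFDerivAt (𝕜 := ℝ) (E := Plane) (F := ℝ) (H ∘ e.symm)
        (F.chartForm q (e q + (0 : ℝ) • w)) (e q + (0 : ℝ) • w) :=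
      hasMFDerivAt_iff_hasFDerivAt.1 (h3.comp (e q + (0 : ℝ) • w) h2)
    have h5 : HasFDerivAt g _ 0 := HasFDerivAt.comp (g := H ∘ e.symm) (0 : ℝ) h4 h1
    convert! h5 using 1
    ext
    simp [hw]
  -- Reparametrization of the segment by the value of H.
  set ρ := hgs.localInverse hgd one_ne_zero with hρ
  have hρs : ContDiffAt ℝ 1 ρ (g 0) := hgs.to_localInverse hgd one_ne_zero
  have hρ0 : ρ (g 0) = 0 := hgs.localInverse_apply_image hgd one_ne_zero
  have hρr : ∀ᶠ s in 𝓝 (g 0), g (ρ s) = s :=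
    (hgs.hasStrictFDerivAt' hgd one_ne_zero).eventually_right_inverse
  have hρc := hρs.continuousAt
  set σ : ℝ → M := fun s => e.symm (e q + ρ s • w) with hσ
  have hσ0 : σ (g 0) = q := by simp only [hσ, hρ0, h0q]
  have ht : ∀ᶠ s in 𝓝 (g 0), e q + ρ s • w ∈ e.target := by
    have : ContinuousAt (fun s => e q + ρ s • w) (g 0) := by fun_prop
    exact this.eventually (e.open_target.mem_nhds (by simpa [hρ0] using h0t))
  have hσs : ∀ᶠ s in 𝓝 (g 0), ContMDiffAt 𝓘(ℝ, ℝ) (𝓡 2) 1 σ s := by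
    filter_upwards [ht, hρs.eventually (by simp)] with s hs1 hs2
    exact ContMDiffAt.comp s (g := fun r : ℝ => e.symm (e q + r • w)) (hcurve _ hs1)
      hs2.contMDiffAt
  have hσc : ContinuousAt σ (g 0) := hσs.self_of_nhds.continuousAt
  have hV : ∀ᶠ x in 𝓝 (σ (g 0)), x ∈ U ∧ x ∈ O ∧ x ∉ F.fixedPoints := by
    rw [hσ0]
    exact inter_mem (hH.isOpen.mem_nhds hqU) (inter_mem hO (hfix.isClosed.isOpen_compl.mem_nhds hq))
  obtain ⟨r, hr, hball⟩ := Metric.nhds_basis_closedBall.eventually_iff.1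
    ((hσc.eventually hV).and (hσs.and hρr))
  rw [Real.closedBall_eq_Icc] at hball
  refine ⟨g 0 - r, g 0 + r, σ, U, H, ⟨by linarith, ?_, ?_, hH, ?_, ?_, ?_⟩, ?_, ?_⟩
  · exact fun s hs => (hball hs).2.1.continuousAt.continuousWithinAt
  · exact fun s hs => (hball (Ioo_subset_Icc_self hs)).2.1
  · exact fun s hs => (hball hs).1.1
  · exact fun s hs => (hball hs).2.2
  · exact fun s hs => (hball hs).1.2.2
  · exact ⟨g 0, ⟨by linarith, by linarith⟩, hσ0⟩
  · rintro _ ⟨s, hs, rfl⟩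
    exact (hball hs).1.2.1

end AreaPreservingFlow

/-! ### Convergence from finitely many cluster points -/

/-- A path in a compact space whose cluster points at infinity form a finite set converges. -/
theorem exists_tendsto_atTop_of_finite_mapClusterPt {M : Type*} [TopologicalSpace M] [T2Space M]
    [CompactSpace M] {ψ : ℝ → M} (hψ : Continuous ψ) {E : Set M} (hE : E.Finite)
    (h : ∀ q, MapClusterPt q atTop ψ → q ∈ E) : ∃ p ∈ E, Tendsto ψ atTop (𝓝 p) := by
  obtain ⟨p, hp⟩ := exists_clusterPt_of_compactSpace (map ψ atTop)
  have hpE : p ∈ E := h p hp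
  refine ⟨p, hpE, ?_⟩
  have hV : (E \ {p})ᶜ ∈ 𝓝 p := (hE.subset sdiff_subset).isClosed.isOpen_compl.mem_nhds (by simp)
  rw [(closed_nhds_basis p).tendsto_right_iff]
  rintro N ⟨hN, hNc⟩
  obtain ⟨W, ⟨hW, hWc⟩, hWN⟩ := (closed_nhds_basis p).mem_iff.1 (inter_mem hN hV)
  -- Infinitely many visits to the compact frontier would produce a cluster point there, but W meets
  -- E at most in the interior point p. By connectedness the path can then no longer leave W.
  have hfr : ∀ᶠ u in atTop, ψ u ∉ frontier W := by
    by_contra hcon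
    rw [not_eventually] at hcon
    simp only [not_not] at hcon
    obtain ⟨q, hq, hqc⟩ := isClosed_frontier.isCompact.exists_mapClusterPt_of_frequently hcon
    have hqE := h q hqc
    have hqW : q ∈ W := hWc.frontier_subset hq
    have hqp : q = p := by
      by_contra hne
      exact (hWN hqW).2 ⟨hqE, hne⟩
    subst hqp
    exact hq.2 (mem_interior_iff_mem_nhds.2 hW)
  obtain ⟨u₀, hu₀⟩ := eventually_atTop.1 hfr
  have hfreq : ∃ᶠ u in atTop, ψ u ∈ W := hp.frequently hW
  obtain ⟨u₁, hu₁, hu₁W⟩ := frequently_atTop.1 hfreq u₀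
  filter_upwards [eventually_ge_atTop u₀] with u hu
  refine (hWN ?_).1
  by_contra huW
  have hpre : IsPreconnected (ψ '' Ici u₀) := isPreconnected_Ici.image _ hψ.continuousOn
  have hin : ∀ r ∈ Ici u₀, ψ r ∈ W → ψ r ∈ interior W := by
    intro r hr hrW
    by_contra hri
    exact hu₀ r hr ⟨subset_closure hrW, hri⟩
  obtain ⟨x, -, hx1, hx2⟩ := hpre (interior W) Wᶜ isOpen_interior hWc.isOpen_compl (by
      rintro _ ⟨r, hr, rfl⟩
      by_cases hrW : ψ r ∈ W
      · exact Or.inl (hin r hr hrW)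
      · exact Or.inr hrW)
    ⟨ψ u₁, mem_image_of_mem _ hu₁, hin u₁ hu₁ hu₁W⟩ ⟨ψ u, mem_image_of_mem _ hu, huW⟩
  exact hx2 (interior_subset hx1)

theorem exists_tendsto_atBot_of_finite_mapClusterPt {M : Type*} [TopologicalSpace M] [T2Space M]
    [CompactSpace M] {ψ : ℝ → M} (hψ : Continuous ψ) {E : Set M} (hE : E.Finite)
    (h : ∀ q, MapClusterPt q atBot ψ → q ∈ E) : ∃ p ∈ E, Tendsto ψ atBot (𝓝 p) := by
  obtain ⟨p, hp, hpt⟩ := exists_tendsto_atTop_of_finite_mapClusterPt (ψ := ψ ∘ Neg.neg)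
    (hψ.comp continuous_neg) hE fun q hq => h q (by
      unfold MapClusterPt at hq ⊢
      rwa [← map_map, map_neg_atTop] at hq)
  refine ⟨p, hp, ?_⟩
  have := hpt.comp tendsto_neg_atBot_atTop
  simpa [Function.comp_def] using this

/-! ### The first return map of a section -/

namespace FlowSection

variable {M : Type*} [TopologicalSpace M] {φ : Flow ℝ M} (S : FlowSection φ)

/-- The arc itself. -/
def carrier : Set M := S.σ '' Icc S.lo S.hi

/-- The positive times at which the orbit of `x` meets the section. -/
def hits (x : M) : Set ℝ := {t | 0 < t ∧ φ t x ∈ S.carrier}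

/-- The first return time. -/
noncomputable def ret (s : ℝ) : ℝ := sInf (S.hits (S.σ s))

/-- The first return map. -/
noncomputable def next (s : ℝ) : ℝ := Function.invFunOn S.σ (Icc S.lo S.hi) (φ (S.ret s) (S.σ s))

/-- The interior parameters whose first return is interior. -/
def regular : Set ℝ := {s | s ∈ Ioo S.lo S.hi ∧ (S.hits (S.σ s)).Nonempty ∧
  S.next s ∈ Ioo S.lo S.hi}

variable {S}

theorem mem_carrier {s : ℝ} (hs : s ∈ Icc S.lo S.hi) : S.σ s ∈ S.carrier := mem_image_of_mem _ hs

theorem isCompact_carrier : IsCompact S.carrier :=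
  isCompact_Icc.image_of_continuousOn S.continuousOn

theorem isClosed_carrier [T2Space M] : IsClosed S.carrier := isCompact_carrier.isClosed

/-- Separation keeps hitting times away from 0, so they form a closed set and the infimum is
attained. -/
theorem isLeast_ret [T2Space M] {s : ℝ} (hs : s ∈ Icc S.lo S.hi)
    (h : (S.hits (S.σ s)).Nonempty) : IsLeast (S.hits (S.σ s)) (S.ret s) := by
  obtain ⟨η, hη, hsep⟩ := S.sep
  have heq : S.hits (S.σ s) = Ici η ∩ (fun t => φ t (S.σ s)) ⁻¹' S.carrier := by
    ext t
    constructor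
    · rintro ⟨ht, htc⟩
      refine ⟨?_, htc⟩
      by_contra hlt
      rw [mem_Ici, not_le] at hlt
      exact hsep _ (mem_carrier hs) t ht.ne' (by rwa [abs_of_pos ht]) htc
    · rintro ⟨ht, htc⟩
      exact ⟨hη.trans_le ht, htc⟩
  have hcl : IsClosed (S.hits (S.σ s)) := by
    rw [heq]
    have : Continuous fun t => φ t (S.σ s) := by fun_prop
    exact isClosed_Ici.inter (isClosed_carrier.preimage this)
  exact hcl.isLeast_csInf h ⟨0, fun t ht => ht.1.le⟩

theorem ret_pos [T2Space M] {s : ℝ} (hs : s ∈ Icc S.lo S.hi)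
    (h : (S.hits (S.σ s)).Nonempty) : 0 < S.ret s := (isLeast_ret hs h).1.1

theorem next_mem [T2Space M] {s : ℝ} (hs : s ∈ Icc S.lo S.hi)
    (h : (S.hits (S.σ s)).Nonempty) : S.next s ∈ Icc S.lo S.hi :=
  Function.invFunOn_mem (isLeast_ret hs h).1.2

theorem flow_ret [T2Space M] {s : ℝ} (hs : s ∈ Icc S.lo S.hi)
    (h : (S.hits (S.σ s)).Nonempty) : φ (S.ret s) (S.σ s) = S.σ (S.next s) :=
  (Function.invFunOn_eq (isLeast_ret hs h).1.2).symm

theorem ret_eq {s τ : ℝ} (h : IsLeast (S.hits (S.σ s)) τ) : S.ret s = τ := h.csInf_eq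

theorem next_eq {s τ v : ℝ} (hv : v ∈ Icc S.lo S.hi) (h : IsLeast (S.hits (S.σ s)) τ)
    (hτ : φ τ (S.σ s) = S.σ v) : S.next s = v := by
  have h1 : ∃ a ∈ Icc S.lo S.hi, S.σ a = φ (S.ret s) (S.σ s) := by
    rw [ret_eq h]
    exact ⟨v, hv, hτ.symm⟩
  refine S.injOn (Function.invFunOn_mem h1) hv ?_
  rw [← hτ, ← ret_eq h]
  exact Function.invFunOn_eq h1

theorem mem_Icc_of_regular {s : ℝ} (hs : s ∈ S.regular) : s ∈ Icc S.lo S.hi :=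
  Ioo_subset_Icc_self hs.1

theorem continuousAt_σ {s : ℝ} (hs : s ∈ Ioo S.lo S.hi) : ContinuousAt S.σ s :=
  S.continuousOn.continuousAt (Icc_mem_nhds hs.1 hs.2)

/-- `transl` supplies a hit at a time t close to the old return time. Nothing precedes it: hits
before η, or within η before t, contradict separation, and the remaining times form a compact
interval on which σ(s₀), hence σ(s), misses the arc. -/
theorem eventually_regular [T2Space M] {s₀ : ℝ} (hs₀ : s₀ ∈ S.regular) {ε : ℝ} (hε : 0 < ε) :
    ∀ᶠ s in 𝓝 s₀, s ∈ S.regular ∧ |S.ret s - S.ret s₀| < ε ∧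
      S.next s = S.next s₀ + (s - s₀) := by
  obtain ⟨η, hη, hsep⟩ := S.sep
  have hI := mem_Icc_of_regular hs₀
  have hleast := isLeast_ret hI hs₀.2.1
  have htr := S.transl s₀ hs₀.1 (S.next s₀) hs₀.2.2 (S.ret s₀) (flow_ret hI hs₀.2.1)
    (min ε (η / 2)) (by positivity)
  have hret : η ≤ S.ret s₀ := by
    by_contra! hlt
    exact hsep _ (mem_carrier hI) _ hleast.1.1.ne' (by rwa [abs_of_pos hleast.1.1]) hleast.1.2
  have hK : ∀ᶠ s in 𝓝 s₀, ∀ r ∈ Icc η (S.ret s₀ - η / 2), φ r (S.σ s) ∉ S.carrier := by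
    refine isCompact_Icc.eventually_forall_of_forall_eventually fun r hr => ?_
    have hc : ContinuousAt (fun z : ℝ × ℝ => φ z.2 (S.σ z.1)) (s₀, r) := by
      have h1 : ContinuousAt (fun z : ℝ × ℝ => S.σ z.1) (s₀, r) :=
        ContinuousAt.comp (f := fun z : ℝ × ℝ => z.1) (continuousAt_σ hs₀.1) continuousAt_fst
      exact ContinuousAt.comp (f := fun z : ℝ × ℝ => (z.2, S.σ z.1))
        (g := fun p : ℝ × M => φ p.1 p.2) (by fun_prop) (continuousAt_snd.prodMk h1)
    refine hc.eventually (isClosed_carrier.isOpen_compl.mem_nhds fun hmem => ?_)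
    have := hleast.2 ⟨by linarith [hr.1], hmem⟩
    linarith [hr.2]
  filter_upwards [htr, hK, Ioo_mem_nhds hs₀.1.1 hs₀.1.2] with s ⟨t, ht, hv, hts⟩ hsK hsI
  have ht1 : |t - S.ret s₀| < ε := ht.trans_le (min_le_left _ _)
  have ht2 := abs_lt.1 (ht.trans_le (min_le_right _ _))
  have htc : φ t (S.σ s) ∈ S.carrier := hts ▸ mem_carrier (Ioo_subset_Icc_self hv)
  have hl : IsLeast (S.hits (S.σ s)) t := by
    refine ⟨⟨by linarith, htc⟩, fun r hr => ?_⟩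
    by_contra! hrt
    have h1 : η ≤ r := by
      by_contra! hlt
      exact hsep _ (mem_carrier (Ioo_subset_Icc_self hsI)) r hr.1.ne'
        (by rwa [abs_of_pos hr.1]) hr.2
    have h2 : η ≤ t - r := by
      by_contra! hlt
      refine hsep _ hr.2 (t - r) (by linarith) (by rwa [abs_of_pos (by linarith)]) ?_
      rwa [← φ.map_add, sub_add_cancel]
    exact hsK r ⟨h1, by linarith⟩ hr.2
  have hn := next_eq (Ioo_subset_Icc_self hv) hl hts
  exact ⟨⟨hsI, ⟨t, hl.1⟩, hn ▸ hv⟩, by rwa [ret_eq hl], hn⟩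

theorem isOpen_regular [T2Space M] : IsOpen S.regular :=
  isOpen_iff_mem_nhds.2 fun _ hs => (eventually_regular hs one_pos).mono fun _ h => h.1

theorem continuousAt_ret [T2Space M] {s₀ : ℝ} (hs₀ : s₀ ∈ S.regular) :
    ContinuousAt S.ret s₀ := by
  refine Metric.tendsto_nhds.2 fun ε hε => ?_
  filter_upwards [eventually_regular hs₀ hε] with s hs
  rw [Real.dist_eq]
  exact hs.2.1

theorem exists_next_eq_add [T2Space M] {J : Set ℝ} (hJo : IsOpen J) (hJc : IsPreconnected J)
    (hJ : J ⊆ S.regular) : ∃ ρ, ∀ s ∈ J, S.next s = s + ρ := by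
  have hd : ∀ s ∈ J, HasDerivAt (fun s => S.next s - s) 0 s := by
    intro s hs
    refine (hasDerivAt_const s (S.next s - s)).congr_of_eventuallyEq ?_
    filter_upwards [eventually_regular (hJ hs) one_pos] with u hu
    rw [hu.2.2]
    ring
  rcases J.eq_empty_or_nonempty with rfl | ⟨r, hr⟩
  · exact ⟨0, by simp⟩
  · refine ⟨S.next r - r, fun s hs => ?_⟩
    have := hJo.is_const_of_deriv_eq_zero hJc
      (fun s hs => (hd s hs).differentiableAt.differentiableWithinAt)
      (fun s hs => (hd s hs).deriv) hs hr
    linarith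

theorem eq_of_isLeast_hits {x y : M} (hx : x ∈ S.carrier) (hy : y ∈ S.carrier) {τ τ' : ℝ}
    (hτ : IsLeast (S.hits x) τ) (hτ' : IsLeast (S.hits y) τ') (h : φ τ x = φ τ' y) : x = y := by
  wlog hle : τ ≤ τ' generalizing x y τ τ'
  · exact (this hy hx hτ' hτ h.symm (le_of_not_ge hle)).symm
  have h1 : φ (τ' - τ) y = x := by
    have : φ (-τ) (φ τ x) = φ (-τ) (φ τ' y) := by rw [h]
    rw [← φ.map_add, ← φ.map_add, neg_add_cancel, φ.map_zero_apply] at this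
    rw [this]
    congr 1
    ring
  rcases hle.eq_or_lt with rfl | hlt
  · simpa using h1.symm
  · have := hτ'.2 (show τ' - τ ∈ S.hits y from ⟨by linarith, h1 ▸ hx⟩)
    linarith [hτ.1.1]

theorem injOn_next [T2Space M] {s s' : ℝ} (hs : s ∈ Icc S.lo S.hi)
    (hs' : s' ∈ Icc S.lo S.hi) (h : (S.hits (S.σ s)).Nonempty) (h' : (S.hits (S.σ s')).Nonempty)
    (heq : S.next s = S.next s') : s = s' := by
  refine S.injOn hs hs' (eq_of_isLeast_hits (mem_carrier hs) (mem_carrier hs')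
    (isLeast_ret hs h) (isLeast_ret hs' h') ?_)
  rw [flow_ret hs h, flow_ret hs' h', heq]

theorem eventually_hit {T : FlowSection φ} {x : M} {t v : ℝ} (hv : v ∈ Ioo T.lo T.hi)
    (h : φ t x = T.σ v) {ε : ℝ} (hε : 0 < ε) :
    ∀ᶠ z in 𝓝 x, ∃ t', |t' - t| < ε ∧ φ t' z ∈ T.carrier := by
  have h1 : Tendsto (φ t) (𝓝 x) (𝓝 (T.σ v)) := by
    rw [← h]
    exact (φ.continuous_toFun t).continuousAt
  filter_upwards [h1.eventually (T.box v hv ε hε)] with z hz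
  obtain ⟨r, hr, w, hw, -, hwz⟩ := hz
  refine ⟨r + t, by simpa using hr, ?_⟩
  rw [φ.map_add, hwz]
  exact mem_carrier (Ioo_subset_Icc_self hw)

end FlowSection

/-! ### Counting crossings of a second section before the first return -/

namespace FlowSection

variable {M : Type*} [TopologicalSpace M] {φ : Flow ℝ M} {S T : FlowSection φ}

variable (S T) in
/-- The parameters on `S` whose orbit meets `T` at least `k` times before the first return. -/
def meets (k : ℕ) : Set ℝ := {s | ∃ t : Fin k → ℝ, Function.Injective t ∧
  ∀ i, 0 < t i ∧ t i < S.ret s ∧ φ (t i) (S.σ s) ∈ T.carrier}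

variable (T) in
theorem exists_gap : ∃ η > 0, ∀ (x : M) (t t' : ℝ), t ≠ t' → φ t x ∈ T.carrier →
    φ t' x ∈ T.carrier → η ≤ |t - t'| := by
  obtain ⟨η, hη, hsep⟩ := T.sep
  refine ⟨η, hη, fun x t t' hne ht ht' => ?_⟩
  by_contra! hlt
  refine hsep _ ht' (t - t') (sub_ne_zero.2 hne) hlt ?_
  rwa [← φ.map_add, sub_add_cancel]

/-- Crossings of T are at least η apart and lie below the return time. -/
theorem exists_notMem_meets (s : ℝ) : ∃ K, s ∉ S.meets T K := by
  obtain ⟨η, hη, hgap⟩ := T.exists_gap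
  refine ⟨⌊S.ret s / η⌋₊ + 2, ?_⟩
  rintro ⟨t, htinj, ht⟩
  have hinj : Function.Injective fun i => ⌊t i / η⌋₊ := by
    intro i j hij
    by_contra hne
    have h1 := hgap _ _ _ (fun h => hne (htinj h)) (ht i).2.2 (ht j).2.2
    have h2 : |t i / η - t j / η| < 1 := by
      have hij' : (⌊t i / η⌋₊ : ℝ) = ⌊t j / η⌋₊ := congrArg Nat.cast hij
      have e1 := Nat.floor_le (div_nonneg (ht i).1.le hη.le)
      have e2 := Nat.lt_floor_add_one (t i / η)
      have e3 := Nat.floor_le (div_nonneg (ht j).1.le hη.le)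
      have e4 := Nat.lt_floor_add_one (t j / η)
      rw [abs_lt]
      constructor <;> linarith
    rw [← sub_div, abs_div, abs_of_pos hη, div_lt_one hη] at h2
    linarith
  have hle : ∀ i, ⌊t i / η⌋₊ ∈ Finset.range (⌊S.ret s / η⌋₊ + 1) := by
    intro i
    rw [Finset.mem_range, Nat.lt_succ_iff]
    exact Nat.floor_le_floor (by gcongr; exact (ht i).2.1.le)
  have := Finset.card_le_card_of_injOn (s := Finset.univ) _ (fun i _ => hle i) hinj.injOn
  simp at this

/-- The set is clopen in J. It is open because crossings occur at interior points of T and persist.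
It is closed because limits of crossing times are still crossings, remain distinct by the gap, and
cannot reach 0 or the return time since T is disjoint from S. -/
theorem subset_meets [T2Space M] {J : Set ℝ} (hJo : IsOpen J) (hJc : IsPreconnected J)
    (hJ : J ⊆ S.regular) (hdisj : Disjoint S.carrier T.carrier)
    (hend : ∀ s ∈ J, ∀ t, 0 < t → t < S.ret s →
      φ t (S.σ s) ≠ T.σ T.lo ∧ φ t (S.σ s) ≠ T.σ T.hi) {k : ℕ}
    (hne : (J ∩ S.meets T k).Nonempty) : J ⊆ S.meets T k := by
  obtain ⟨η, hη, hgap⟩ := T.exists_gap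
  have hopen : IsOpen (J ∩ S.meets T k) := by
    rw [isOpen_iff_mem_nhds]
    rintro s₀ ⟨hs₀, t, htinj, ht⟩
    have hev : ∀ i, ∀ᶠ s in 𝓝 s₀, ∃ t', |t' - t i| < η / 2 ∧ 0 < t' ∧ t' < S.ret s ∧
        φ t' (S.σ s) ∈ T.carrier := by
      intro i
      obtain ⟨hi0, hi1, v, hv, hvt⟩ := ht i
      have hvI : v ∈ Ioo T.lo T.hi := by
        have h1 := hend s₀ hs₀ (t i) hi0 hi1
        rw [← hvt] at h1
        exact ⟨hv.1.lt_of_ne fun h => h1.1 (by rw [h]), hv.2.lt_of_ne fun h => h1.2 (by rw [h])⟩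
      set ε := min (η / 2) (min (t i) ((S.ret s₀ - t i) / 2)) with hε
      have hε0 : 0 < ε := by
        have : 0 < S.ret s₀ - t i := by linarith
        positivity
      have e1 : ε ≤ η / 2 := min_le_left _ _
      have e2 : ε ≤ t i := (min_le_right _ _).trans (min_le_left _ _)
      have e3 : ε ≤ (S.ret s₀ - t i) / 2 := (min_le_right _ _).trans (min_le_right _ _)
      have hc := continuousAt_σ (hJ hs₀).1
      filter_upwards [hc.eventually (eventually_hit hvI hvt.symm hε0),
        eventually_regular (hJ hs₀) hε0] with s ⟨t', ht', hhit⟩ ⟨_, hret, _⟩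
      have h1 := abs_lt.1 ht'
      have h2 := abs_lt.1 hret
      exact ⟨t', ht'.trans_le e1, by linarith, by linarith, hhit⟩
    filter_upwards [hJo.mem_nhds hs₀, eventually_all.2 hev] with s hsJ hs
    choose t' ht' using hs
    refine ⟨hsJ, t', fun i j hij => ?_, fun i => (ht' i).2⟩
    by_contra hne
    have h1 := hgap _ _ _ (fun h => hne (htinj h)) (ht i).2.2 (ht j).2.2
    have h2 := ht' i
    have h3 := ht' j
    rw [hij] at h2
    have h4 : |t i - t j| < η := by
      have := abs_lt.1 h2.1
      have := abs_lt.1 h3.1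
      rw [abs_lt]
      constructor <;> linarith
    linarith
  have hsub : J ⊆ J ∩ S.meets T k := by
    refine hJc.subset_of_closure_inter_subset hopen
      (hne.mono fun s hs => ⟨hs.1, hs⟩) ?_
    rintro s₀ ⟨hs₀c, hs₀⟩
    refine ⟨hs₀, ?_⟩
    obtain ⟨u, hu, hus₀⟩ := mem_closure_iff_ultrafilter.1 hs₀c
    have hex : ∀ s, ∃ t : Fin k → ℝ, s ∈ S.meets T k → (Function.Injective t ∧
        ∀ i, 0 < t i ∧ t i < S.ret s ∧ φ (t i) (S.σ s) ∈ T.carrier) := by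
      intro s
      by_cases hs : s ∈ S.meets T k
      · obtain ⟨t, ht⟩ := hs
        exact ⟨t, fun _ => ht⟩
      · exact ⟨fun _ => 0, fun h => absurd h hs⟩
    choose t ht using hex
    have hreg := hJ hs₀
    have hret : Tendsto S.ret u (𝓝 (S.ret s₀)) := (continuousAt_ret hreg).tendsto.mono_left hus₀
    have hσ : Tendsto S.σ u (𝓝 (S.σ s₀)) := (continuousAt_σ hreg.1).tendsto.mono_left hus₀
    have hmeets : ∀ᶠ s in (u : Filter ℝ), s ∈ S.meets T k :=
      mem_of_superset hu inter_subset_right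
    have hlim : ∀ i, ∃ L, Tendsto (fun s => t s i) u (𝓝 L) := by
      intro i
      have h1 : ∀ᶠ s in (u : Filter ℝ), t s i ∈ Icc 0 (S.ret s₀ + 1) := by
        filter_upwards [hmeets, hret.eventually (Iio_mem_nhds (lt_add_one _))] with s hs hs'
        have h2 := (ht s hs).2 i
        exact ⟨h2.1.le, by linarith⟩
      obtain ⟨L, -, hL⟩ := isCompact_Icc.ultrafilter_le_nhds (u.map fun s => t s i)
        (le_principal_iff.2 h1)
      exact ⟨L, hL⟩
    choose L hL using hlim
    have hpos : ∀ i, Tendsto (fun s => φ (t s i) (S.σ s)) u (𝓝 (φ (L i) (S.σ s₀))) := by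
      intro i
      have hc : Continuous fun p : ℝ × M => φ p.1 p.2 := by fun_prop
      exact (hc.tendsto (L i, S.σ s₀)).comp ((hL i).prodMk_nhds hσ)
    have hmem : ∀ i, φ (L i) (S.σ s₀) ∈ T.carrier := by
      intro i
      refine isClosed_carrier.mem_of_tendsto (hpos i) ?_
      filter_upwards [hmeets] with s hs using ((ht s hs).2 i).2.2
    refine ⟨L, fun i j hij => ?_, fun i => ⟨?_, ?_, hmem i⟩⟩
    · by_contra hne
      have h1 : η ≤ |L i - L j| := by
        refine ge_of_tendsto ((hL i).sub (hL j)).abs ?_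
        filter_upwards [hmeets] with s hs
        have h2 := ht s hs
        exact hgap _ _ _ (fun h => hne (h2.1 h)) (h2.2 i).2.2 (h2.2 j).2.2
      rw [hij] at h1
      simp at h1
      linarith
    · refine lt_of_le_of_ne (ge_of_tendsto (hL i) ?_) fun h => ?_
      · filter_upwards [hmeets] with s hs using ((ht s hs).2 i).1.le
      · have h1 := hmem i
        rw [← h, φ.map_zero_apply] at h1
        exact Set.disjoint_left.1 hdisj (mem_carrier (mem_Icc_of_regular hreg)) h1
    · refine lt_of_le_of_ne (le_of_tendsto_of_tendsto (hL i) hret ?_) fun h => ?_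
      · filter_upwards [hmeets] with s hs using ((ht s hs).2 i).2.1.le
      · have h1 := hmem i
        rw [h, flow_ret (mem_Icc_of_regular hreg) hreg.2.1] at h1
        exact Set.disjoint_left.1 hdisj (mem_carrier (Ioo_subset_Icc_self hreg.2.2)) h1
  exact hsub.trans inter_subset_right

/-- At most one orbit of the section meets a given point before its first return. -/
theorem subsingleton_before_return [T2Space M] (e : M) :
    {s | s ∈ S.regular ∧ ∃ t, 0 < t ∧ t < S.ret s ∧ φ t (S.σ s) = e}.Subsingleton := by
  rintro s ⟨hs, t, ht0, ht1, hte⟩ s' ⟨hs', t', ht0', ht1', hte'⟩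
  wlog hle : t ≤ t' generalizing s s' t t'
  · exact (this hs' t' ht0' ht1' hte' hs t ht0 ht1 hte (le_of_not_ge hle)).symm
  have h1 : φ (t' - t) (S.σ s') = S.σ s := by
    have : φ (-t) (φ t' (S.σ s')) = φ (-t) (φ t (S.σ s)) := by rw [hte, hte']
    rw [← φ.map_add, ← φ.map_add, neg_add_cancel, φ.map_zero_apply] at this
    rw [← this]
    congr 1
    ring
  have hI := mem_Icc_of_regular hs
  have hI' := mem_Icc_of_regular hs'
  rcases hle.eq_or_lt with rfl | hlt
  · exact (S.injOn hI' hI (by simpa using h1)).symm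
  · have := (isLeast_ret hI' hs'.2.1).2 ⟨sub_pos.2 hlt, h1 ▸ mem_carrier hI⟩
    linarith

/-- A filter of regular parameters that approaches a parameter from one side. -/
structure IsSide (S : FlowSection φ) (l : Filter ℝ) (c : ℝ) : Prop where
  neBot : l.NeBot
  le_nhds : l ≤ 𝓝 c
  mem : c ∈ Icc S.lo S.hi
  basis : ∀ E : Set ℝ, E.Finite → ∃ J ⊆ S.regular \ E, IsOpen J ∧ IsPreconnected J ∧ J ∈ l

namespace IsSide

variable {l : Filter ℝ} {c : ℝ}

theorem right {d : ℝ} (hc : c ∈ Icc S.lo S.hi) (hcd : c < d) (h : Ioo c d ⊆ S.regular) :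
    S.IsSide (𝓝[>] c) c where
  neBot := inferInstance
  le_nhds := nhdsWithin_le_nhds
  mem := hc
  basis E hE := by
    have h1 : (E \ {c})ᶜ ∈ 𝓝 c := (hE.subset sdiff_subset).isClosed.isOpen_compl.mem_nhds (by simp)
    obtain ⟨r, hr, hball⟩ := Metric.mem_nhds_iff.1 h1
    rw [Real.ball_eq_Ioo] at hball
    have hlt : c < min d (c + r) := lt_min hcd (by linarith)
    refine ⟨Ioo c (min d (c + r)), fun s hs => ⟨h ⟨hs.1, hs.2.trans_le (min_le_left _ _)⟩,
      fun hsE => ?_⟩, isOpen_Ioo, isPreconnected_Ioo, Ioo_mem_nhdsGT hlt⟩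
    exact hball ⟨by linarith [hs.1], hs.2.trans_le (min_le_right _ _)⟩ ⟨hsE, hs.1.ne'⟩

theorem left {d : ℝ} (hc : c ∈ Icc S.lo S.hi) (hcd : d < c) (h : Ioo d c ⊆ S.regular) :
    S.IsSide (𝓝[<] c) c where
  neBot := inferInstance
  le_nhds := nhdsWithin_le_nhds
  mem := hc
  basis E hE := by
    have h1 : (E \ {c})ᶜ ∈ 𝓝 c := (hE.subset sdiff_subset).isClosed.isOpen_compl.mem_nhds (by simp)
    obtain ⟨r, hr, hball⟩ := Metric.mem_nhds_iff.1 h1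
    rw [Real.ball_eq_Ioo] at hball
    have hlt : max d (c - r) < c := max_lt hcd (by linarith)
    refine ⟨Ioo (max d (c - r)) c, fun s hs => ⟨h ⟨(le_max_left _ _).trans_lt hs.1, hs.2⟩,
      fun hsE => ?_⟩, isOpen_Ioo, isPreconnected_Ioo, Ioo_mem_nhdsLT hlt⟩
    exact hball ⟨(le_max_right _ _).trans_lt hs.1, by linarith [hs.2]⟩ ⟨hsE, hs.2.ne⟩

theorem eventually_regular (h : S.IsSide l c) : ∀ᶠ s in l, s ∈ S.regular := by
  obtain ⟨J, hJ, -, -, hJl⟩ := h.basis ∅ finite_empty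
  exact mem_of_superset hJl fun s hs => (hJ hs).1

theorem tendsto_σ (h : S.IsSide l c) : Tendsto S.σ l (𝓝 (S.σ c)) := by
  refine (S.continuousOn c h.mem).mono_left (le_inf h.le_nhds ?_)
  rw [le_principal_iff]
  exact h.eventually_regular.mono fun s hs => mem_Icc_of_regular hs

/-- If return times stayed bounded along some ultrafilter, their limit, at least η, would be a
return time of c. -/
theorem tendsto_ret [T2Space M] (h : S.IsSide l c) (hc : S.hits (S.σ c) = ∅) :
    Tendsto S.ret l atTop := by
  rw [tendsto_atTop]
  intro B
  by_contra hcon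
  rw [not_eventually] at hcon
  have hne : (l ⊓ 𝓟 {s | ¬ B ≤ S.ret s}).NeBot := frequently_mem_iff_neBot.1 hcon
  obtain ⟨u, hu⟩ := Ultrafilter.exists_le (l ⊓ 𝓟 {s | ¬ B ≤ S.ret s})
  obtain ⟨hul, hu⟩ := le_inf_iff.1 hu
  rw [le_principal_iff] at hu
  obtain ⟨η, hη, hgap⟩ := S.exists_gap
  have hreg : ∀ᶠ s in (u : Filter ℝ), s ∈ S.regular := hul h.eventually_regular
  have hη' : ∀ᶠ s in (u : Filter ℝ), S.ret s ∈ Icc η B := by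
    filter_upwards [hreg, hu] with s hs hsB
    have h1 := isLeast_ret (mem_Icc_of_regular hs) hs.2.1
    have h2 := hgap (S.σ s) (S.ret s) 0 h1.1.1.ne' h1.1.2
      (by simpa using mem_carrier (mem_Icc_of_regular hs))
    rw [sub_zero, abs_of_pos h1.1.1] at h2
    exact ⟨h2, (not_le.1 hsB).le⟩
  obtain ⟨L, hLI, hL⟩ := isCompact_Icc.ultrafilter_le_nhds (u.map S.ret) (le_principal_iff.2 hη')
  have hcont : Continuous fun p : ℝ × M => φ p.1 p.2 := by fun_prop
  have hL' : Tendsto S.ret u (𝓝 L) := hL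
  have hpos : Tendsto (fun s => φ (S.ret s) (S.σ s)) u (𝓝 (φ L (S.σ c))) :=
    (hcont.tendsto (L, S.σ c)).comp (hL'.prodMk_nhds (h.tendsto_σ.mono_left hul))
  have hmem : φ L (S.σ c) ∈ S.carrier := by
    refine isClosed_carrier.mem_of_tendsto hpos ?_
    filter_upwards [hreg] with s hs using (isLeast_ret (mem_Icc_of_regular hs) hs.2.1).1.2
  have : L ∈ S.hits (S.σ c) := ⟨hη.trans_le hLI.1, hmem⟩
  rw [hc] at this
  exact this

/-- Near the side, the orbits meet a disjoint section a bounded number of times before the first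
return. -/
theorem exists_eventually_notMem_meets [T2Space M] (h : S.IsSide l c)
    (hdisj : Disjoint S.carrier T.carrier) : ∃ K, ∀ᶠ s in l, s ∉ S.meets T K := by
  -- At most two parameters pass through the ends of T. On an interval without them the crossing
  -- count is constant, so a bound for one parameter serves for all.
  obtain ⟨J, hJ, hJo, hJc, hJl⟩ := h.basis _
    ((subsingleton_before_return (S := S) (T.σ T.lo)).finite.union
      (subsingleton_before_return (S := S) (T.σ T.hi)).finite)
  have hne := h.neBot
  obtain ⟨r, hr⟩ := hne.nonempty_of_mem hJl
  obtain ⟨K, hK⟩ := exists_notMem_meets (S := S) (T := T) r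
  refine ⟨K, mem_of_superset hJl fun s hs hsK => hK ?_⟩
  refine subset_meets hJo hJc (fun s hs => (hJ hs).1) hdisj (fun s hs t ht0 ht1 => ?_)
    ⟨s, hs, hsK⟩ hr
  exact ⟨fun he => (hJ hs).2 (Or.inl ⟨(hJ hs).1, t, ht0, ht1, he⟩),
    fun he => (hJ hs).2 (Or.inr ⟨(hJ hs).1, t, ht0, ht1, he⟩)⟩

end IsSide

end FlowSection

/-! ### Limits of long orbit segments -/

namespace Flow

variable {M : Type*} [TopologicalSpace M]

/-- The stationary points of a flow. -/
def rest (φ : Flow ℝ M) : Set M := {x | ∀ t, φ t x = x}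

/-- Through every nonstationary point there are arbitrarily short sections. -/
def HasSections (φ : Flow ℝ M) : Prop := ∀ q, q ∉ φ.rest → ∀ O ∈ 𝓝 q,
  ∃ T : FlowSection φ, (∃ v ∈ Ioo T.lo T.hi, T.σ v = q) ∧ T.carrier ⊆ O

theorem eq_of_map_eq (φ : Flow ℝ M) {x y : M} {s t : ℝ} (h : φ s x = φ t y) :
    φ (s - t) x = y := by
  have : φ (-t) (φ s x) = φ (-t) (φ t y) := by rw [h]
  rw [← φ.map_add, ← φ.map_add, neg_add_cancel, φ.map_zero_apply] at this
  rw [← this]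
  congr 1
  ring

theorem map_notMem_rest (φ : Flow ℝ M) {x : M} (hx : x ∉ φ.rest) (t : ℝ) : φ t x ∉ φ.rest := by
  intro h
  have h1 : φ (-t) (φ t x) = φ t x := h (-t)
  rw [← φ.map_add, neg_add_cancel, φ.map_zero_apply] at h1
  exact hx (h1 ▸ h)

end Flow

namespace FlowSection

variable {M : Type*} [TopologicalSpace M] {φ : Flow ℝ M} {S T : FlowSection φ}

theorem notMem_rest {x : M} (hx : x ∈ S.carrier) : x ∉ φ.rest := by
  intro h
  obtain ⟨η, hη, hgap⟩ := S.exists_gap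
  have := hgap x (η / 2) 0 (by positivity) (by rwa [h]) (by simpa using hx)
  rw [sub_zero, abs_of_pos (by positivity)] at this
  linarith

/-- A nonstationary point can be moved off a section by an arbitrarily short time. -/
theorem exists_flow_notMem (S : FlowSection φ) (q : M) {ε : ℝ} (hε : 0 < ε) :
    ∃ r, |r| < ε ∧ φ r q ∉ S.carrier := by
  obtain ⟨η, hη, hgap⟩ := S.exists_gap
  by_cases hq : q ∈ S.carrier
  · refine ⟨min (η / 2) (ε / 2), ?_, fun h => ?_⟩
    · rw [abs_of_pos (by positivity)]
      exact (min_le_right _ _).trans_lt (by linarith)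
    · have := hgap q (min (η / 2) (ε / 2)) 0 (by positivity) h (by simpa using hq)
      rw [sub_zero, abs_of_pos (by positivity)] at this
      linarith [min_le_left (η / 2) (ε / 2)]
  · exact ⟨0, by simpa, by simpa⟩

namespace IsSide

variable {l : Filter ℝ} {c : ℝ}

/-- Limits of orbit points that stay far from the returns have only stationary limit points. -/
theorem mem_rest_of_mapClusterPt [T2Space M] (hφ : φ.HasSections) (h : S.IsSide l c)
    {f : Filter ℝ} [f.NeBot] (hf : f ≤ l) {t : ℝ → ℝ} {z : M}
    (hz : Tendsto (fun s => φ (t s) (S.σ s)) f (𝓝 z)) {g : Filter ℝ}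
    (hg : ∀ N : ℝ, ∀ᶠ u in g, N < |u|)
    (hP : ∀ᶠ u in g, ∀ᶠ s in f, 1 < t s + u ∧ t s + u + 1 < S.ret s) {q : M}
    (hq : MapClusterPt q g (fun u => φ u z)) : q ∈ φ.rest := by
  by_contra hqr
  -- The limit point may lie on S; moving it slightly along its orbit allows T to be disjoint from
  -- S.
  obtain ⟨r, hr, hrS⟩ := S.exists_flow_notMem q (ε := 1 / 4) (by norm_num)
  obtain ⟨T, ⟨v, hv, hvq⟩, hTS⟩ := hφ (φ r q) (φ.map_notMem_rest hqr r) S.carrierᶜ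
    (isClosed_carrier.isOpen_compl.mem_nhds hrS)
  have hdisj : Disjoint S.carrier T.carrier := by
    rw [Set.disjoint_right]
    exact fun x hx => hTS hx
  obtain ⟨K, hK⟩ := h.exists_eventually_notMem_meets hdisj
  have hbox : ∀ᶠ y in 𝓝 q, ∃ w ∈ Ioo T.lo T.hi, ∃ t', |t'| < 1 / 2 ∧ φ t' y = T.σ w := by
    have h1 : Tendsto (φ r) (𝓝 q) (𝓝 (T.σ v)) := by
      rw [hvq]
      exact (φ.continuous_toFun r).continuousAt
    filter_upwards [h1.eventually (T.box v hv (1 / 4) (by norm_num))] with y hy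
    obtain ⟨t', ht', w, hw, -, hwy⟩ := hy
    refine ⟨w, hw, t' + r, ?_, by rw [φ.map_add, hwy]⟩
    have := abs_add_le t' r
    linarith
  -- Infinitely many near-crossings of T by the orbit of z, more than 2 apart. For nearby parameters
  -- each shifts by less than 1, so K of them stay distinct and contradict the bound.
  obtain ⟨u, hu, hsep⟩ := exists_seq_of_forall_finset_exists
    (fun u : ℝ => (∀ᶠ s in f, 1 < t s + u ∧ t s + u + 1 < S.ret s) ∧
      ∃ w ∈ Ioo T.lo T.hi, ∃ t', |t'| < 1 / 2 ∧ φ t' (φ u z) = T.σ w)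
    (fun x y => 2 < |x - y|) (by
      intro E hE
      obtain ⟨B, hB⟩ : ∃ B, ∀ x ∈ E, |x| ≤ B := by
        obtain ⟨B, hB⟩ := (E.finite_toSet.image fun x => |x|).bddAbove
        exact ⟨B, fun x hx => hB (mem_image_of_mem _ hx)⟩
      obtain ⟨u, hu2, hu1, hu3⟩ := ((hq.frequently hbox).and_eventually
        (hP.and (hg (B + 2)))).exists
      refine ⟨u, ⟨hu1, hu2⟩, fun x hx => ?_⟩
      have h1 := hB x hx
      have h2 := abs_sub_abs_le_abs_sub u x
      rw [abs_sub_comm] at h2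
      linarith)
  have hev : ∀ i : Fin K, ∀ᶠ s in f, ∃ t', |t' - (t s + u i)| < 1 ∧ 0 < t' ∧ t' < S.ret s ∧
      φ t' (S.σ s) ∈ T.carrier := by
    intro i
    obtain ⟨h1, w, hw, t₁, ht₁, hwt⟩ := hu i
    have h2 := hz.eventually (eventually_hit hw (x := z) (t := t₁ + u i)
      (by rw [φ.map_add, hwt]) (ε := 1 / 2) (by norm_num))
    filter_upwards [h1, h2] with s hs1 ⟨t₂, ht₂, hhit⟩
    have e1 := abs_lt.1 ht₁
    have e2 := abs_lt.1 ht₂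
    refine ⟨t₂ + t s, ?_, by linarith, by linarith, by rwa [φ.map_add]⟩
    rw [abs_lt]
    constructor <;> linarith
  obtain ⟨s, hs, hsK⟩ := ((eventually_all.2 hev).and (hf hK)).exists
  choose t' ht' using hs
  refine hsK ⟨t', fun i j hij => ?_, fun i => (ht' i).2⟩
  by_contra hne
  wlog hlt : i < j generalizing i j
  · exact this j i hij.symm (Ne.symm hne) (lt_of_le_of_ne (not_lt.1 hlt) (Ne.symm hne))
  have h1 := hsep i j hlt
  have h2 := abs_lt.1 (ht' i).1
  have h3 := abs_lt.1 (ht' j).1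
  rw [hij] at h2
  have h4 : |u i - u j| < 2 := by
    rw [abs_lt]
    constructor <;> linarith
  linarith

/-- Here t(s) is the time elapsed since leaving S. Since the time left before return tends to
infinity, the whole forward orbit of z is approximated by segments before return. -/
theorem exists_tendsto_atTop [T2Space M] [CompactSpace M] (hφ : φ.HasSections)
    (hrest : φ.rest.Finite) (h : S.IsSide l c)
    {f : Filter ℝ} [f.NeBot] (hf : f ≤ l) {t : ℝ → ℝ} {z : M}
    (hz : Tendsto (fun s => φ (t s) (S.σ s)) f (𝓝 z)) (ht : ∀ᶠ s in f, 0 ≤ t s)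
    (ht' : Tendsto (fun s => S.ret s - t s) f atTop) :
    ∃ p ∈ φ.rest, Tendsto (fun u => φ u z) atTop (𝓝 p) := by
  refine exists_tendsto_atTop_of_finite_mapClusterPt (by fun_prop) hrest fun q hq =>
    h.mem_rest_of_mapClusterPt hφ hf hz (g := atTop) (fun N => ?_) ?_ hq
  · exact tendsto_abs_atTop_atTop.eventually_gt_atTop N
  · filter_upwards [eventually_gt_atTop 1] with u hu
    filter_upwards [ht, ht'.eventually_gt_atTop (u + 1)] with s h1 h2
    constructor <;> linarith

theorem exists_tendsto_atBot [T2Space M] [CompactSpace M] (hφ : φ.HasSections)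
    (hrest : φ.rest.Finite) (h : S.IsSide l c)
    {f : Filter ℝ} [f.NeBot] (hf : f ≤ l) {t : ℝ → ℝ} {z : M}
    (hz : Tendsto (fun s => φ (t s) (S.σ s)) f (𝓝 z)) (ht : ∀ᶠ s in f, t s ≤ S.ret s)
    (ht' : Tendsto t f atTop) :
    ∃ p ∈ φ.rest, Tendsto (fun u => φ u z) atBot (𝓝 p) := by
  refine exists_tendsto_atBot_of_finite_mapClusterPt (by fun_prop) hrest fun q hq =>
    h.mem_rest_of_mapClusterPt hφ hf hz (g := atBot) (fun N => ?_) ?_ hq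
  · exact tendsto_abs_atBot_atTop.eventually_gt_atTop N
  · filter_upwards [eventually_lt_atBot (-1)] with u hu
    filter_upwards [ht, ht'.eventually_gt_atTop (1 - u)] with s h1 h2
    constructor <;> linarith

end IsSide

end FlowSection

/-! ### Singular parameters and recurrence -/

namespace FlowSection

variable {M : Type*} [TopologicalSpace M] {φ : Flow ℝ M} {S T : FlowSection φ}

variable (S) in
/-- The endpoints, the parameters whose first return is an endpoint, and the parameters that do
not return and converge to a stationary point. -/
def singular : Set ℝ := {s | s ∈ Icc S.lo S.hi ∧ ((s = S.lo ∨ s = S.hi) ∨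
  ((S.hits (S.σ s)).Nonempty ∧ (S.next s = S.lo ∨ S.next s = S.hi)) ∨
  (S.hits (S.σ s) = ∅ ∧ ∃ p ∈ φ.rest, Tendsto (fun t => φ t (S.σ s)) atTop (𝓝 p)))}

/-- Two orbit points of nonreturning parameters coincide only trivially. -/
theorem eq_of_hits_eq_empty {s s' t t' : ℝ} (hs : s ∈ Icc S.lo S.hi) (hs' : s' ∈ Icc S.lo S.hi)
    (h : S.hits (S.σ s) = ∅) (h' : S.hits (S.σ s') = ∅) (heq : φ t (S.σ s) = φ t' (S.σ s')) :
    s = s' ∧ t = t' := by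
  have htt : t = t' := by
    rcases lt_trichotomy t t' with hlt | rfl | hlt
    · have h1 : t' - t ∈ S.hits (S.σ s') :=
        ⟨sub_pos.2 hlt, by rw [φ.eq_of_map_eq heq.symm]; exact mem_carrier hs⟩
      rw [h'] at h1
      exact h1.elim
    · rfl
    · have h1 : t - t' ∈ S.hits (S.σ s) :=
        ⟨sub_pos.2 hlt, by rw [φ.eq_of_map_eq heq]; exact mem_carrier hs'⟩
      rw [h] at h1
      exact h1.elim
  subst htt
  have := φ.eq_of_map_eq heq
  rw [sub_self, φ.map_zero_apply] at this
  exact ⟨S.injOn hs hs' this, rfl⟩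

/-- The return map is injective, so each end has at most one preimage. Nonreturning convergent
parameters lie on pairwise distinct stable trajectories, of which there are finitely many. -/
theorem finite_singular [T2Space M]
    (hsep : {O : Set M | ∃ z, z ∉ φ.rest ∧ O = range (fun t => φ t z) ∧
      ∃ p ∈ φ.rest, Tendsto (fun t => φ t z) atTop (𝓝 p)}.Finite) : S.singular.Finite := by
  have h1 : ∀ e, {s | s ∈ Icc S.lo S.hi ∧ (S.hits (S.σ s)).Nonempty ∧ S.next s = e}.Finite := by
    intro e
    refine Set.Subsingleton.finite ?_
    rintro s ⟨hs, hn, he⟩ s' ⟨hs', hn', he'⟩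
    exact injOn_next hs hs' hn hn' (he.trans he'.symm)
  have h2 : {s | s ∈ Icc S.lo S.hi ∧ S.hits (S.σ s) = ∅ ∧
      ∃ p ∈ φ.rest, Tendsto (fun t => φ t (S.σ s)) atTop (𝓝 p)}.Finite := by
    refine Set.Finite.of_finite_image (f := fun s => range fun t => φ t (S.σ s))
      (hsep.subset ?_) ?_
    · rintro _ ⟨s, ⟨hs, -, hp⟩, rfl⟩
      exact ⟨S.σ s, notMem_rest (mem_carrier hs), rfl, hp⟩
    · rintro s ⟨hs, he, -⟩ s' ⟨hs', he', -⟩ heq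
      have h3 : S.σ s' ∈ range fun t => φ t (S.σ s) := by
        simp only at heq
        rw [heq]
        exact ⟨0, φ.map_zero_apply _⟩
      obtain ⟨t, ht⟩ := h3
      exact (eq_of_hits_eq_empty (t := t) (t' := 0) hs hs' he he' (by simpa using ht)).1
  refine (((finite_singleton S.lo).union (finite_singleton S.hi)).union
    (((h1 S.lo).union (h1 S.hi)).union h2)).subset ?_
  rintro s ⟨hs, (h | h) | ⟨hn, h | h⟩ | ⟨hn, h⟩⟩
  · exact Or.inl (Or.inl h)
  · exact Or.inl (Or.inr h)
  · exact Or.inr (Or.inl (Or.inl ⟨hs, hn, h⟩))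
  · exact Or.inr (Or.inl (Or.inr ⟨hs, hn, h⟩))
  · exact Or.inr (Or.inr ⟨hs, hn, h⟩)

theorem mem_regular_of_notMem_singular [T2Space M] {s : ℝ} (hs : s ∈ Icc S.lo S.hi)
    (h : s ∉ S.singular) (hne : (S.hits (S.σ s)).Nonempty) : s ∈ S.regular := by
  have hn := next_mem hs hne
  refine ⟨⟨hs.1.lt_of_ne fun he => h ⟨hs, Or.inl (Or.inl he.symm)⟩,
    hs.2.lt_of_ne fun he => h ⟨hs, Or.inl (Or.inr he)⟩⟩, hne,
    hn.1.lt_of_ne fun he => h ⟨hs, Or.inr (Or.inl ⟨hne, Or.inl he.symm⟩)⟩,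
    hn.2.lt_of_ne fun he => h ⟨hs, Or.inr (Or.inl ⟨hne, Or.inr he⟩)⟩⟩

theorem hits_eq_empty_of_notMem [T2Space M] {s : ℝ} (hs : s ∈ Icc S.lo S.hi)
    (h : s ∉ S.singular) (hr : s ∉ S.regular) : S.hits (S.σ s) = ∅ := by
  by_contra hne
  exact hr (mem_regular_of_notMem_singular hs h (nonempty_iff_ne_empty.2 hne))

theorem IsSide.mem_singular [T2Space M] [CompactSpace M] (hφ : φ.HasSections)
    (hrest : φ.rest.Finite) {l : Filter ℝ} {c : ℝ} (h : S.IsSide l c)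
    (hc : S.hits (S.σ c) = ∅) : c ∈ S.singular := by
  have := h.neBot
  refine ⟨h.mem, Or.inr (Or.inr ⟨hc, ?_⟩)⟩
  refine h.exists_tendsto_atTop hφ hrest le_rfl (t := fun _ => 0) (by simpa using h.tendsto_σ)
    (by simp) (by simpa using h.tendsto_ret hc)

/-- The regular set is open. A first nonregular point reached from a regular one would be
nonreturning and one-sidedly approached by regular parameters, hence singular. -/
theorem subset_regular [T2Space M] [CompactSpace M] (hφ : φ.HasSections)
    (hrest : φ.rest.Finite) {J : Set ℝ} (hJo : J.OrdConnected)
    (hJ : J ⊆ Ioo S.lo S.hi \ S.singular) (hne : (J ∩ S.regular).Nonempty) : J ⊆ S.regular := by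
  obtain ⟨r, hrJ, hr⟩ := hne
  intro x hxJ
  by_contra hx
  have key : ∀ c ∈ J, c ∉ S.regular → ∀ l, S.IsSide l c → False := fun c hcJ hc l hl =>
    (hJ hcJ).2 (hl.mem_singular hφ hrest
      (hits_eq_empty_of_notMem (Ioo_subset_Icc_self (hJ hcJ).1) (hJ hcJ).2 hc))
  rcases lt_or_ge r x with hlt | hle
  · have hcpt : IsCompact (Icc r x \ S.regular) := isCompact_Icc.diff isOpen_regular
    obtain ⟨c, ⟨hcI, hcr⟩, hcl⟩ := hcpt.exists_isLeast ⟨x, ⟨hlt.le, le_rfl⟩, hx⟩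
    have hcJ : c ∈ J := hJo.out hrJ hxJ hcI
    have hrc : r < c := hcI.1.lt_of_ne fun h => hcr (h ▸ hr)
    refine key c hcJ hcr _ (IsSide.left (Ioo_subset_Icc_self (hJ hcJ).1) hrc fun s hs => ?_)
    by_contra hsr
    exact absurd (hcl ⟨⟨hs.1.le, hs.2.le.trans hcI.2⟩, hsr⟩) (not_le.2 hs.2)
  · have hcpt : IsCompact (Icc x r \ S.regular) := isCompact_Icc.diff isOpen_regular
    obtain ⟨c, ⟨hcI, hcr⟩, hcl⟩ := hcpt.exists_isGreatest ⟨x, ⟨le_rfl, hle⟩, hx⟩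
    have hcJ : c ∈ J := hJo.out hxJ hrJ hcI
    have hrc : c < r := hcI.2.lt_of_ne fun h => hcr (h ▸ hr)
    refine key c hcJ hcr _ (IsSide.right (Ioo_subset_Icc_self (hJ hcJ).1) hrc fun s hs => ?_)
    by_contra hsr
    exact absurd (hcl ⟨⟨hcI.1.trans hs.1.le, hs.2.le⟩, hsr⟩) (not_le.2 hs.1)

/-- Recurrence: a parameter that does not return is singular. -/
theorem mem_regular [T2Space M] [CompactSpace M] (hφ : φ.HasSections)
    (hrest : φ.rest.Finite)
    (hsep : {O : Set M | ∃ z, z ∉ φ.rest ∧ O = range (fun t => φ t z) ∧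
      ∃ p ∈ φ.rest, Tendsto (fun t => φ t z) atTop (𝓝 p)}.Finite)
    {c : ℝ} (hc : c ∈ Icc S.lo S.hi) (hcs : c ∉ S.singular) : c ∈ S.regular := by
  by_contra hcr
  have hcI : c ∈ Ioo S.lo S.hi :=
    ⟨hc.1.lt_of_ne fun he => hcs ⟨hc, Or.inl (Or.inl he.symm)⟩,
      hc.2.lt_of_ne fun he => hcs ⟨hc, Or.inl (Or.inr he)⟩⟩
  -- a neighbourhood of nonreturning parameters
  obtain ⟨δ, hδ, hball⟩ := Metric.mem_nhds_iff.1 (inter_mem (Ioo_mem_nhds hcI.1 hcI.2)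
    ((finite_singular (S := S) hsep).isClosed.isOpen_compl.mem_nhds hcs))
  have hJr : ∀ s ∈ Metric.ball c δ, s ∉ S.regular := by
    intro s hs hsr
    refine hcr (subset_regular hφ hrest (J := Metric.ball c δ) ?_ (fun x hx => hball hx)
      ⟨s, hs, hsr⟩ (Metric.mem_ball_self hδ))
    rw [Real.ball_eq_Ioo]
    exact ordConnected_Ioo
  have hJI : ∀ s ∈ Metric.ball c δ, s ∈ Icc S.lo S.hi := fun s hs =>
    Ioo_subset_Icc_self (hball hs).1
  have hJe : ∀ s ∈ Metric.ball c δ, S.hits (S.σ s) = ∅ := fun s hs =>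
    hits_eq_empty_of_notMem (hJI s hs) (hball hs).2 (hJr s hs)
  have hcJ : c ∈ Metric.ball c δ := Metric.mem_ball_self hδ
  -- a nonstationary limit point and a section there
  obtain ⟨q, hq, hqr⟩ : ∃ q, MapClusterPt q atTop (fun u => φ u (S.σ c)) ∧ q ∉ φ.rest := by
    by_contra! hcon
    exact hcs ⟨hc, Or.inr (Or.inr ⟨hJe c hcJ,
      exists_tendsto_atTop_of_finite_mapClusterPt (by fun_prop) hrest hcon⟩)⟩
  obtain ⟨T, ⟨v, hv, hvq⟩, -⟩ := hφ q hqr univ univ_mem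
  have hhit : ∀ B : ℝ, ∃ u > B, ∃ w ∈ Ioo T.lo T.hi, φ u (S.σ c) = T.σ w := by
    intro B
    have h1 := T.box v hv 1 one_pos
    rw [hvq] at h1
    obtain ⟨u, ⟨t, ht, w, hw, -, hwt⟩, hu⟩ :=
      ((hq.frequently h1).and_eventually (eventually_gt_atTop (B + 1))).exists
    have := abs_lt.1 ht
    exact ⟨t + u, by linarith, w, hw, by rw [φ.map_add, hwt]⟩
  have hfin := finite_singular (S := T) hsep
  -- The orbit of c passes at most once through each of the finitely many singular points of T, so a
  -- late crossing v₀ has none ahead of it.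
  obtain ⟨B, hB⟩ : BddAbove {u | ∃ d ∈ T.singular, φ u (S.σ c) = T.σ d} := by
    refine Set.Finite.bddAbove ((hfin.biUnion (t := fun d => {u | φ u (S.σ c) = T.σ d})
      fun d _ => Set.Subsingleton.finite ?_).subset ?_)
    · intro u hu u' hu'
      exact (eq_of_hits_eq_empty hc hc (hJe c hcJ) (hJe c hcJ) (hu.trans hu'.symm)).2
    · rintro u ⟨d, hd, hu⟩
      exact mem_biUnion hd hu
  obtain ⟨u₀, hu₀B, v₀, hv₀, huv⟩ := hhit B
  obtain ⟨η, hη, hgap⟩ := T.exists_gap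
  set near : ℝ → Prop := fun w => ∃ s ∈ Metric.ball c δ, ∃ t, |t - u₀| < η / 2 ∧
    φ t (S.σ s) = T.σ w with hnear
  have hnear0 : near v₀ := ⟨c, hcJ, u₀, by simpa using half_pos hη, huv⟩
  -- two nearby parameters of `T` on the same orbit coincide
  have huniq : ∀ w w' r r', w ∈ Icc T.lo T.hi → w' ∈ Icc T.lo T.hi → near w → near w' →
      φ r (T.σ w) = φ r' (T.σ w') → w = w' ∧ r = r' := by
    rintro w w' r r' hw hw' ⟨s, hs, t, ht, hst⟩ ⟨s', hs', t', ht', hst'⟩ heq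
    rw [← hst, ← hst', ← φ.map_add, ← φ.map_add] at heq
    obtain ⟨rfl, h2⟩ := eq_of_hits_eq_empty (hJI s hs) (hJI s' hs') (hJe s hs) (hJe s' hs') heq
    have htt : t = t' := by
      by_contra hne
      have h3 := hgap (S.σ s) t t' hne (hst ▸ mem_carrier hw) (hst' ▸ mem_carrier hw')
      have h4 := abs_lt.1 ht
      have h5 := abs_lt.1 ht'
      have h6 : |t - t'| < η := by
        rw [abs_lt]
        constructor <;> linarith
      linarith
    subst htt
    exact ⟨T.injOn hw hw' (hst.symm.trans hst'), by linarith⟩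
  have hbad : {w | w ∈ Icc T.lo T.hi ∧ near w ∧
      ∃ d ∈ T.singular, ∃ r, 0 ≤ r ∧ φ r (T.σ w) = T.σ d}.Finite := by
    refine (hfin.biUnion (t := fun d => {w | w ∈ Icc T.lo T.hi ∧ near w ∧
      ∃ r, 0 ≤ r ∧ φ r (T.σ w) = T.σ d}) fun d _ => Set.Subsingleton.finite ?_).subset ?_
    · rintro w ⟨hw, hwn, r, -, hr⟩ w' ⟨hw', hwn', r', -, hr'⟩
      exact (huniq w w' r r' hw hw' hwn hwn' (hr.trans hr'.symm)).1
    · rintro w ⟨hw, hwn, d, hd, hr⟩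
      exact mem_biUnion hd ⟨hw, hwn, hr⟩
  have hbad0 : v₀ ∉ {w | w ∈ Icc T.lo T.hi ∧ near w ∧
      ∃ d ∈ T.singular, ∃ r, 0 ≤ r ∧ φ r (T.σ w) = T.σ d} := by
    rintro ⟨-, -, d, hd, r, hr, hrd⟩
    rw [← huv, ← φ.map_add] at hrd
    have := hB ⟨d, hd, hrd⟩
    linarith
  have hnearev : ∀ᶠ w in 𝓝 v₀, near w := by
    have h1 := S.box c hcI (min δ (η / 2)) (by positivity)
    have h2 : Tendsto (fun w => φ (-u₀) (T.σ w)) (𝓝 v₀) (𝓝 (S.σ c)) := by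
      have h3 : φ (-u₀) (T.σ v₀) = S.σ c := by
        rw [← huv, ← φ.map_add, neg_add_cancel, φ.map_zero_apply]
      rw [← h3]
      exact (φ.continuous_toFun (-u₀)).continuousAt.comp (continuousAt_σ hv₀)
    filter_upwards [h2.eventually h1] with w hw
    obtain ⟨t, ht, s, hs, hsc, hts⟩ := hw
    refine ⟨s, ?_, u₀ - t, ?_, ?_⟩
    · rw [Metric.mem_ball, Real.dist_eq]
      exact hsc.trans_le (min_le_left _ _)
    · rw [sub_sub_cancel_left, abs_neg]
      exact ht.trans_le (min_le_right _ _)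
    · rw [← hts, ← φ.map_add, ← φ.map_add]
      simp
  obtain ⟨ε, hε, hI⟩ := Metric.eventually_nhds_iff_ball.1 (hnearev.and
    (inter_mem (Ioo_mem_nhds hv₀.1 hv₀.2) (hbad.isClosed.isOpen_compl.mem_nhds hbad0)))
  have hv₀I : v₀ ∈ Metric.ball v₀ ε := Metric.mem_ball_self hε
  have hIT : ∀ w ∈ Metric.ball v₀ ε, w ∈ Icc T.lo T.hi := fun w hw =>
    Ioo_subset_Icc_self (hI w hw).2.1
  have hgood : ∀ w ∈ Metric.ball v₀ ε, ∀ d ∈ T.singular, ∀ r, 0 ≤ r → φ r (T.σ w) ≠ T.σ d :=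
    fun w hw d hd r hr he => (hI w hw).2.2 ⟨hIT w hw, (hI w hw).1, d, hd, r, hr, he⟩
  -- the interval returns to `T` forever
  let Q : ℝ × (ℝ → ℝ) → Prop := fun x => ∀ w ∈ Metric.ball v₀ ε, w + x.1 ∈ Ioo T.lo T.hi ∧
    0 ≤ x.2 w ∧ φ (x.2 w) (T.σ w) = T.σ (w + x.1)
  have hstep : ∀ x : {x // Q x}, ∃ y : {y // Q y}, ∀ w ∈ Metric.ball v₀ ε,
      x.1.2 w < y.1.2 w := by
    rintro ⟨⟨ρ, τ⟩, hx⟩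
    have hx' : ∀ w ∈ Metric.ball v₀ ε, w + ρ ∈ Ioo T.lo T.hi ∧ 0 ≤ τ w ∧
      φ (τ w) (T.σ w) = T.σ (w + ρ) := hx
    have hsub : Metric.ball (v₀ + ρ) ε ⊆ Ioo T.lo T.hi \ T.singular := by
      intro y hy
      have hy' : y - ρ ∈ Metric.ball v₀ ε := by
        rw [Metric.mem_ball, Real.dist_eq] at hy ⊢
        rwa [sub_sub, add_comm ρ v₀]
      obtain ⟨h1, h2, h3⟩ := hx' _ hy'
      rw [sub_add_cancel] at h1 h3
      exact ⟨h1, fun hys => hgood _ hy' y hys _ h2 h3⟩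
    have h0 := Metric.mem_ball_self (x := v₀ + ρ) hε
    -- The centre does return: it lies on the orbit of c, which crosses T at arbitrarily late times.
    -- `subset_regular` then carries the whole ball along.
    have hreg0 : v₀ + ρ ∈ T.regular := by
      refine mem_regular_of_notMem_singular (Ioo_subset_Icc_self (hsub h0).1) (hsub h0).2 ?_
      obtain ⟨u, hu, w, hw, huw⟩ := hhit (τ v₀ + u₀)
      refine ⟨u - (τ v₀ + u₀), sub_pos.2 hu, ?_⟩
      rw [← (hx' v₀ hv₀I).2.2, ← huv, ← φ.map_add, ← φ.map_add]
      rw [show u - (τ v₀ + u₀) + τ v₀ + u₀ = u by ring, huw]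
      exact mem_carrier (Ioo_subset_Icc_self hw)
    have hreg : Metric.ball (v₀ + ρ) ε ⊆ T.regular := by
      refine subset_regular hφ hrest ?_ hsub ⟨_, h0, hreg0⟩
      rw [Real.ball_eq_Ioo]
      exact ordConnected_Ioo
    obtain ⟨ρ₁, hρ₁⟩ := exists_next_eq_add Metric.isOpen_ball
      (convex_ball (v₀ + ρ) ε).isPreconnected hreg
    have hshift : ∀ w ∈ Metric.ball v₀ ε, w + ρ ∈ Metric.ball (v₀ + ρ) ε := by
      intro w hw
      rw [Metric.mem_ball, Real.dist_eq] at hw ⊢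
      rwa [add_sub_add_right_eq_sub]
    refine ⟨⟨(ρ + ρ₁, fun w => T.ret (w + ρ) + τ w), fun w hw => ?_⟩, fun w hw => ?_⟩
    · have h1 := hreg (hshift w hw)
      have h2 := hρ₁ _ (hshift w hw)
      have h3 := mem_Icc_of_regular h1
      have h4 := flow_ret h3 h1.2.1
      rw [h2] at h4
      refine ⟨?_, ?_, ?_⟩
      · have := h1.2.2
        rw [h2] at this
        rwa [← add_assoc]
      · have := ret_pos h3 h1.2.1
        have := (hx' w hw).2.1
        change 0 ≤ T.ret (w + ρ) + τ w
        linarith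
      · change φ (T.ret (w + ρ) + τ w) (T.σ w) = T.σ (w + (ρ + ρ₁))
        rw [φ.map_add, (hx' w hw).2.2, h4, add_assoc]
    · have h1 := hreg (hshift w hw)
      have := ret_pos (mem_Icc_of_regular h1) h1.2.1
      change τ w < T.ret (w + ρ) + τ w
      linarith
  choose step hstep using hstep
  let x : ℕ → {x // Q x} := fun n => Nat.rec ⟨(0, fun _ => 0), fun w hw => by
    simpa using (hI w hw).2.1⟩ (fun _ y => step y) n
  have hmono : ∀ w ∈ Metric.ball v₀ ε, StrictMono fun n => (x n).1.2 w := fun w hw =>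
    strictMono_nat_of_lt_succ fun n => hstep (x n) w hw
  -- two of the translates are close: contradiction
  obtain ⟨a, -, ψ, hψ, hψa⟩ := (isCompact_Icc (a := T.lo) (b := T.hi)).tendsto_subseq
    (x := fun n => v₀ + (x n).1.1) fun n => Ioo_subset_Icc_self ((x n).2 v₀ hv₀I).1
  obtain ⟨N, hN⟩ := Metric.cauchySeq_iff.1 hψa.cauchySeq ε hε
  set m := ψ N with hm
  set n := ψ (N + 1) with hn
  have hmn : m < n := hψ (Nat.lt_succ_self N)
  have hdist : dist (v₀ + (x m).1.1) (v₀ + (x n).1.1) < ε := hN N le_rfl (N + 1) (by simp)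
  -- Two centres less than ε apart: the n-th image of w is the m-th image of v₀. Since nearby
  -- parameters share no orbit, w = v₀ and the two times coincide, although times strictly increase.
  set w := v₀ + (x m).1.1 - (x n).1.1 with hw
  have hwI : w ∈ Metric.ball v₀ ε := by
    rw [Real.dist_eq] at hdist
    rw [Metric.mem_ball, Real.dist_eq, hw]
    convert! hdist using 2
    ring
  have h1 := ((x n).2 w hwI).2.2
  have h2 := ((x m).2 v₀ hv₀I).2.2
  have h3 : w + (x n).1.1 = v₀ + (x m).1.1 := by rw [hw]; ring
  rw [h3, ← h2] at h1
  obtain ⟨h4, h5⟩ := huniq w v₀ _ _ (hIT w hwI) (hIT v₀ hv₀I) (hI w hwI).1 hnear0 h1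
  rw [h4] at h5
  exact absurd ((hmono v₀ hv₀I).injective h5) hmn.ne'

end FlowSection

/-- A path that leaves an open set has a first exit point on the frontier. -/
theorem exists_first_exit {M : Type*} [TopologicalSpace M] {ψ : ℝ → M} (hψ : Continuous ψ)
    {W : Set M} (hW : IsOpen W) {a b : ℝ} (hab : a ≤ b) (ha : ψ a ∈ W) (hb : ψ b ∉ W) :
    ∃ t ∈ Icc a b, ψ t ∈ frontier W ∧ ∀ r ∈ Ico a t, ψ r ∈ W := by
  have hcpt : IsCompact (Icc a b ∩ ψ ⁻¹' Wᶜ) :=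
    isCompact_Icc.inter_right (hW.isClosed_compl.preimage hψ)
  obtain ⟨t, ⟨htI, htW⟩, htl⟩ := hcpt.exists_isLeast ⟨b, ⟨hab, le_rfl⟩, hb⟩
  have hin : ∀ r ∈ Ico a t, ψ r ∈ W := by
    intro r hr
    by_contra hrW
    exact absurd (htl ⟨⟨hr.1, hr.2.le.trans htI.2⟩, hrW⟩) (not_le.2 hr.2)
  have hat : a < t := htI.1.lt_of_ne fun h => htW (h ▸ ha)
  refine ⟨t, htI, ⟨?_, by rwa [hW.interior_eq]⟩, hin⟩
  have h1 : t ∈ closure (Ico a t) := by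
    rw [closure_Ico hat.ne]
    exact ⟨hat.le, le_rfl⟩
  exact closure_mono (image_subset_iff.2 hin) (image_closure_subset_closure_image hψ
    (mem_image_of_mem ψ h1))

/-! ### Chains of stationary points reached by the one-sided limit of the returns -/

namespace FlowSection

variable {M : Type*} [TopologicalSpace M] {φ : Flow ℝ M} {S T : FlowSection φ}

namespace IsSide

variable {l : Filter ℝ} {c : ℝ}

theorem exists_nhds_visits [T2Space M] (hφ : φ.HasSections) (h : S.IsSide l c) {q : M}
    (hq : q ∉ φ.rest) : ∃ N ∈ 𝓝 q, ∃ K : ℕ, ∀ᶠ s in l, ∀ E : Finset ℝ,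
      (E : Set ℝ).Pairwise (fun x y => 2 < |x - y|) →
      (∀ e ∈ E, 1 < e ∧ e + 1 < S.ret s ∧ φ e (S.σ s) ∈ N) → E.card ≤ K := by
  obtain ⟨r, hr, hrS⟩ := S.exists_flow_notMem q (ε := 1 / 4) (by norm_num)
  obtain ⟨T, ⟨v, hv, hvq⟩, hTS⟩ := hφ (φ r q) (φ.map_notMem_rest hq r) S.carrierᶜ
    (isClosed_carrier.isOpen_compl.mem_nhds hrS)
  have hdisj : Disjoint S.carrier T.carrier := by
    rw [Set.disjoint_right]
    exact fun x hx => hTS hx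
  obtain ⟨K, hK⟩ := h.exists_eventually_notMem_meets hdisj
  have hbox : ∀ᶠ y in 𝓝 q, ∃ t', |t'| < 1 / 2 ∧ φ t' y ∈ T.carrier := by
    filter_upwards [eventually_hit hv hvq.symm (ε := 1 / 4) (by norm_num)] with y ⟨t', ht', hy⟩
    have h1 := abs_lt.1 ht'
    have h2 := abs_lt.1 hr
    exact ⟨t', by rw [abs_lt]; constructor <;> linarith, hy⟩
  refine ⟨_, hbox, K, ?_⟩
  filter_upwards [hK] with s hs E hE hE'
  by_contra! hlt
  -- K of the visits suffice: each gives a crossing of T within time 1/2, and spacing above 2 keeps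
  -- the crossings distinct.
  let e := E.orderEmbOfCardLe hlt.le
  have he : ∀ i, e i ∈ E := fun i => E.orderEmbOfCardLe_mem hlt.le i
  choose t' ht' using fun i => (hE' _ (he i)).2.2
  refine hs ⟨fun i => t' i + e i, fun i j hij => ?_, fun i => ?_⟩
  · by_contra hne
    have h1 := hE (he i) (he j) (e.injective.ne hne)
    have h2 := abs_lt.1 (ht' i).1
    have h3 := abs_lt.1 (ht' j).1
    simp only at hij
    have h4 : |e i - e j| < 2 := by
      rw [abs_lt]
      constructor <;> linarith
    linarith
  · have h2 := abs_lt.1 (ht' i).1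
    have h3 := hE' _ (he i)
    refine ⟨by linarith, by linarith, ?_⟩
    rw [φ.map_add]
    exact (ht' i).2

/-- The number of visits to a compact set without stationary points is bounded near the side. -/
theorem exists_visits_le [T2Space M] (hφ : φ.HasSections) (h : S.IsSide l c) {C : Set M}
    (hC : IsCompact C) (hCr : Disjoint C φ.rest) : ∃ K : ℕ, ∀ᶠ s in l, ∀ E : Finset ℝ,
      (E : Set ℝ).Pairwise (fun x y => 2 < |x - y|) →
      (∀ e ∈ E, 1 < e ∧ e + 1 < S.ret s ∧ φ e (S.σ s) ∈ C) → E.card ≤ K := by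
  classical
  refine hC.induction_on (p := fun C => ∃ K : ℕ, ∀ᶠ s in l, ∀ E : Finset ℝ,
      (E : Set ℝ).Pairwise (fun x y => 2 < |x - y|) →
      (∀ e ∈ E, 1 < e ∧ e + 1 < S.ret s ∧ φ e (S.σ s) ∈ C) → E.card ≤ K) ?_ ?_ ?_ ?_
  · refine ⟨0, Eventually.of_forall fun s E _ hE => ?_⟩
    rw [Nat.le_zero, Finset.card_eq_zero, Finset.eq_empty_iff_forall_notMem]
    exact fun e he => (hE e he).2.2
  · rintro A B hAB ⟨K, hK⟩
    refine ⟨K, hK.mono fun s hs E hE hE' => hs E hE fun e he => ?_⟩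
    exact ⟨(hE' e he).1, (hE' e he).2.1, hAB (hE' e he).2.2⟩
  · rintro A B ⟨K, hK⟩ ⟨K', hK'⟩
    refine ⟨K + K', ?_⟩
    filter_upwards [hK, hK'] with s hs hs' E hE hE'
    rw [← Finset.card_filter_add_card_filter_not (s := E) (fun e => φ e (S.σ s) ∈ A)]
    refine add_le_add (hs _ (hE.mono fun e he => ?_) fun e he => ?_)
      (hs' _ (hE.mono fun e he => ?_) fun e he => ?_)
    · exact (Finset.mem_filter.1 he).1
    · obtain ⟨h1, h2⟩ := Finset.mem_filter.1 he
      exact ⟨(hE' e h1).1, (hE' e h1).2.1, h2⟩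
    · exact (Finset.mem_filter.1 he).1
    · obtain ⟨h1, h2⟩ := Finset.mem_filter.1 he
      exact ⟨(hE' e h1).1, (hE' e h1).2.1, (hE' e h1).2.2.resolve_left h2⟩
  · intro q hq
    obtain ⟨N, hN, K, hK⟩ := h.exists_nhds_visits hφ (Set.disjoint_left.1 hCr hq)
    exact ⟨N, mem_nhdsWithin_of_mem_nhds hN, K, hK⟩

/-- The limit of the returns on one side of a nonreturning parameter is reached through a chain of
stationary points and connecting orbits. -/
theorem reach [T2Space M] [CompactSpace M] (hφ : φ.HasSections) (hrest : φ.rest.Finite)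
    (h : S.IsSide l c) (hc : S.hits (S.σ c) = ∅) {y : M}
    (hlim : Tendsto (fun s => S.σ (S.next s)) l (𝓝 y)) (R : M → Prop)
    (hstart : ∀ p ∈ φ.rest, ∀ y, Tendsto (fun t => φ t (S.σ c)) atTop (𝓝 p) →
      Tendsto (fun t => φ t y) atBot (𝓝 p) → R y)
    (hstep : ∀ z ∉ φ.rest, R z → ∀ p ∈ φ.rest, ∀ y, Tendsto (fun t => φ t z) atTop (𝓝 p) →
      Tendsto (fun t => φ t y) atBot (𝓝 p) → R y) : R y := by
  classical
  by_contra hRy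
  have := h.neBot
  obtain ⟨u, hul⟩ := Ultrafilter.exists_le l
  have hreg : ∀ᶠ s in (u : Filter ℝ), s ∈ S.regular := hul h.eventually_regular
  have hcont : Continuous fun p : ℝ × M => φ p.1 p.2 := by fun_prop
  -- neighbourhoods of the stationary points
  have hWex : ∀ p ∈ φ.rest, ∃ W, IsOpen W ∧ p ∈ W ∧ closure W ∩ φ.rest ⊆ {p} ∧
      Disjoint (closure W) S.carrier := by
    intro p hp
    have hN : (φ.rest \ {p} ∪ S.carrier)ᶜ ∈ 𝓝 p := by
      refine ((hrest.subset sdiff_subset).isClosed.union isClosed_carrier).isOpen_compl.mem_nhds ?_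
      rintro (hp' | hp')
      · exact hp'.2 rfl
      · exact notMem_rest hp' hp
    obtain ⟨N, ⟨hNp, hNc⟩, hNs⟩ := (closed_nhds_basis p).mem_iff.1 hN
    have hcl : closure (interior N) ⊆ N := closure_minimal interior_subset hNc
    refine ⟨interior N, isOpen_interior, mem_interior_iff_mem_nhds.2 hNp, ?_, ?_⟩
    · rintro x ⟨hx, hxr⟩
      by_contra hxp
      exact hNs (hcl hx) (Or.inl ⟨hxr, hxp⟩)
    · rw [Set.disjoint_left]
      exact fun x hx hxS => hNs (hcl hx) (Or.inr hxS)
  choose! W hWo hpW hWr hWS using hWex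
  -- Every link of the chain will cost one visit to C, which contains no stationary point; visits
  -- are therefore bounded and the chain is finite.
  set C := ⋃ p ∈ φ.rest, frontier (W p) with hCdef
  have hCc : IsCompact C := hrest.isCompact_biUnion fun p _ => isClosed_frontier.isCompact
  have hCr : Disjoint C φ.rest := by
    rw [Set.disjoint_left]
    intro x hx hxr
    obtain ⟨p, hp, hxp⟩ := mem_iUnion₂.1 hx
    have h1 : x = p := hWr p hp ⟨hxp.1, hxr⟩
    subst h1
    rw [(hWo x hp).frontier_eq] at hxp
    exact hxp.2 (hpW x hp)
  obtain ⟨K, hK⟩ := h.exists_visits_le hφ hCc hCr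
  -- arbitrarily long chains
  have key : ∀ k : ℕ, ∃ (t : ℝ → ℝ) (z : M), z ∉ φ.rest ∧ (∀ᶠ s in (u : Filter ℝ), 0 ≤ t s) ∧
      Tendsto (fun s => S.ret s - t s) u atTop ∧
      Tendsto (fun s => φ (t s) (S.σ s)) u (𝓝 z) ∧
      (∀ p ∈ φ.rest, ∀ y, Tendsto (fun t => φ t z) atTop (𝓝 p) →
        Tendsto (fun t => φ t y) atBot (𝓝 p) → R y) ∧
      ∀ᶠ s in (u : Filter ℝ), ∃ E : Finset ℝ, E.card = k ∧
        (E : Set ℝ).Pairwise (fun x y => 2 < |x - y|) ∧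
        ∀ e ∈ E, 1 < e ∧ e ≤ t s ∧ φ e (S.σ s) ∈ C := by
    intro k
    induction k with
    | zero =>
      refine ⟨fun _ => 0, S.σ c, notMem_rest (mem_carrier h.mem), by simp, ?_, ?_, hstart, ?_⟩
      · simpa using (h.tendsto_ret hc).mono_left hul
      · simpa using h.tendsto_σ.mono_left hul
      · exact Eventually.of_forall fun s => ⟨∅, by simp⟩
    | succ k ih =>
      obtain ⟨t, z, hz, ht0, hret, htz, hext, hE⟩ := ih
      obtain ⟨p, hp, hzp⟩ := h.exists_tendsto_atTop hφ hrest hul htz ht0 hret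
      obtain ⟨T₁, hT₁⟩ := eventually_atTop.1 (hzp.eventually ((hWo p hp).mem_nhds (hpW p hp)))
      set T₀ := max T₁ 0 with hT₀
      have hT₀W : ∀ r, T₀ ≤ r → φ r z ∈ W p := fun r hr => hT₁ r ((le_max_left _ _).trans hr)
      have htube : ∀ B, ∀ᶠ s in (u : Filter ℝ), ∀ r ∈ Icc T₀ B, φ (r + t s) (S.σ s) ∈ W p := by
        intro B
        have h1 : ∀ᶠ x in 𝓝 z, ∀ r ∈ Icc T₀ B, φ r x ∈ W p := by
          refine isCompact_Icc.eventually_forall_of_forall_eventually fun r hr => ?_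
          have h2 : Continuous fun x : M × ℝ => φ x.2 x.1 := by fun_prop
          exact h2.continuousAt.eventually ((hWo p hp).mem_nhds (hT₀W r hr.1))
        filter_upwards [htz.eventually h1] with s hs r hr
        rw [φ.map_add]
        exact hs r hr
      have hexit : ∀ s, ∃ t', (s ∈ S.regular ∧ T₀ + t s ≤ S.ret s ∧
          φ (T₀ + t s) (S.σ s) ∈ W p) → t' ∈ Icc (T₀ + t s) (S.ret s) ∧
            φ t' (S.σ s) ∈ frontier (W p) ∧ ∀ r ∈ Ico (T₀ + t s) t', φ r (S.σ s) ∈ W p := by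
        intro s
        by_cases hs : s ∈ S.regular ∧ T₀ + t s ≤ S.ret s ∧ φ (T₀ + t s) (S.σ s) ∈ W p
        · obtain ⟨hs1, hs2, hs3⟩ := hs
          have hend : φ (S.ret s) (S.σ s) ∉ W p := fun hmem =>
            Set.disjoint_left.1 (hWS p hp) (subset_closure hmem)
              (isLeast_ret (mem_Icc_of_regular hs1) hs1.2.1).1.2
          obtain ⟨t', ht'⟩ := exists_first_exit (ψ := fun r => φ r (S.σ s)) (by fun_prop)
            (hWo p hp) hs2 hs3 hend
          exact ⟨t', fun _ => ht'⟩
        · exact ⟨0, fun hs' => absurd hs' hs⟩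
      choose t' ht' using hexit
      have hgood : ∀ᶠ s in (u : Filter ℝ), t' s ∈ Icc (T₀ + t s) (S.ret s) ∧
          φ (t' s) (S.σ s) ∈ frontier (W p) ∧
            ∀ r ∈ Ico (T₀ + t s) (t' s), φ r (S.σ s) ∈ W p := by
        filter_upwards [hreg, hret.eventually_ge_atTop T₀, htube T₀] with s h1 h2 h3
        exact ht' s ⟨h1, by linarith, h3 T₀ ⟨le_rfl, le_rfl⟩⟩
      -- After T₀ the orbit of z never leaves W(p), so nearby orbits stay there for any prescribed
      -- time.
      have hfar : ∀ B, ∀ᶠ s in (u : Filter ℝ), t s + B < t' s := by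
        intro B
        filter_upwards [hgood, htube B] with s ⟨h1, h2, _⟩ h3
        by_contra! hle
        have h4 := h3 (t' s - t s) ⟨by linarith [h1.1], by linarith⟩
        rw [sub_add_cancel] at h4
        rw [(hWo p hp).frontier_eq] at h2
        exact h2.2 h4
      have ht'top : Tendsto t' u atTop := by
        rw [tendsto_atTop]
        intro B
        filter_upwards [hfar B, ht0] with s h1 h2
        linarith
      obtain ⟨z', -, hz'⟩ := isCompact_univ.ultrafilter_le_nhds
        (u.map fun s => φ (t' s) (S.σ s)) (by simp)
      have hz' : Tendsto (fun s => φ (t' s) (S.σ s)) u (𝓝 z') := hz'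
      have hz'C : z' ∈ C := by
        refine mem_biUnion hp (isClosed_frontier.mem_of_tendsto hz' ?_)
        filter_upwards [hgood] with s hs using hs.2.1
      have hz'r : z' ∉ φ.rest := Set.disjoint_left.1 hCr hz'C
      -- The backward orbit of z' stays in the closure of W(p), whose only stationary point is p.
      have hz'p : Tendsto (fun r => φ r z') atBot (𝓝 p) := by
        obtain ⟨p', hp', hlim'⟩ := h.exists_tendsto_atBot hφ hrest hul hz'
          (hgood.mono fun s hs => hs.1.2) ht'top
        have hcl : ∀ r < 0, φ r z' ∈ closure (W p) := by
          intro r hr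
          have h1 : Tendsto (fun s => φ r (φ (t' s) (S.σ s))) u (𝓝 (φ r z')) :=
            ((φ.continuous_toFun r).tendsto z').comp hz'
          refine isClosed_closure.mem_of_tendsto h1 ?_
          filter_upwards [hgood, hfar (T₀ - r)] with s h2 h3
          rw [← φ.map_add]
          exact subset_closure (h2.2.2 _ ⟨by linarith, by linarith⟩)
        have hpp : p' ∈ closure (W p) :=
          isClosed_closure.mem_of_tendsto hlim' ((eventually_lt_atBot 0).mono hcl)
        have : p' = p := hWr p hp ⟨hpp, hp'⟩
        rwa [this] at hlim'
      have hRz' : R z' := hext p hp z' hzp hz'p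
      -- If the remaining time stayed bounded, y would lie on the orbit of z' and hence begin at p;
      -- the chain would end at y, giving R(y), contrary to assumption.
      have hret' : Tendsto (fun s => S.ret s - t' s) u atTop := by
        by_contra hcon
        rw [tendsto_atTop] at hcon
        push Not at hcon
        obtain ⟨B, hB⟩ := hcon
        have hI : ∀ᶠ s in (u : Filter ℝ), S.ret s - t' s ∈ Icc 0 B := by
          filter_upwards [hB, hgood] with s h1 h2
          exact ⟨by linarith [h2.1.2], h1.le⟩
        obtain ⟨L, -, hL⟩ := isCompact_Icc.ultrafilter_le_nhds
          (u.map fun s => S.ret s - t' s) (le_principal_iff.2 hI)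
        have hL : Tendsto (fun s => S.ret s - t' s) u (𝓝 L) := hL
        have h1 : Tendsto (fun s => φ (S.ret s - t' s) (φ (t' s) (S.σ s))) u (𝓝 (φ L z')) :=
          (hcont.tendsto (L, z')).comp (hL.prodMk_nhds hz')
        have h2 : y = φ L z' := by
          refine tendsto_nhds_unique ((hlim.mono_left hul).congr' ?_) h1
          filter_upwards [hreg] with s hs
          rw [← φ.map_add, sub_add_cancel, flow_ret (mem_Icc_of_regular hs) hs.2.1]
        refine hRy (hext p hp y hzp ?_)
        have h3 : (fun r => φ r y) = (fun r => φ r z') ∘ fun r => r + L := by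
          funext r
          simp only [Function.comp_apply, φ.map_add, h2]
        rw [h3]
        exact hz'p.comp (tendsto_atBot_add_const_right _ L tendsto_id)
      refine ⟨t', z', hz'r, ht'top.eventually_ge_atTop 0, hret', hz',
        fun p hp y => hstep z' hz'r hRz' p hp y, ?_⟩
      filter_upwards [hE, hgood, hfar 2, ht'top.eventually_gt_atTop 1] with s hEs h1 h2 h3
      obtain ⟨E, hcard, hpair, hmem⟩ := hEs
      have hlt : ∀ e ∈ E, e + 2 < t' s := fun e he => by linarith [(hmem e he).2.1]
      refine ⟨insert (t' s) E, ?_, ?_, ?_⟩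
      · rw [Finset.card_insert_of_notMem fun hin => by linarith [hlt _ hin], hcard]
      · rw [Finset.coe_insert]
        refine hpair.insert fun e he _ => ?_
        have h4 := hlt e he
        rw [abs_sub_comm e, and_self, abs_of_pos (by linarith)]
        linarith
      · intro e he
        rcases Finset.mem_insert.1 he with rfl | he
        · exact ⟨h3, le_rfl, mem_biUnion hp h1.2.1⟩
        · exact ⟨(hmem e he).1, by linarith [hlt e he], (hmem e he).2.2⟩
  obtain ⟨t, z, -, -, hret, -, -, hE⟩ := key (K + 1)
  obtain ⟨s, ⟨E, hcard, hpair, hmem⟩, hs1, hs2⟩ :=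
    (hE.and ((Eventually.filter_mono hul hK).and (hret.eventually_gt_atTop 1))).exists
  have := hs1 E hpair fun e he => ⟨(hmem e he).1, by linarith [(hmem e he).2.1], (hmem e he).2.2⟩
  omega

end IsSide

end FlowSection

/-! ### Extension of a piecewise translation to an interval exchange -/

open MeasureTheory in
/-- An injective piecewise translation of `[a, b)` into itself is onto. -/
theorem surjOn_of_piecewise_add {a b : ℝ} {T : ℝ → ℝ} (hmaps : MapsTo T (Ico a b) (Ico a b))
    (hinj : InjOn T (Ico a b)) {N : ℕ} {α : Fin (N + 1) → ℝ} {σ : Fin N → ℝ} (hα : StrictMono α)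
    (h0 : α 0 = a) (hlast : α (Fin.last N) = b)
    (hT : ∀ i : Fin N, ∀ x ∈ Ico (α i.castSucc) (α i.succ), T x = x + σ i) :
    SurjOn T (Ico a b) (Ico a b) := by
  have hcover : Ico a b = ⋃ i : Fin N, Ico (α i.castSucc) (α i.succ) := by
    apply Subset.antisymm
    · rintro x ⟨hax, hxb⟩
      have key : ∀ k : Fin (N + 1), x < α k → x ∈ ⋃ i : Fin N, Ico (α i.castSucc) (α i.succ) := by
        intro k
        induction k using Fin.induction with
        | zero => exact fun h => absurd hax (by rw [← h0]; exact not_le.2 h)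
        | succ i ih =>
          intro h
          by_cases hx : x < α i.castSucc
          · exact ih hx
          · exact mem_iUnion.2 ⟨i, not_lt.1 hx, h⟩
      exact key _ (hlast ▸ hxb)
    · refine iUnion_subset fun i => Ico_subset_Ico ?_ ?_
      · rw [← h0]
        exact hα.monotone (Fin.zero_le _)
      · rw [← hlast]
        exact hα.monotone (Fin.le_last _)
  have hsub : ∀ i : Fin N, Ico (α i.castSucc) (α i.succ) ⊆ Ico a b := fun i =>
    hcover ▸ subset_iUnion (fun i : Fin N => Ico (α i.castSucc) (α i.succ)) i
  have hdisj : Pairwise (Function.onFun Disjoint fun i : Fin N => Ico (α i.castSucc) (α i.succ)) := by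
    refine (pairwise_disjoint_on _).2 fun i j hij => disjoint_left.2 fun x hi hj => ?_
    exact absurd (hi.2.trans_le (hα.monotone (Fin.succ_le_castSucc_iff.2 hij))) (not_lt.2 hj.1)
  have himg : ∀ i : Fin N, T '' Ico (α i.castSucc) (α i.succ) =
      Ico (α i.castSucc + σ i) (α i.succ + σ i) := fun i => by
    rw [← image_add_const_Ico]
    exact image_congr (hT i)
  have hTdisj : Pairwise (Function.onFun Disjoint
      fun i : Fin N => Ico (α i.castSucc + σ i) (α i.succ + σ i)) := fun i j hij => by
    simp only [Function.onFun, ← himg]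
    rw [disjoint_left]
    rintro _ ⟨x, hx, rfl⟩ ⟨y, hy, hyx⟩
    exact disjoint_left.1 (hdisj hij) hx (hinj (hsub j hy) (hsub i hx) hyx ▸ hy)
  have hTcover : T '' Ico a b = ⋃ i : Fin N, Ico (α i.castSucc + σ i) (α i.succ + σ i) := by
    rw [hcover, image_iUnion]
    exact iUnion_congr himg
  have hvol : volume (T '' Ico a b) = volume (Ico a b) := by
    rw [hTcover, measure_iUnion hTdisj fun i => measurableSet_Ico, hcover,
      measure_iUnion hdisj fun i => measurableSet_Ico]
    simp [Real.volume_Ico]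
  have hmeas : MeasurableSet (T '' Ico a b) := by
    rw [hTcover]
    exact MeasurableSet.iUnion fun i => measurableSet_Ico
  have hnull : volume (Ico a b \ T '' Ico a b) = 0 := by
    rw [measure_sdiff hmaps.image_subset hmeas.nullMeasurableSet (by simp [hvol, Real.volume_Ico]),
      hvol, tsub_self]
  -- The image has full measure and is a finite union of intervals closed on the left. A missed
  -- point would therefore have a missed interval to its right, of positive measure.
  intro y hy
  by_contra hyT
  have h1 : ∀ᶠ z in 𝓝[>] y, z ∈ Ico a b \ T '' Ico a b := by
    have h2 : ∀ i : Fin N, ∀ᶠ z in 𝓝[>] y, z ∉ Ico (α i.castSucc + σ i) (α i.succ + σ i) := by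
      intro i
      have hyi : y ∉ Ico (α i.castSucc + σ i) (α i.succ + σ i) := fun h =>
        hyT (hTcover ▸ mem_iUnion.2 ⟨i, h⟩)
      by_cases hlt : y < α i.castSucc + σ i
      · filter_upwards [Ioo_mem_nhdsGT hlt] with z hz h
        exact absurd hz.2 (not_lt.2 h.1)
      · filter_upwards [self_mem_nhdsWithin] with z hz h
        exact hyi ⟨not_lt.1 hlt, lt_trans hz h.2⟩
    filter_upwards [Ioo_mem_nhdsGT hy.2, eventually_all.2 h2] with z hz hz2
    refine ⟨⟨hy.1.trans hz.1.le, hz.2⟩, ?_⟩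
    rw [hTcover, mem_iUnion, not_exists]
    exact hz2
  obtain ⟨d, hd, hsubd⟩ := mem_nhdsGT_iff_exists_Ioo_subset.1 h1
  have h3 := measure_mono_null hsubd hnull
  rw [Real.volume_Ioo, ENNReal.ofReal_eq_zero] at h3
  exact absurd (sub_pos.2 hd) (not_lt.2 h3)

/-- An injective map that is a translation on every interval avoiding a finite set extends to a
right-continuous interval exchange. -/
theorem exists_isIET {a b : ℝ} (hab : a < b) {D : Set ℝ} (hD : D.Finite) (ha : a ∈ D) (hb : b ∈ D)
    (hDI : D ⊆ Icc a b) {f : ℝ → ℝ} (hmaps : MapsTo f (Icc a b \ D) (Ioo a b))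
    (hinj : InjOn f (Icc a b \ D))
    (htrans : ∀ c d, Ioo c d ⊆ Icc a b \ D → ∃ ρ, ∀ s ∈ Ioo c d, f s = s + ρ) :
    ∃ T : ℝ → ℝ, IsIET a b T ∧ (∀ x ∈ Icc a b \ D, T x = f x) ∧
      (∀ x ∈ Ico a b, ∃ d > x, Ioo x d ⊆ Icc a b \ D ∧ ∀ s ∈ Ioo x d, T s = s + (T x - x)) ∧
      ∀ x ∈ Ioc a b, ∃ c < x, ∃ l ∈ Icc a b, Ioo c x ⊆ Icc a b \ D ∧
        ∀ s ∈ Ioo c x, T s = s + (l - x) := by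
  have hDx : ∀ x, (D \ {x})ᶜ ∈ 𝓝 x := fun x =>
    (hD.subset sdiff_subset).isClosed.isOpen_compl.mem_nhds (by simp)
  have hright : ∀ x ∈ Ico a b, ∃ d > x, Ioo x d ⊆ Icc a b \ D := by
    intro x hx
    have : Icc a b \ D ∈ 𝓝[>] x := by
      filter_upwards [nhdsWithin_le_nhds (hDx x), Ioo_mem_nhdsGT hx.2] with s h1 h2
      exact ⟨⟨hx.1.trans h2.1.le, h2.2.le⟩, fun hs => h1 ⟨hs, h2.1.ne'⟩⟩
    obtain ⟨d, hd, h⟩ := mem_nhdsGT_iff_exists_Ioo_subset.1 this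
    exact ⟨d, hd, h⟩
  have hleft : ∀ x ∈ Ioc a b, ∃ c < x, Ioo c x ⊆ Icc a b \ D := by
    intro x hx
    have : Icc a b \ D ∈ 𝓝[<] x := by
      filter_upwards [nhdsWithin_le_nhds (hDx x), Ioo_mem_nhdsLT hx.1] with s h1 h2
      exact ⟨⟨h2.1.le, h2.2.le.trans hx.2⟩, fun hs => h1 ⟨hs, h2.2.ne⟩⟩
    obtain ⟨d, hd, h⟩ := mem_nhdsLT_iff_exists_Ioo_subset.1 this
    exact ⟨d, hd, h⟩
  -- T(x) is defined as x + r(x), where r(x) is the translation of f just to the right of x.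
  have hr : ∀ x, ∃ ρ, x ∈ Ico a b → ∀ᶠ s in 𝓝[>] x, s ∈ Icc a b \ D ∧ f s = s + ρ := by
    intro x
    by_cases hx : x ∈ Ico a b
    · obtain ⟨d, hd, hsub⟩ := hright x hx
      obtain ⟨ρ, hρ⟩ := htrans x d hsub
      exact ⟨ρ, fun _ => (eventually_of_mem (Ioo_mem_nhdsGT hd) fun s hs => ⟨hsub hs, hρ s hs⟩)⟩
    · exact ⟨0, fun h => absurd h hx⟩
  choose r hr using hr
  have hpiece : ∀ c d, c < d → c ∈ Ico a b → Ioo c d ⊆ Icc a b \ D →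
      ∃ ρ, (∀ s ∈ Ioo c d, f s = s + ρ) ∧ ∀ x ∈ Ico c d, x + r x = x + ρ := by
    intro c d hcd hc hsub
    obtain ⟨ρ, hρ⟩ := htrans c d hsub
    refine ⟨ρ, hρ, fun x hx => ?_⟩
    have hxI : x ∈ Ico a b := by
      refine ⟨hc.1.trans hx.1, ?_⟩
      obtain ⟨z, hz⟩ := exists_between hx.2
      exact hz.1.trans_le (hsub ⟨hx.1.trans_lt hz.1, hz.2⟩).1.2
    obtain ⟨s, h1, h2⟩ := ((hr x hxI).and (Ioo_mem_nhdsGT hx.2)).exists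
    have h3 := hρ s ⟨hx.1.trans_lt h2.1, h2.2⟩
    linarith [h1.2]
  have hoff : ∀ x ∈ Icc a b \ D, x + r x = f x := by
    intro x hx
    have hxa : a < x := hx.1.1.lt_of_ne fun he => hx.2 (he ▸ ha)
    have hxb : x < b := hx.1.2.lt_of_ne fun he => hx.2 (he ▸ hb)
    obtain ⟨d, hd, hsub⟩ := hright x ⟨hxa.le, hxb⟩
    obtain ⟨c, hc, hsub'⟩ := hleft x ⟨hxa, hxb.le⟩
    obtain ⟨c', hc', hcx⟩ := exists_between (max_lt hc hxa)
    obtain ⟨ρ, h1, h2⟩ := hpiece c' d (hcx.trans hd)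
      ⟨(le_max_right _ _).trans hc'.le, hcx.trans hxb⟩ fun s hs => by
        rcases lt_trichotomy s x with h | rfl | h
        · exact hsub' ⟨((le_max_left _ _).trans_lt hc').trans hs.1, h⟩
        · exact hx
        · exact hsub ⟨h, hs.2⟩
    rw [h2 x ⟨hcx.le, hd⟩, h1 x ⟨hcx, hd⟩]
  have hmapsT : MapsTo (fun x => x + r x) (Ico a b) (Ico a b) := by
    intro x hx
    constructor
    · have ht : Tendsto (fun s => s + r x) (𝓝[>] x) (𝓝 (x + r x)) :=
        ((continuous_id.add continuous_const).tendsto x).mono_left nhdsWithin_le_nhds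
      refine ge_of_tendsto ht ((hr x hx).mono fun s hs => ?_)
      rw [← hs.2]
      exact (hmaps hs.1).1.le
    · obtain ⟨s, h1, h2⟩ := ((hr x hx).and self_mem_nhdsWithin).exists
      have h3 := (hmaps h1.1).2
      rw [h1.2] at h3
      exact (add_lt_add_left (mem_Ioi.1 h2) _).trans h3
  have hinjT : InjOn (fun x => x + r x) (Ico a b) := by
    intro x hx y hy hxy
    have hxy : x + r x = y + r y := hxy
    -- If T(x) = T(y), this shift matches right neighbourhoods of x and y on which f has equal
    -- values, so injectivity of f forces x = y.
    have hsh : Tendsto (fun s => s + (y - x)) (𝓝[>] x) (𝓝[>] y) := by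
      refine tendsto_nhdsWithin_iff.2 ⟨?_, ?_⟩
      · have : Tendsto (fun s => s + (y - x)) (𝓝 x) (𝓝 (x + (y - x))) :=
          (continuous_id.add continuous_const).tendsto x
        rw [add_sub_cancel] at this
        exact this.mono_left nhdsWithin_le_nhds
      · filter_upwards [self_mem_nhdsWithin] with s hs
        rw [mem_Ioi] at hs ⊢
        linarith
    obtain ⟨s, h1, h2⟩ := ((hr x hx).and (hsh.eventually (hr y hy))).exists
    have := hinj h1.1 h2.1 (by rw [h1.2, h2.2]; linarith)
    linarith
  refine ⟨fun x => x + r x, ?_, hoff, ?_, ?_⟩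
  -- The breakpoints are all of D in increasing order; a and b come first and last.
  · obtain ⟨N, hN⟩ : ∃ N, hD.toFinset.card = N + 1 :=
      Nat.exists_eq_succ_of_ne_zero (Finset.card_ne_zero_of_mem (hD.mem_toFinset.2 ha))
    set α := hD.toFinset.orderEmbOfFin hN with hαdef
    have hmem : ∀ k, α k ∈ D := fun k => hD.mem_toFinset.1 (Finset.orderEmbOfFin_mem _ hN k)
    have hex : ∀ x ∈ D, ∃ k, α k = x := fun x hx => by
      have : x ∈ range α := by
        rw [hαdef, Finset.range_orderEmbOfFin]
        exact hD.mem_toFinset.2 hx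
      exact this
    have h0 : α 0 = a := by
      obtain ⟨k, hk⟩ := hex a ha
      exact le_antisymm (hk ▸ α.monotone (Fin.zero_le k)) (hDI (hmem 0)).1
    have hlast : α (Fin.last N) = b := by
      obtain ⟨k, hk⟩ := hex b hb
      exact le_antisymm (hDI (hmem _)).2 (hk ▸ α.monotone (Fin.le_last k))
    have hlt : ∀ i : Fin N, α i.castSucc < α i.succ := fun i => α.strictMono i.castSucc_lt_succ
    have hgap : ∀ i : Fin N, Ioo (α i.castSucc) (α i.succ) ⊆ Icc a b \ D := by
      intro i s hs
      refine ⟨⟨(hDI (hmem _)).1.trans hs.1.le, hs.2.le.trans (hDI (hmem _)).2⟩, fun hsD => ?_⟩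
      obtain ⟨k, rfl⟩ := hex s hsD
      have h1 := α.lt_iff_lt.1 hs.1
      have h2 := α.lt_iff_lt.1 hs.2
      exact absurd h2 (not_lt.2 (Fin.castSucc_lt_iff_succ_le.1 h1))
    choose σ _ hσ using fun i => hpiece _ _ (hlt i)
      ⟨(hDI (hmem _)).1, (hlt i).trans_le (hDI (hmem _)).2⟩ (hgap i)
    refine ⟨⟨hmapsT, hinjT, surjOn_of_piecewise_add hmapsT hinjT α.strictMono h0 hlast hσ⟩,
      N, α, σ, ?_, α.strictMono, h0, hlast, hσ⟩
    rw [Nat.one_le_iff_ne_zero]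
    rintro rfl
    exact hab.ne (h0.symm.trans hlast)
  · intro x hx
    obtain ⟨d, hd, hsub⟩ := hright x hx
    obtain ⟨ρ, -, h2⟩ := hpiece x d hd hx hsub
    refine ⟨d, hd, hsub, fun s hs => ?_⟩
    have h3 := h2 x ⟨le_rfl, hd⟩
    have h4 := h2 s ⟨hs.1.le, hs.2⟩
    simp only
    linarith
  · intro x hx
    obtain ⟨c, hc, hsub⟩ := hleft x hx
    obtain ⟨ρ, hρ⟩ := htrans c x hsub
    have ht : Tendsto (fun s => s + ρ) (𝓝[<] x) (𝓝 (x + ρ)) :=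
      ((continuous_id.add continuous_const).tendsto x).mono_left nhdsWithin_le_nhds
    refine ⟨c, hc, x + ρ, ?_, hsub, fun s hs => ?_⟩
    · refine isClosed_Icc.mem_of_tendsto ht (eventually_of_mem (Ioo_mem_nhdsLT hc) fun s hs => ?_)
      rw [← hρ s hs]
      exact Ioo_subset_Icc_self (hmaps (hsub hs))
    · exact (hoff s (hsub hs)).trans (by rw [hρ s hs, add_sub_cancel_left])

/-! ### Application to area-preserving flows and proof of the theorem -/

namespace AreaPreservingFlow

variable {M : Type*} [TopologicalSpace M] [ChartedSpace (EuclideanSpace ℝ (Fin 2)) M]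
  [IsManifold (𝓡 2) ∞ M] {F : AreaPreservingFlow M}

theorem rest_eq_fixedPoints [T2Space M] (F : AreaPreservingFlow M) :
    F.φ.rest = F.fixedPoints :=
  Subset.antisymm (fun _ h => F.mem_fixedPoints_of_flow_eq h)
    fun _ h => F.flow_eq_of_mem_fixedPoints h

theorem hasSections [T2Space M] (hfix : F.fixedPoints.Finite) : F.φ.HasSections := by
  intro q hq O hO
  rw [F.rest_eq_fixedPoints] at hq
  obtain ⟨lo, hi, σ, U, H, h, hv, hsub⟩ := exists_isHamiltonianArc hfix hq hO
  exact ⟨h.flowSection, hv, hsub⟩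

theorem finite_stable_trajectories [T2Space M] (hsep : F.separatrices.Finite) :
    {O : Set M | ∃ z, z ∉ F.φ.rest ∧ O = range (fun t => F.φ t z) ∧
      ∃ p ∈ F.φ.rest, Tendsto (fun t => F.φ t z) atTop (𝓝 p)}.Finite := by
  refine hsep.subset ?_
  rintro O ⟨z, hz, hO, p, hp, hlim⟩
  rw [F.rest_eq_fixedPoints] at hz hp
  exact Or.inl ⟨z, hz, hO, p, hp, hlim⟩

theorem ExistsSeparatrixPath.of_isSaddle {x y p : M} (hp : F.IsSaddle p) (hx : F.EndsAt x p)
    (hy : F.BeginsAt y p) : F.ExistsSeparatrixPath x y :=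
  ⟨0, fun _ => p, fun _ => hp, hx, fun i => i.elim0, hy⟩

theorem ExistsSeparatrixPath.append {x z y p : M} (h : F.ExistsSeparatrixPath x z)
    (hz : z ∉ F.fixedPoints) (hp : F.IsSaddle p) (hzp : F.EndsAt z p) (hy : F.BeginsAt y p) :
    F.ExistsSeparatrixPath x y := by
  obtain ⟨n, s, hs, hx, hc, hlast⟩ := h
  refine ⟨n + 1, Fin.snoc (α := fun _ => M) s p, fun i => ?_, ?_, fun i => ?_, ?_⟩
  · refine Fin.lastCases ?_ (fun j => ?_) i
    · rwa [Fin.snoc_last]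
    · rw [Fin.snoc_castSucc]
      exact hs j
  · rw [← Fin.castSucc_zero, Fin.snoc_castSucc]
    exact hx
  · refine Fin.lastCases ?_ (fun j => ?_) i
    · rw [Fin.snoc_castSucc, Fin.succ_last, Fin.snoc_last]
      exact ⟨z, hz, hlast, hzp⟩
    · rw [Fin.snoc_castSucc, Fin.succ_castSucc, Fin.snoc_castSucc]
      exact hc j
  · rwa [Fin.snoc_last]

namespace Transversal

variable {a b : ℝ}

theorem notMem_fixedPoints (Γ : F.Transversal a b) {s : ℝ} (hs : s ∈ Icc a b) :
    Γ.γ s ∉ F.fixedPoints :=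
  Γ.isHamiltonianArc.notMem_fixedPoints s hs

variable [T2Space M]

/-- A transversal is a cross-section of the flow. -/
def flowSection (Γ : F.Transversal a b) : FlowSection F.φ := Γ.isHamiltonianArc.flowSection

theorem isFirstReturn_next (Γ : F.Transversal a b) {s : ℝ} (hs : s ∈ Icc a b)
    (h : (Γ.flowSection.hits (Γ.γ s)).Nonempty) :
    F.IsFirstReturn Γ.carrier (Γ.γ s) (Γ.γ (Γ.flowSection.next s)) :=
  ⟨Γ.flowSection.ret s, FlowSection.isLeast_ret (S := Γ.flowSection) hs h,
    (FlowSection.flow_ret (S := Γ.flowSection) hs h).symm⟩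

theorem isFirstReturn_iff (Γ : F.Transversal a b) {s v : ℝ} (hs : s ∈ Icc a b)
    (hv : v ∈ Icc a b) : F.IsFirstReturn Γ.carrier (Γ.γ s) (Γ.γ v) ↔
      (Γ.flowSection.hits (Γ.γ s)).Nonempty ∧ Γ.flowSection.next s = v := by
  constructor
  · rintro ⟨τ, hτ, h⟩
    exact ⟨⟨τ, hτ.1⟩, FlowSection.next_eq (S := Γ.flowSection) hv hτ h.symm⟩
  · rintro ⟨h, rfl⟩
    exact Γ.isFirstReturn_next hs h

/-- The saddle in one definition and the stationary point in the other agree, because a fixed point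
to which a nonfixed orbit converges is a saddle. -/
theorem exceptional_eq_singular (hfix : F.fixedPoints.Finite) (Γ : F.Transversal a b) :
    Γ.exceptional = Γ.flowSection.singular := by
  ext s
  refine and_congr_right fun hs => or_congr Iff.rfl (or_congr ?_ (and_congr ?_ ?_))
  · rw [Γ.isFirstReturn_iff hs (left_mem_Icc.2 Γ.lt.le),
      Γ.isFirstReturn_iff hs (right_mem_Icc.2 Γ.lt.le), ← and_or_left]
    rfl
  · rw [eq_empty_iff_forall_notMem]
    exact forall_congr' fun t => not_and.symm
  · rw [F.rest_eq_fixedPoints]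
    exact ⟨fun ⟨p, _, h⟩ => ⟨p, h.1, h.2⟩,
      fun ⟨p, hp, h⟩ => ⟨p, EndsAt.isSaddle hfix (Γ.notMem_fixedPoints hs) ⟨hp, h⟩, hp, h⟩⟩

/-- The one-sided limits of the first return map at a nonreturning point are the ends of
separatrix paths. -/
theorem existsSeparatrixPath [CompactSpace M] (hfix : F.fixedPoints.Finite)
    (Γ : F.Transversal a b) {l : Filter ℝ} {c v : ℝ} (h : Γ.flowSection.IsSide l c)
    (hc : Γ.flowSection.hits (Γ.γ c) = ∅) (hv : v ∈ Icc a b)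
    (hnext : ∀ᶠ s in l, Γ.flowSection.next s = s + (v - c)) :
    F.ExistsSeparatrixPath (Γ.γ c) (Γ.γ v) := by
  have hrest := F.rest_eq_fixedPoints
  have hcI : c ∈ Icc a b := h.mem
  have hlim : Tendsto Γ.flowSection.next l (𝓝[Icc a b] v) := by
    refine tendsto_nhdsWithin_iff.2 ⟨?_, h.eventually_regular.mono fun s hs =>
      Ioo_subset_Icc_self hs.2.2⟩
    have : Tendsto (fun s => s + (v - c)) (𝓝 c) (𝓝 (c + (v - c))) :=
      (continuous_id.add continuous_const).tendsto c
    rw [add_sub_cancel] at this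
    exact (this.mono_left h.le_nhds).congr' (hnext.mono fun _ hs => hs.symm)
  refine h.reach (hasSections hfix) (hrest ▸ hfix) hc
    ((Γ.flowSection.continuousOn v hv).tendsto.comp hlim)
    (F.ExistsSeparatrixPath (Γ.γ c)) ?_ ?_
  · intro p hp y hcp hpy
    rw [hrest] at hp
    exact .of_isSaddle (EndsAt.isSaddle hfix (Γ.notMem_fixedPoints hcI) ⟨hp, hcp⟩)
      ⟨hp, hcp⟩ ⟨hp, hpy⟩
  · intro z hz hR p hp y hzp hpy
    rw [hrest] at hp hz
    exact hR.append hz (EndsAt.isSaddle hfix hz ⟨hp, hzp⟩) ⟨hp, hzp⟩ ⟨hp, hpy⟩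

end Transversal

end AreaPreservingFlow

theorem mainTheorem8 {M : Type*} [TopologicalSpace M] [T2Space M] [CompactSpace M]
    [ConnectedSpace M] [ChartedSpace (EuclideanSpace ℝ (Fin 2)) M] [IsManifold (𝓡 2) ∞ M]
    (F : AreaPreservingFlow M) (hfix : F.fixedPoints.Finite) (hsep : F.separatrices.Finite)
    (a b : ℝ) (Γ : F.Transversal a b) :
    Γ.exceptional.Finite ∧
    ∃ T : ℝ → ℝ, IsIET a b T ∧
      (∀ x ∈ Ico a b \ Γ.exceptional, F.IsFirstReturn Γ.carrier (Γ.γ x) (Γ.γ (T x))) ∧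
      (∀ x ∈ Ico a b, ¬ ContinuousWithinAt T (Ico a b) x → x ∈ Γ.exceptional) ∧
      (∀ x ∈ Γ.exceptional ∩ Ico a b, (¬ ∃ y, F.IsFirstReturn Γ.carrier (Γ.γ x) y) →
        F.ExistsSeparatrixPath (Γ.γ x) (Γ.γ (T x)) ∧
        (a < x → ∃ l ∈ Icc a b, Tendsto T (𝓝[<] x) (𝓝 l) ∧
          F.ExistsSeparatrixPath (Γ.γ x) (Γ.γ l))) := by
  have hstab := AreaPreservingFlow.finite_stable_trajectories hsep
  have hD : Γ.exceptional.Finite :=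
    Γ.exceptional_eq_singular hfix ▸ FlowSection.finite_singular hstab
  have hreg : ∀ s ∈ Icc a b \ Γ.exceptional, s ∈ Γ.flowSection.regular := fun s hs =>
    FlowSection.mem_regular (AreaPreservingFlow.hasSections hfix)
      (F.rest_eq_fixedPoints ▸ hfix) hstab hs.1 (Γ.exceptional_eq_singular hfix ▸ hs.2)
  have hadd : ∀ c d, Ioo c d ⊆ Icc a b \ Γ.exceptional →
      ∃ ρ, ∀ s ∈ Ioo c d, Γ.flowSection.next s = s + ρ := fun c d h =>
    FlowSection.exists_next_eq_add isOpen_Ioo isPreconnected_Ioo fun s hs => hreg s (h hs)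
  obtain ⟨T, hT, hTnext, hTright, hTleft⟩ := exists_isIET Γ.lt hD
    ⟨left_mem_Icc.2 Γ.lt.le, Or.inl (Or.inl rfl)⟩
    ⟨right_mem_Icc.2 Γ.lt.le, Or.inl (Or.inr rfl)⟩ (fun s hs => hs.1)
    (fun s hs => (hreg s hs).2.2)
    (fun s hs t ht => FlowSection.injOn_next (S := Γ.flowSection) hs.1 ht.1
      (hreg s hs).2.1 (hreg t ht).2.1) hadd
  refine ⟨hD, T, hT, ?_, ?_, ?_⟩
  · rintro x ⟨hx, hxD⟩
    have hxI := Ico_subset_Icc_self hx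
    rw [hTnext x ⟨hxI, hxD⟩]
    exact Γ.isFirstReturn_next hxI (hreg x ⟨hxI, hxD⟩).2.1
  · intro x hx hcont
    by_contra hxD
    have hxr := hreg x ⟨Ico_subset_Icc_self hx, hxD⟩
    refine hcont (ContinuousAt.continuousWithinAt ?_)
    -- Off 𝒟 the point is regular, so T is a single translation on both sides of it.
    have hev : T =ᶠ[𝓝 x] fun s => Γ.flowSection.next x + (s - x) := by
      filter_upwards [FlowSection.eventually_regular hxr one_pos,
        Icc_mem_nhds hxr.1.1 hxr.1.2, hD.isClosed.isOpen_compl.mem_nhds hxD] with s h1 h2 h3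
      rw [hTnext s ⟨h2, h3⟩, h1.2.2]
    exact (continuousAt_congr hev).2 (by fun_prop)
  · rintro x ⟨-, hx⟩ hno
    have hxI := Ico_subset_Icc_self hx
    have hempty : Γ.flowSection.hits (Γ.γ x) = ∅ := by
      by_contra hne
      exact hno ⟨_, Γ.isFirstReturn_next hxI (nonempty_iff_ne_empty.2 hne)⟩
    -- Right regular parameters have returns tending to T(x), left ones to the left limit of T; the
    -- chain argument applies to each side.
    constructor
    · obtain ⟨d, hd, hsub, hd'⟩ := hTright x hx
      refine Γ.existsSeparatrixPath hfix
        (.right hxI hd fun s hs => hreg s (hsub hs)) hempty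
        (Ico_subset_Icc_self (hT.1.mapsTo hx)) ?_
      filter_upwards [Ioo_mem_nhdsGT hd] with s hs
      rw [← hTnext s (hsub hs), hd' s hs]
    · intro hax
      obtain ⟨c, hc, l, hl, hsub, hc'⟩ := hTleft x ⟨hax, hxI.2⟩
      refine ⟨l, hl, ?_, Γ.existsSeparatrixPath hfix
        (.left hxI hc fun s hs => hreg s (hsub hs)) hempty hl ?_⟩
      · have h1 : Tendsto (fun s => s + (l - x)) (𝓝 x) (𝓝 (x + (l - x))) :=
          (continuous_id.add continuous_const).tendsto x
        rw [add_sub_cancel] at h1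
        exact (h1.mono_left nhdsWithin_le_nhds).congr'
          (eventually_of_mem (Ioo_mem_nhdsLT hc) fun s hs => (hc' s hs).symm)
      · filter_upwards [Ioo_mem_nhdsLT hc] with s hs
        rw [← hTnext s (hsub hs), hc' s hs]
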